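/- Let $m\ge 2$, let $\mathcal S(\mathbb R^m)$ be the space of complex-valued rapidly decreasing functions, $\Delta=\sum_i\partial_{x_i}^2$, $|x|^2=\sum_i x_i^2$, $\mathbb E=\sum_i x_i\partial_{x_i}$, and put $$h=-\tfrac{\Delta}{2}+\tfrac{|x|^2}{2},\quad e=-\tfrac{\Delta}{4}-\tfrac{|x|^2}{4}+\tfrac{\mathbb E}{2}+\tfrac m4,\quad f=\tfrac{\Delta}{4}+\tfrac{|x|^2}{4}+\tfrac{\mathbb E}{2}+\tfrac m4,\quad \Omega=1+h^2+2ef+2fe.$$ For each $k\ge 0$ let $\{H_k^{(\ell)}\}_\ell$ be a basis of the space $\mathcal H_k$ of complex homogeneous polynomials of degree $k$ in $m$ variables annihilated by $\Delta$, and let $$\phi_{j,k,\ell}(x)=2^j j!\,L_j^{m/2+k-1}(|x|^2)\,H_k^{(\ell)}(x)\,e^{-|x|^2/2},\qquad j,k\ge 0,$$ with $L_j^\alpha$ the generalized Laguerre polynomials. Both $h$ and $\Omega$ are diagonal on $\{\phi_{j,k,\ell}\}$, with real eigenvalues $2j+k+\frac m2$ and $(k+\frac m2-1)^2$, and a function of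 $h$ or of $\Omega$ is the operator acting on the orthogonal eigenspaces (whose span is dense in $L^2(\mathbb R^m)$) by the corresponding function of the eigenvalue. In particular $e^{i\frac\pi2F(\sqrt\Omega)}$ acts as $e^{i\frac\pi2F(\sqrt\nu)}$ on the eigenspace of $\Omega$ with eigenvalue $\nu$. Put $E_n(x)=\frac{2}{(2n)!}\prod_{l=0}^{n-1}(x^2-l^2)$ for $n\ge1$, $D_n(x)=\frac1{(2n)!}\prod_{l=0}^{n-1}\bigl(x^2-(l+\frac12)^2\bigr)$ for $n\ge 1$, and $$\mathcal E_{0101}=E_1,\quad \mathcal E_{0010}=E_2+2E_3,\quad \mathcal E_{0001}=\sum_{n\ge1}\Bigl(E_{2^n+1}+\sum_{j=1}^{n-1}2E_{2^n+1+2^j}\Bigr)\quad\text{on the integers},$$ $$\mathcal D_{0110}=D_1+2D_2,\quad \mathcal D_{0011}=\sum_{n\ge1}\Bigl(D_{2^n}+\sum_{j=1}^{n-1}2D_{2^n+2^j}\Bigr),\quad \mathcal D_{0010}=2D_3+\sum_{n\ge0}\Bigl(D_{2^n+1}+\sum_{j=1}^{n-1}2D_{2^n+1+2^j}\Bigr)\quad\text{on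 }\mathbb Z+\tfrac12$$ (at each such point only finitely many terms are nonzero). **Theorem.** Let $T:\mathcal S(\mathbb R^m)\to\mathcal S(\mathbb R^m)$ be a linear operator such that (i) $T\circ\Delta=-|x|^2\circ T$ and $T\circ|x|^2=-\Delta\circ T$; (ii) $T\phi_{j,k,\ell}=\mu_{j,k}\,\phi_{j,k,\ell}$ for all $j,k,\ell$, with $\mu_{j,k}\in\mathbb C$; (iii) $T^4=\mathrm{id}$; (iv) $\mu_{j,k+4}=\mu_{j,k}$ for all $j,k$. Then there are $a,b,c,d\in\{0,1,2,3\}$ such that $$T=e^{i\frac\pi2F(\sqrt\Omega)}\,e^{i\frac\pi2(h-\frac m2)},$$ where $F=a+b\,\mathcal E_{0101}+c\,\mathcal E_{0010}+d\,\mathcal E_{0001}$ if $m$ is even and $F=a+b\,\mathcal D_{0110}+c\,\mathcal D_{0011}+d\,\mathcal D_{0010}$ if $m$ is odd. Conversely, for all $a,b,c,d\in\{0,1,2,3\}$ the two exponentials map $\mathcal S(\mathbb R^m)$ into itself, and their product $T$ satisfies (i)–(iv). -/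

import Mathlib

open scoped SchwartzMap ContDiff Nat
open MeasureTheory

noncomputable section

namespace GenFourier

/-- The Euclidean space `ℝ^m`. -/
abbrev Eu (m : ℕ) : Type := EuclideanSpace ℝ (Fin m)

/-- The space `𝓢(ℝ^m)` of complex valued rapidly decreasing functions. -/
abbrev Sch (m : ℕ) : Type := 𝓢(Eu m, ℂ)

/-- The Hilbert space `L²(ℝ^m)`. -/
abbrev L2 (m : ℕ) : Type := Lp ℂ 2 (volume : Measure (Eu m))

/-! ### The realization of `𝔰𝔩(2)` on `𝓢(ℝ^m)` -/

/-- The Laplace operator `Δ` on `𝓢(ℝ^m)`. -/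
def lap (m : ℕ) : Module.End ℂ (Sch m) :=
  (LineDeriv.laplacianCLM ℂ (Eu m) (Sch m)).toLinearMap

/-- Multiplication by `|x|²` on `𝓢(ℝ^m)`. -/
def normSq (m : ℕ) : Module.End ℂ (Sch m) :=
  (SchwartzMap.smulLeftCLM ℂ (fun x : Eu m => ((‖x‖ ^ 2 : ℝ) : ℂ))).toLinearMap

/-- Multiplication by the coordinate `x_i` on `𝓢(ℝ^m)`. -/
def coordMul (m : ℕ) (i : Fin m) : Module.End ℂ (Sch m) :=
  (SchwartzMap.smulLeftCLM ℂ (fun x : Eu m => ((x i : ℝ) : ℂ))).toLinearMap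

/-- The partial derivative `∂_{x_i}` on `𝓢(ℝ^m)`. -/
def partialDeriv (m : ℕ) (i : Fin m) : Module.End ℂ (Sch m) :=
  (LineDeriv.lineDerivOpCLM ℂ (Sch m) (EuclideanSpace.single i (1 : ℝ))).toLinearMap

/-- The Euler operator `∑ x_i ∂_{x_i}`. -/
def euler (m : ℕ) : Module.End ℂ (Sch m) :=
  ∑ i : Fin m, coordMul m i * partialDeriv m i

/-- `h = -Δ/2 + |x|²/2`. -/
def opH (m : ℕ) : Module.End ℂ (Sch m) :=
  -((1 / 2 : ℂ) • lap m) + (1 / 2 : ℂ) • normSq m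

/-- `e = -Δ/4 - |x|²/4 + 𝔼/2 + m/4`. -/
def opE (m : ℕ) : Module.End ℂ (Sch m) :=
  -((1 / 4 : ℂ) • lap m) - (1 / 4 : ℂ) • normSq m + (1 / 2 : ℂ) • euler m + ((m : ℂ) / 4) • 1

/-- `f = Δ/4 + |x|²/4 + 𝔼/2 + m/4`. -/
def opF (m : ℕ) : Module.End ℂ (Sch m) :=
  (1 / 4 : ℂ) • lap m + (1 / 4 : ℂ) • normSq m + (1 / 2 : ℂ) • euler m + ((m : ℂ) / 4) • 1

/-- The Casimir operator `Ω = 1 + h² + 2ef + 2fe`. -/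
def casimir (m : ℕ) : Module.End ℂ (Sch m) :=
  1 + opH m ^ 2 + (2 : ℂ) • (opE m * opF m) + (2 : ℂ) • (opF m * opE m)

/-! ### The Hermite basis -/

/-- The generalized Laguerre polynomial `L_j^α`, evaluated at `t`. -/
def laguerre (j : ℕ) (α t : ℝ) : ℝ :=
  ∑ n ∈ Finset.range (j + 1),
    Real.Gamma (j + α + 1) / ((n ! : ℝ) * ((j - n)! : ℝ) * Real.Gamma (n + α + 1)) * (-t) ^ n

/-- The space `ℋ_k` of spherical harmonics of degree `k`: homogeneous polynomials of degree `k`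
in `m` variables that are annihilated by the Laplace operator. -/
def sphericalHarmonics (m k : ℕ) : Submodule ℂ (MvPolynomial (Fin m) ℂ) :=
  MvPolynomial.homogeneousSubmodule (Fin m) ℂ k ⊓
    LinearMap.ker (∑ i : Fin m,
      ((MvPolynomial.pderiv i).toLinearMap ∘ₗ (MvPolynomial.pderiv i).toLinearMap :
        MvPolynomial (Fin m) ℂ →ₗ[ℂ] MvPolynomial (Fin m) ℂ))

/-- The value of a complex polynomial at a point of `ℝ^m`. -/
def polyVal {m : ℕ} (p : MvPolynomial (Fin m) ℂ) (x : Eu m) : ℂ :=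
  MvPolynomial.eval (fun i => ((x i : ℝ) : ℂ)) p

lemma one_add_pow_mul_exp_le (N : ℕ) (r : ℝ) (hr : 0 ≤ r) :
    (1 + r) ^ N * Real.exp (-(1 / 2) * r ^ 2) ≤ Real.exp (3 / 2) * (N ! : ℝ) := by
  have h1 : (1 + r) ^ N ≤ Real.exp (1 + r) * (N ! : ℝ) := by
    have := Real.pow_div_factorial_le_exp (1 + r) (by linarith) N
    rwa [div_le_iff₀ (by positivity)] at this
  have h2 : Real.exp (1 + r) * Real.exp (-(1 / 2) * r ^ 2) ≤ Real.exp (3 / 2) := by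
    rw [← Real.exp_add]
    exact Real.exp_le_exp.mpr (by nlinarith [sq_nonneg (r - 1)])
  calc (1 + r) ^ N * Real.exp (-(1 / 2) * r ^ 2)
      ≤ (Real.exp (1 + r) * (N ! : ℝ)) * Real.exp (-(1 / 2) * r ^ 2) := by gcongr
    _ = (Real.exp (1 + r) * Real.exp (-(1 / 2) * r ^ 2)) * (N ! : ℝ) := by ring
    _ ≤ _ := by gcongr

/-- The Gaussian `e^{-|x|²/2}` as a real valued rapidly decreasing function. -/
def gaussianReal (m : ℕ) : 𝓢(Eu m, ℝ) where
  toFun x := Real.exp (-(1 / 2) * ‖x‖ ^ 2)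
  smooth' := ((contDiff_const (c := (-(1 / 2) : ℝ))).mul (contDiff_norm_sq ℝ)).exp
  decay' k n := by
    obtain ⟨K, C, hC0, hC⟩ :=
      (Function.hasTemperateGrowth_norm_sq (Eu m)).norm_iteratedFDeriv_le_uniform n
    refine ⟨(n ! : ℝ) * (C + 1) ^ n * (Real.exp (3 / 2) * ((k + K * n)! : ℝ)), fun x => ?_⟩
    have key : ‖iteratedFDeriv ℝ n
        ((fun t : ℝ => Real.exp (-(1 / 2) * t)) ∘ fun x : Eu m => ‖x‖ ^ 2) x‖ ≤
        n ! * Real.exp (-(1 / 2) * ‖x‖ ^ 2) * ((C + 1) * (1 + ‖x‖) ^ K) ^ n := by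
      refine norm_iteratedFDeriv_comp_le (N := ∞) (by fun_prop) (contDiff_norm_sq ℝ)
        (by exact_mod_cast le_top) x ?_ ?_
      · intro i _
        rw [norm_iteratedFDeriv_eq_norm_iteratedDeriv, iteratedDeriv_exp_const_mul, norm_mul,
          norm_pow, Real.norm_eq_abs (Real.exp _), abs_of_pos (Real.exp_pos _)]
        refine mul_le_of_le_one_left (Real.exp_pos _).le (pow_le_one₀ (norm_nonneg _) ?_)
        norm_num
      · intro i hi hin
        have h1 : 1 ≤ (C + 1) * (1 + ‖x‖) ^ K :=
          one_le_mul_of_one_le_of_one_le (by linarith)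
            (one_le_pow₀ (by linarith [norm_nonneg x]))
        calc ‖iteratedFDeriv ℝ i (fun x : Eu m => ‖x‖ ^ 2) x‖
            ≤ C * (1 + ‖x‖) ^ K := hC i hin x
          _ ≤ (C + 1) * (1 + ‖x‖) ^ K := by gcongr; linarith
          _ ≤ _ := le_self_pow₀ h1 (by omega)
    calc ‖x‖ ^ k * ‖iteratedFDeriv ℝ n (fun x : Eu m => Real.exp (-(1 / 2) * ‖x‖ ^ 2)) x‖
        ≤ (1 + ‖x‖) ^ k *
          (n ! * Real.exp (-(1 / 2) * ‖x‖ ^ 2) * ((C + 1) * (1 + ‖x‖) ^ K) ^ n) := by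
          gcongr
          · linarith [norm_nonneg x]
          · exact key
      _ = (n ! : ℝ) * (C + 1) ^ n *
          ((1 + ‖x‖) ^ (k + K * n) * Real.exp (-(1 / 2) * ‖x‖ ^ 2)) := by
          rw [mul_pow, ← pow_mul, pow_add]; ring
      _ ≤ _ := by
          exact mul_le_mul_of_nonneg_left (one_add_pow_mul_exp_le _ _ (norm_nonneg x))
            (by positivity)

/-- The Gaussian `e^{-|x|²/2}` as an element of `𝓢(ℝ^m)`. -/
def gaussian (m : ℕ) : Sch m :=
  SchwartzMap.postcompCLM Complex.ofRealCLM (gaussianReal m)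

/-- The Hermite function
`φ_j(H)(x) = 2^j j! L_j^{m/2+k-1}(|x|²) H(x) e^{-|x|²/2}` attached to `j`, `k` and a
polynomial `H` (a spherical harmonic of degree `k` in the applications). -/
def hermiteFun (m j k : ℕ) (H : MvPolynomial (Fin m) ℂ) : Sch m :=
  SchwartzMap.smulLeftCLM ℂ
    (fun x : Eu m => (2 : ℂ) ^ j * (j ! : ℂ) *
      (laguerre j ((m : ℝ) / 2 + k - 1) (‖x‖ ^ 2) : ℂ) * polyVal H x) (gaussian m)

lemma polyVal_hasTemperateGrowth {m : ℕ} (p : MvPolynomial (Fin m) ℂ) :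
    (fun x : Eu m => polyVal p x).HasTemperateGrowth := by
  induction p using MvPolynomial.induction_on with
  | C a => simp [polyVal]
  | add p q hp hq => simpa [polyVal] using! hp.add hq
  | mul_X p i hp =>
    have hi : (fun x : Eu m => ((x i : ℝ) : ℂ)).HasTemperateGrowth :=
      (Complex.ofRealCLM.comp (EuclideanSpace.proj (𝕜 := ℝ) i)).hasTemperateGrowth
    simpa [polyVal] using! hp.mul hi

/-- The pointwise formula for the Hermite functions. -/
lemma hermiteFun_apply (m j k : ℕ) (H : MvPolynomial (Fin m) ℂ) (x : Eu m) :
    hermiteFun m j k H x = (2 : ℂ) ^ j * (j ! : ℂ) *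
      (laguerre j ((m : ℝ) / 2 + k - 1) (‖x‖ ^ 2) : ℂ) * polyVal H x *
        (Real.exp (-‖x‖ ^ 2 / 2) : ℂ) := by
  have hn : (fun x : Eu m => ‖x‖ ^ 2).HasTemperateGrowth :=
    Function.hasTemperateGrowth_norm_sq (Eu m)
  have hl : (fun x : Eu m => laguerre j ((m : ℝ) / 2 + k - 1) (‖x‖ ^ 2)).HasTemperateGrowth := by
    unfold laguerre
    refine Function.HasTemperateGrowth.sum fun n _ => ?_
    exact (Function.HasTemperateGrowth.const _).mul (hn.neg.pow n)
  have hl' : (fun x : Eu m =>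
      (laguerre j ((m : ℝ) / 2 + k - 1) (‖x‖ ^ 2) : ℂ)).HasTemperateGrowth :=
    Complex.ofRealCLM.hasTemperateGrowth.comp hl
  have hg : (fun x : Eu m => (2 : ℂ) ^ j * (j ! : ℂ) *
      (laguerre j ((m : ℝ) / 2 + k - 1) (‖x‖ ^ 2) : ℂ) * polyVal H x).HasTemperateGrowth :=
    ((Function.HasTemperateGrowth.const _).mul hl').mul (polyVal_hasTemperateGrowth H)
  rw [hermiteFun, SchwartzMap.smulLeftCLM_apply_apply hg, smul_eq_mul]
  congr 1
  change ((Real.exp (-(1 / 2) * ‖x‖ ^ 2) : ℝ) : ℂ) = _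
  congr 2
  ring

/-! ### Functions of a diagonalizable operator -/

/-- The closure in `L²(ℝ^m)` of the eigenspace of `D : 𝓢(ℝ^m) → 𝓢(ℝ^m)` for the eigenvalue
`ν`. -/
def spectralSpace {m : ℕ} (D : Module.End ℂ (Sch m)) (ν : ℝ) : Submodule ℂ (L2 m) :=
  ((D.eigenspace (ν : ℂ)).map
    (SchwartzMap.toLpCLM ℂ ℂ 2 (volume : Measure (Eu m))).toLinearMap).topologicalClosure

instance spectralSpace_complete {m : ℕ} (D : Module.End ℂ (Sch m)) (ν : ℝ) : CompleteSpace (spectralSpace D ν) :=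
  (Submodule.isClosed_topologicalClosure _).completeSpace_coe

/-- The function `G(D)` of a symmetric operator `D` on `𝓢(ℝ^m)` whose eigenfunctions are
complete in `L²(ℝ^m)`: it acts as the scalar `G(ν)` on the eigenspace for the eigenvalue `ν`, i.e.
`G(D) u = ∑_ν G(ν) P_ν u` with `P_ν` the orthogonal projection on that eigenspace. (The terms where
`ν` is not an eigenvalue vanish.) -/
def opFun {m : ℕ} (D : Module.End ℂ (Sch m)) (G : ℝ → ℂ) (u : L2 m) : L2 m :=
  ∑' ν : ℝ, G ν • (spectralSpace D ν).starProjection u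

/-- The operator `A` on `𝓢(ℝ^m)` is the operator `G(D)`. -/
def IsOpFun {m : ℕ} (A D : Module.End ℂ (Sch m)) (G : ℝ → ℂ) : Prop :=
  ∀ g : Sch m, (A g).toLp 2 = opFun D G (g.toLp 2)

/-! ### Integer-valued polynomials -/

/-- `E_0 = 1` and `E_n(x) = 2/(2n)! ∏_{l<n} (x² - l²)` for `n ≥ 1`. -/
def polyE (n : ℕ) (x : ℝ) : ℝ :=
  if n = 0 then 1 else 2 / ((2 * n)! : ℝ) * ∏ l ∈ Finset.range n, (x ^ 2 - (l : ℝ) ^ 2)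

/-- `D_n(x) = 1/(2n)! ∏_{l<n} (x² - (l+1/2)²)`. -/
def polyD (n : ℕ) (x : ℝ) : ℝ :=
  1 / ((2 * n)! : ℝ) * ∏ l ∈ Finset.range n, (x ^ 2 - ((l : ℝ) + 1 / 2) ^ 2)

/-- `ℰ_{0101} = E_1`. -/
def E0101 (x : ℝ) : ℝ := polyE 1 x

/-- `ℰ_{0010} = E_2 + 2 E_3`. -/
def E0010 (x : ℝ) : ℝ := polyE 2 x + 2 * polyE 3 x

/-- `ℰ_{0001} = ∑_{n ≥ 1} (E_{2^n+1} + ∑_{j=1}^{n-1} 2 E_{2^n+1+2^j})`, for integer `x`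
(only finitely many terms are nonzero then). -/
def E0001 (x : ℝ) : ℝ :=
  ∑' n : ℕ, if 1 ≤ n then
    polyE (2 ^ n + 1) x + ∑ j ∈ Finset.Ico 1 n, 2 * polyE (2 ^ n + 1 + 2 ^ j) x else 0

/-- `𝒟_{0110} = D_1 + 2 D_2`, as a function of the half-integer `x`. -/
def D0110 (x : ℝ) : ℝ := polyD 1 x + 2 * polyD 2 x

/-- `𝒟_{0011} = ∑_{n ≥ 1} (D_{2^n} + ∑_{j=1}^{n-1} 2 D_{2^n+2^j})`, for half-integer `x`
(only finitely many terms are nonzero then). -/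
def D0011 (x : ℝ) : ℝ :=
  ∑' n : ℕ, if 1 ≤ n then
    polyD (2 ^ n) x + ∑ j ∈ Finset.Ico 1 n, 2 * polyD (2 ^ n + 2 ^ j) x else 0

/-- `𝒟_{0010} = 2 D_3 + ∑_{n ≥ 0} (D_{2^n+1} + ∑_{j=1}^{n-1} 2 D_{2^n+1+2^j})`, for half-integer `x`
(only finitely many terms are nonzero then). -/
def D0010 (x : ℝ) : ℝ :=
  2 * polyD 3 x + ∑' n : ℕ,
    (polyD (2 ^ n + 1) x + ∑ j ∈ Finset.Ico 1 n, 2 * polyD (2 ^ n + 1 + 2 ^ j) x)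

/-- The function `F = a + b ℰ_{0101} + c ℰ_{0010} + d ℰ_{0001}` for even `m`, and
`F = a + b 𝒟_{0110} + c 𝒟_{0011} + d 𝒟_{0010}` for odd `m`, with `a, b, c, d ∈ {0, 1, 2, 3}`. -/
def phaseFun (m : ℕ) (a b c d : Fin 4) (x : ℝ) : ℝ :=
  if Even m then
    ((a : ℕ) : ℝ) + ((b : ℕ) : ℝ) * E0101 x + ((c : ℕ) : ℝ) * E0010 x + ((d : ℕ) : ℝ) * E0001 x
  else
    ((a : ℕ) : ℝ) + ((b : ℕ) : ℝ) * D0110 x + ((c : ℕ) : ℝ) * D0011 x + ((d : ℕ) : ℝ) * D0010 x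

/-! ### The two sides of the classification -/

/-- `T` satisfies the Helmholtz relations, is diagonal on the Hermite basis built from the bases
`b k` of `ℋ_k` with eigenvalues `μ_{j,k}` independent of `ℓ`, has `T⁴ = id`, and its eigenvalues
are 4-periodic in `k`. -/
structure IsPeriodicTransform {m : ℕ} {ι : ℕ → Type*}
    (b : ∀ k, Module.Basis (ι k) ℂ (sphericalHarmonics m k)) (T : Module.End ℂ (Sch m)) :
    Prop where
  helmholtz_lap : T * lap m = -(normSq m * T)
  helmholtz_normSq : T * normSq m = -(lap m * T)
  diagonal_periodic : ∃ μ : ℕ → ℕ → ℂ,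
    (∀ (j k : ℕ) (l : ι k), T (hermiteFun m j k (b k l)) = μ j k • hermiteFun m j k (b k l)) ∧
    ∀ j k : ℕ, μ j (k + 4) = μ j k
  pow_four : T ^ 4 = 1

/-- `T = exp(i π/2 F(√Ω)) exp(i π/2 (h - m/2))` as operators on `𝓢(ℝ^m)`. -/
def IsExpProduct {m : ℕ} (F : ℝ → ℝ) (T : Module.End ℂ (Sch m)) : Prop :=
  ∃ A B : Module.End ℂ (Sch m),
    IsOpFun A (casimir m)
      (fun ν => Complex.exp (Complex.I * (Real.pi / 2 : ℝ) * (F (Real.sqrt ν) : ℝ))) ∧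
    IsOpFun B (opH m)
      (fun ν => Complex.exp (Complex.I * (Real.pi / 2 : ℝ) * (ν - (m : ℝ) / 2 : ℝ))) ∧
    T = A * B

end GenFourier

end

noncomputable section

namespace GenFourier

/-! The Helmholtz relations say that `T` commutes with `h` and anticommutes with `f - e`, which is
half of `Δ + |x|²`. Since `f + e` is, up to a factor, the commutator of `h` with `f - e`, `T`
anticommutes with `e` and `f` separately, hence commutes with `Ω`. The operator `f` sends
`φ_{j+1,k}` to a nonzero multiple of `φ_{j,k}`, so `μ_{j+1,k} = -μ_{j,k}`. Thus `μ_{j,k} = (-1)^j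
ρ_k` with `ρ` of period 4 and `ρ_k^4 = 1`. On the other side the exponential product acts on
`φ_{j,k}` as `i^{F(k+m/2-1)} i^{2j+k} = (-1)^j i^{F(k+m/2-1)+k}`. What remains is arithmetic: modulo
4, the functions `F` must give every 4-periodic function with values in `ℤ/4`, and nothing else.

Arithmetic. `D_n(N+1/2)` and `E_n(N)` are sums of binomial coefficients, with generating series
`K^n/(1-X)` and `K^n(1+X)/(1-X)`, where `K = X/(1-X)²`. Modulo 4 one has `(1-X)^4 = (1+X²)²`, so `K²
= B - B²` with `B = X²/(1+X²)`. The dyadic sums in the definition of `F` are arranged so that they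
collapse to `B` (`exists_dyadicSum_eq`): up to end terms they are the square of a sum of `K²` to
powers of two, and that sum telescopes modulo 2 by Frobenius. Every generating series becomes a
polynomial of degree at most 3 over `1 - X^4`, and `exists_phaseResidue_eq` solves a triangular
system.

Analysis. Both sides are compared through the multipliers `IsMult`. Hermite functions are complete
in `L²` (`eq_zero_of_forall_hermiteFun`), so a multiplier is determined by its symbol. The norms
`‖h^N g‖` dominate the Schwartz seminorms (`exists_seminorm_le`), so every symbol bounded by 1 is
realized on `𝓢` (`exists_isMult`). No continuity of `T` is assumed: `isMult_of_commute` extracts the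
multiplier property from commutation with `h` and `Ω`. -/

variable {m : ℕ}

/-! ### Coordinates, partial derivatives and the Weyl relations. -/

lemma coordMul_hasTemperateGrowth (i : Fin m) :
    (fun x : Eu m => ((x i : ℝ) : ℂ)).HasTemperateGrowth :=
  (Complex.ofRealCLM.comp (EuclideanSpace.proj (𝕜 := ℝ) i)).hasTemperateGrowth

lemma normSq_hasTemperateGrowth :
    (fun x : Eu m => ((‖x‖ ^ 2 : ℝ) : ℂ)).HasTemperateGrowth :=
  Complex.ofRealCLM.hasTemperateGrowth.comp (Function.hasTemperateGrowth_norm_sq (Eu m))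

lemma coordMul_apply (i : Fin m) (g : Sch m) (x : Eu m) :
    coordMul m i g x = (x i : ℂ) * g x := by
  change SchwartzMap.smulLeftCLM ℂ _ g x = _
  rw [SchwartzMap.smulLeftCLM_apply_apply (coordMul_hasTemperateGrowth i), smul_eq_mul]

lemma normSq_apply (g : Sch m) (x : Eu m) :
    normSq m g x = ((‖x‖ ^ 2 : ℝ) : ℂ) * g x := by
  change SchwartzMap.smulLeftCLM ℂ _ g x = _
  rw [SchwartzMap.smulLeftCLM_apply_apply normSq_hasTemperateGrowth, smul_eq_mul]

lemma partialDeriv_apply (i : Fin m) (g : Sch m) (x : Eu m) :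
    partialDeriv m i g x = fderiv ℝ g x (EuclideanSpace.single i 1) := by
  rfl

lemma normSq_eq_sum : normSq m = ∑ i, coordMul m i * coordMul m i := by
  ext g x
  rw [normSq_apply, LinearMap.sum_apply, sum_apply]
  simp only [Module.End.mul_apply, coordMul_apply, ← mul_assoc]
  rw [← Finset.sum_mul, EuclideanSpace.real_norm_sq_eq]
  push_cast
  simp [sq]

lemma lap_eq_sum : lap m = ∑ i, partialDeriv m i * partialDeriv m i := by
  ext g x
  have : lap m g = ∑ i, partialDeriv m i (partialDeriv m i g) := by
    change LineDeriv.laplacianCLM ℂ (Eu m) (Sch m) g = _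
    rw [SchwartzMap.laplacianCLM_eq,
      SchwartzMap.laplacian_eq_sum (EuclideanSpace.basisFun (Fin m) ℝ)]
    simp [partialDeriv]
  rw [this]
  simp [LinearMap.sum_apply]

lemma coordMul_comm (i j : Fin m) : coordMul m i * coordMul m j = coordMul m j * coordMul m i := by
  ext g x
  simp only [Module.End.mul_apply, coordMul_apply]
  ring

lemma partialDeriv_comm (i j : Fin m) :
    partialDeriv m i * partialDeriv m j = partialDeriv m j * partialDeriv m i := by
  ext g x
  simp only [Module.End.mul_apply]
  have key : ∀ i j : Fin m, partialDeriv m i (partialDeriv m j g) x =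
      fderiv ℝ (fderiv ℝ g) x (EuclideanSpace.single i 1) (EuclideanSpace.single j 1) := by
    intro i j
    rw [partialDeriv_apply]
    have h : ⇑(partialDeriv m j g) = fun y => fderiv ℝ g y (EuclideanSpace.single j 1) := by
      ext y; rfl
    rw [h]
    have hd : DifferentiableAt ℝ (fderiv ℝ g) x :=
      ((g.smooth 2).fderiv_right (m := 1) (by norm_num)).differentiable (by norm_num) x
    rw [fderiv_clm_apply hd (differentiableAt_const _)]
    simp
  rw [key, key]
  have hs : IsSymmSndFDerivAt ℝ g x :=
    ((g.smooth 2).contDiffAt).isSymmSndFDerivAt (by simp)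
  exact hs _ _

/-- The canonical commutation relation, from the product rule. With the two commutativity lemmas it
is the source of all commutators below. -/
lemma partialDeriv_coordMul (i j : Fin m) :
    partialDeriv m i * coordMul m j =
      coordMul m j * partialDeriv m i + (if i = j then 1 else 0) := by
  ext g x
  simp only [Module.End.mul_apply, LinearMap.add_apply, add_apply]
  rw [partialDeriv_apply, coordMul_apply, partialDeriv_apply]
  have h : ⇑(coordMul m j g) = fun y => (y j : ℂ) * g y := by
    ext y; exact coordMul_apply j g y
  rw [h]
  have h1 : HasFDerivAt (fun y : Eu m => (y j : ℂ))
      (Complex.ofRealCLM.comp (EuclideanSpace.proj (𝕜 := ℝ) j)) x :=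
    (Complex.ofRealCLM.comp (EuclideanSpace.proj (𝕜 := ℝ) j)).hasFDerivAt
  rw [(h1.fun_mul g.differentiableAt.hasFDerivAt).fderiv]
  by_cases hij : i = j
  · subst hij; simp
  · simp [hij, Ne.symm hij]

/-! ### The `L²` pairing and formal adjoints. -/

/-- The inclusion of `𝓢(ℝ^m)` into `L²(ℝ^m)`. -/
def toL2 (m : ℕ) : Sch m →ₗ[ℂ] L2 m :=
  (SchwartzMap.toLpCLM ℂ ℂ 2 (volume : Measure (Eu m))).toLinearMap

lemma toL2_apply (g : Sch m) : toL2 m g = g.toLp 2 := rfl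

lemma toL2_injective : Function.Injective (toL2 m) :=
  SchwartzMap.injective_toLp 2 _

/-- The `L²` inner product on `𝓢(ℝ^m)`. -/
def ip (f g : Sch m) : ℂ := inner ℂ (toL2 m f) (toL2 m g)

lemma ip_eq_integral (f g : Sch m) : ip f g = ∫ x, (starRingEnd ℂ) (f x) * g x := by
  refine (SchwartzMap.inner_toL2_toL2_eq f g volume).trans ?_
  simp [mul_comm]

@[simp] lemma ip_add_left (f g k : Sch m) : ip (f + g) k = ip f k + ip g k := by
  simp [ip, inner_add_left]

@[simp] lemma ip_add_right (f g k : Sch m) : ip f (g + k) = ip f g + ip f k := by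
  simp [ip, inner_add_right]

@[simp] lemma ip_neg_left (f g : Sch m) : ip (-f) g = -ip f g := by
  simp [ip]

@[simp] lemma ip_neg_right (f g : Sch m) : ip f (-g) = -ip f g := by
  simp [ip]

@[simp] lemma ip_sub_right (f g k : Sch m) : ip f (g - k) = ip f g - ip f k := by
  simp [ip, inner_sub_right]

@[simp] lemma ip_smul_left (c : ℂ) (f g : Sch m) : ip (c • f) g = (starRingEnd ℂ) c * ip f g := by
  simp [ip, inner_smul_left]

@[simp] lemma ip_smul_right (c : ℂ) (f g : Sch m) : ip f (c • g) = c * ip f g := by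
  simp [ip, inner_smul_right]

@[simp] lemma ip_zero_left (g : Sch m) : ip 0 g = 0 := by simp [ip]

@[simp] lemma ip_zero_right (g : Sch m) : ip g 0 = 0 := by simp [ip]

lemma ip_conj_symm (f g : Sch m) : (starRingEnd ℂ) (ip f g) = ip g f := inner_conj_symm _ _

/-- `B` is a formal adjoint of `A`. -/
def IsAdj (A B : Module.End ℂ (Sch m)) : Prop := ∀ f g, ip (A f) g = ip f (B g)

lemma IsAdj.symm {A B : Module.End ℂ (Sch m)} (h : IsAdj A B) : IsAdj B A := by
  intro f g
  rw [← ip_conj_symm, ← h, ip_conj_symm]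

lemma IsAdj.add {A B A' B' : Module.End ℂ (Sch m)} (h : IsAdj A B) (h' : IsAdj A' B') :
    IsAdj (A + A') (B + B') := by
  intro f g
  simp [h f g, h' f g]

lemma IsAdj.neg {A B : Module.End ℂ (Sch m)} (h : IsAdj A B) : IsAdj (-A) (-B) := by
  intro f g
  simp [h f g]

lemma IsAdj.mul {A B A' B' : Module.End ℂ (Sch m)} (h : IsAdj A B) (h' : IsAdj A' B') :
    IsAdj (A * A') (B' * B) := by
  intro f g
  simp [h _ g, h' f _]

lemma IsAdj.pow {A B : Module.End ℂ (Sch m)} (h : IsAdj A B) (n : ℕ) : IsAdj (A ^ n) (B ^ n) := by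
  induction n with
  | zero => intro f g; simp
  | succ n ih => rw [pow_succ, pow_succ']; exact ih.mul h

lemma isAdj_one : IsAdj (1 : Module.End ℂ (Sch m)) 1 := fun _ _ => rfl

lemma IsAdj.smul {A B : Module.End ℂ (Sch m)} (h : IsAdj A B) (c : ℝ) :
    IsAdj ((c : ℂ) • A) ((c : ℂ) • B) := by
  intro f g
  rw [LinearMap.smul_apply, LinearMap.smul_apply, ip_smul_left, ip_smul_right, h f g,
    Complex.conj_ofReal]

lemma IsAdj.sum {ι : Type*} (s : Finset ι) {A B : ι → Module.End ℂ (Sch m)}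
    (h : ∀ i, IsAdj (A i) (B i)) : IsAdj (∑ i ∈ s, A i) (∑ i ∈ s, B i) := by
  classical
  induction s using Finset.induction_on with
  | empty => intro f g; simp
  | insert a s ha ih => rw [Finset.sum_insert ha, Finset.sum_insert ha]; exact (h a).add ih

lemma isAdj_coordMul (i : Fin m) : IsAdj (coordMul m i) (coordMul m i) := by
  intro f g
  rw [ip_eq_integral, ip_eq_integral]
  congr 1
  ext x
  simp only [coordMul_apply, map_mul, Complex.conj_ofReal]
  ring

lemma isAdj_partialDeriv (i : Fin m) : IsAdj (partialDeriv m i) (-partialDeriv m i) := by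
  intro f g
  have key := SchwartzMap.integral_bilinear_lineDerivOp_right_eq_neg_left (μ := volume) f g
    (((ContinuousLinearMap.mul ℝ ℂ).comp (Complex.conjCLE : ℂ →L[ℝ] ℂ)))
    (EuclideanSpace.single i 1)
  rw [LinearMap.neg_apply, ip_neg_right, ip_eq_integral, ip_eq_integral]
  have h2 : ∀ f : Sch m, LineDeriv.lineDerivOp (EuclideanSpace.single i (1 : ℝ)) f
    = partialDeriv m i f := fun f => rfl
  simp only [h2] at key
  simp only [ContinuousLinearMap.comp_apply, ContinuousLinearMap.mul_apply',
    ContinuousLinearEquiv.coe_coe, Complex.conjCLE_apply] at key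
  rw [key, neg_neg]

/-! ### Ladder operators -/

/-- The lowering operator `x_i + ∂_i`. -/
def lower (i : Fin m) : Module.End ℂ (Sch m) := coordMul m i + partialDeriv m i

/-- The raising operator `x_i - ∂_i`. -/
def raise (i : Fin m) : Module.End ℂ (Sch m) := coordMul m i - partialDeriv m i

lemma isAdj_lower (i : Fin m) : IsAdj (lower i) (raise i) := by
  rw [lower, raise, sub_eq_add_neg]
  exact (isAdj_coordMul i).add (isAdj_partialDeriv i)

lemma lower_mul_raise (i j : Fin m) :
    lower i * raise j = raise j * lower i + (if i = j then 2 else 0) := by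
  have h1 := coordMul_comm i j
  have h2 := partialDeriv_comm i j
  have h3 := partialDeriv_coordMul i j
  have h4 := partialDeriv_coordMul j i
  simp only [lower, raise, add_mul, mul_sub, mul_add, sub_mul, h1, h2, h3, h4]
  by_cases hij : i = j
  · subst hij
    simp only [if_true]
    rw [show (2 : Module.End ℂ (Sch m)) = 1 + 1 from one_add_one_eq_two.symm]
    abel
  · simp only [hij, Ne.symm hij, if_false]
    abel

lemma lower_comm (i j : Fin m) : lower i * lower j = lower j * lower i := by
  have h1 := coordMul_comm i j
  have h2 := partialDeriv_comm i j
  have h3 := partialDeriv_coordMul i j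
  have h4 := partialDeriv_coordMul j i
  simp only [lower, add_mul, mul_add, h1, h2, h3, h4, eq_comm (a := j)]
  abel

lemma raise_comm (i j : Fin m) : raise i * raise j = raise j * raise i := by
  have h1 := coordMul_comm i j
  have h2 := partialDeriv_comm i j
  have h3 := partialDeriv_coordMul i j
  have h4 := partialDeriv_coordMul j i
  simp only [raise, sub_mul, mul_sub, h1, h2, h3, h4, eq_comm (a := j)]
  abel

/-- This number-operator form gives both the positivity of `h` and its commutators with the ladder
operators. -/
lemma opH_eq : opH m = (1 / 2 : ℂ) • ∑ i, raise i * lower i + ((m : ℂ) / 2) • 1 := by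
  have h : ∀ i : Fin m, raise i * lower i =
      coordMul m i * coordMul m i - partialDeriv m i * partialDeriv m i - 1 := by
    intro i
    have h3 := partialDeriv_coordMul i i
    simp only [lower, raise, sub_mul, mul_add, h3, if_true]
    abel
  simp only [h, Finset.sum_sub_distrib, ← normSq_eq_sum, ← lap_eq_sum, opH]
  simp only [Finset.sum_const, Finset.card_univ, Fintype.card_fin, ← Nat.cast_smul_eq_nsmul ℂ]
  module

lemma opF_eq : opF m = (1 / 4 : ℂ) • ∑ i, lower i * lower i := by
  have h : ∀ i : Fin m, lower i * lower i =
      coordMul m i * coordMul m i + partialDeriv m i * partialDeriv m i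
        + (2 : ℂ) • (coordMul m i * partialDeriv m i) + 1 := by
    intro i
    have h3 := partialDeriv_coordMul i i
    simp only [lower, add_mul, mul_add, h3, if_true]
    module
  simp only [h, Finset.sum_add_distrib, ← normSq_eq_sum, ← lap_eq_sum, opF, ← Finset.smul_sum,
    euler]
  simp only [Finset.sum_const, Finset.card_univ, Fintype.card_fin, ← Nat.cast_smul_eq_nsmul ℂ]
  module

lemma opE_eq : opE m = -((1 / 4 : ℂ) • ∑ i, raise i * raise i) := by
  have h : ∀ i : Fin m, raise i * raise i =
      coordMul m i * coordMul m i + partialDeriv m i * partialDeriv m i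
        - (2 : ℂ) • (coordMul m i * partialDeriv m i) - 1 := by
    intro i
    have h3 := partialDeriv_coordMul i i
    simp only [raise, sub_mul, mul_sub, h3, if_true]
    module
  simp only [h, Finset.sum_add_distrib, Finset.sum_sub_distrib, ← normSq_eq_sum, ← lap_eq_sum,
    opE, ← Finset.smul_sum, euler]
  simp only [Finset.sum_const, Finset.card_univ, Fintype.card_fin, ← Nat.cast_smul_eq_nsmul ℂ]
  module

lemma normSq_eq : normSq m = opH m + opF m - opE m := by
  simp only [opH, opF, opE]; module

lemma lap_eq : lap m = opF m - opE m - opH m := by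
  simp only [opH, opF, opE]; module

lemma opH_mul_lower (i : Fin m) : opH m * lower i = lower i * opH m - lower i := by
  have h : ∀ j : Fin m, raise j * lower j * lower i =
      lower i * (raise j * lower j) - (if i = j then (2 : ℂ) • lower i else 0) := by
    intro j
    have h2 : raise j * lower i = lower i * raise j - (if i = j then 2 else 0) := by
      rw [lower_mul_raise]; abel
    rw [mul_assoc, lower_comm j i, ← mul_assoc, h2, sub_mul, mul_assoc]
    by_cases hij : i = j
    · subst hij; simp [two_mul, two_smul]
    · simp [hij]
  rw [opH_eq]
  simp only [add_mul, smul_mul_assoc, Finset.sum_mul, h, mul_add, mul_smul_comm, Finset.mul_sum,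
    Finset.sum_sub_distrib, Finset.sum_ite_eq, Finset.mem_univ, if_true, one_mul, mul_one]
  module

lemma opH_mul_raise (i : Fin m) : opH m * raise i = raise i * opH m + raise i := by
  have h : ∀ j : Fin m, raise j * lower j * raise i =
      raise i * (raise j * lower j) + (if i = j then (2 : ℂ) • raise i else 0) := by
    intro j
    rw [mul_assoc, lower_mul_raise, mul_add, ← mul_assoc, raise_comm j i, mul_assoc]
    by_cases hij : i = j
    · subst hij; simp [mul_two, two_smul]
    · simp [hij, Ne.symm hij]
  rw [opH_eq]
  simp only [add_mul, smul_mul_assoc, Finset.sum_mul, h, mul_add, mul_smul_comm, Finset.mul_sum,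
    Finset.sum_add_distrib, Finset.sum_ite_eq, Finset.mem_univ, if_true, one_mul, mul_one]
  module

lemma opH_mul_opF : opH m * opF m = opF m * opH m - (2 : ℂ) • opF m := by
  have h : ∀ i : Fin m, opH m * (lower i * lower i) =
      (lower i * lower i) * opH m - (2 : ℂ) • (lower i * lower i) := by
    intro i
    rw [← mul_assoc, opH_mul_lower, sub_mul, mul_assoc, opH_mul_lower, mul_sub, ← mul_assoc]
    module
  rw [opF_eq]
  simp only [mul_smul_comm, smul_mul_assoc, Finset.mul_sum, Finset.sum_mul, h,
    Finset.sum_sub_distrib, ← Finset.smul_sum]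
  module

lemma opH_mul_opE : opH m * opE m = opE m * opH m + (2 : ℂ) • opE m := by
  have h : ∀ i : Fin m, opH m * (raise i * raise i) =
      (raise i * raise i) * opH m + (2 : ℂ) • (raise i * raise i) := by
    intro i
    rw [← mul_assoc, opH_mul_raise, add_mul, mul_assoc, opH_mul_raise, mul_add, ← mul_assoc]
    module
  rw [opE_eq]
  simp only [mul_neg, neg_mul, mul_smul_comm, smul_mul_assoc, Finset.mul_sum, Finset.sum_mul, h,
    Finset.sum_add_distrib, ← Finset.smul_sum]
  module

lemma isAdj_opH : IsAdj (opH m) (opH m) := by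
  rw [opH_eq]
  have h1 := (IsAdj.sum Finset.univ fun i : Fin m => (isAdj_lower i).symm.mul (isAdj_lower i))
  have h2 := (h1.smul (1 / 2)).add ((isAdj_one (m := m)).smul (m / 2))
  simpa using h2

/-- Squares of raising operators are adjoint to squares of lowering operators; the minus sign is the
one in `opE_eq`. -/
lemma isAdj_opE : IsAdj (opE m) (-opF m) := by
  rw [opE_eq, opF_eq]
  have h1 := (IsAdj.sum Finset.univ fun i : Fin m => (isAdj_lower i).symm.mul (isAdj_lower i).symm)
  simpa using (h1.smul (1 / 4)).neg

lemma isAdj_opF : IsAdj (opF m) (-opE m) := by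
  rw [← neg_neg (opF m)]
  exact isAdj_opE.neg.symm

lemma isAdj_casimir : IsAdj (casimir m) (casimir m) := by
  rw [casimir]
  have h1 := (isAdj_opE (m := m)).mul isAdj_opF
  have h2 := (isAdj_opF (m := m)).mul isAdj_opE
  simpa using (((isAdj_one (m := m)).add (isAdj_opH.pow 2)).add (h1.smul 2)).add (h2.smul 2)

/-! ### Polynomials times the Gaussian -/

/-- The map `p ↦ p e^{-|x|²/2}` from polynomials to rapidly decreasing functions. -/
def gaussMul (m : ℕ) : MvPolynomial (Fin m) ℂ →ₗ[ℂ] Sch m where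
  toFun p := SchwartzMap.smulLeftCLM ℂ (fun x : Eu m => polyVal p x) (gaussian m)
  map_add' p q := by
    ext x
    rw [add_apply]
    simp only [SchwartzMap.smulLeftCLM_apply_apply (polyVal_hasTemperateGrowth _)]
    simp [polyVal, add_mul]
  map_smul' c p := by
    ext x
    rw [smul_apply]
    simp only [SchwartzMap.smulLeftCLM_apply_apply (polyVal_hasTemperateGrowth _)]
    simp [polyVal, mul_assoc]

lemma gaussian_apply (x : Eu m) : gaussian m x = (Real.exp (-‖x‖ ^ 2 / 2) : ℂ) := by
  change ((Real.exp (-(1 / 2) * ‖x‖ ^ 2) : ℝ) : ℂ) = _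
  congr 2
  ring

lemma gaussMul_apply (p : MvPolynomial (Fin m) ℂ) (x : Eu m) :
    gaussMul m p x = polyVal p x * (Real.exp (-‖x‖ ^ 2 / 2) : ℂ) := by
  change SchwartzMap.smulLeftCLM ℂ (fun x : Eu m => polyVal p x) (gaussian m) x = _
  rw [SchwartzMap.smulLeftCLM_apply_apply (polyVal_hasTemperateGrowth _), gaussian_apply,
    smul_eq_mul]

lemma gaussMul_one : gaussMul m 1 = gaussian m := by
  ext x; rw [gaussMul_apply, gaussian_apply]; simp [polyVal]

lemma coordMul_gaussMul (i : Fin m) (p : MvPolynomial (Fin m) ℂ) :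
    coordMul m i (gaussMul m p) = gaussMul m (MvPolynomial.X i * p) := by
  ext x
  rw [coordMul_apply, gaussMul_apply, gaussMul_apply]
  simp [polyVal, mul_assoc]

lemma partialDeriv_gaussian (i : Fin m) :
    partialDeriv m i (gaussian m) = -coordMul m i (gaussian m) := by
  ext x
  rw [neg_apply, coordMul_apply, partialDeriv_apply]
  have h : ⇑(gaussian m) = fun x => ((Real.exp (-(1 / 2) * ‖x‖ ^ 2) : ℝ) : ℂ) := rfl
  rw [h]
  have h1 : HasFDerivAt (fun x : Eu m => ‖x‖ ^ 2) (2 • innerSL ℝ x) x :=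
    (hasStrictFDerivAt_norm_sq x).hasFDerivAt
  have h2 := Complex.ofRealCLM.hasFDerivAt.comp x ((h1.const_mul (-(1 / 2) : ℝ)).exp)
  change fderiv ℝ (Complex.ofRealCLM ∘ fun x : Eu m => Real.exp (-(1 / 2) * ‖x‖ ^ 2)) x _ = _
  rw [h2.fderiv]
  simp [EuclideanSpace.inner_single_right]
  ring

lemma partialDeriv_gaussMul (i : Fin m) (p : MvPolynomial (Fin m) ℂ) :
    partialDeriv m i (gaussMul m p) =
      gaussMul m (MvPolynomial.pderiv i p - MvPolynomial.X i * p) := by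
  induction p using MvPolynomial.induction_on with
  | C a =>
    have h : (MvPolynomial.C a : MvPolynomial (Fin m) ℂ) = a • 1 := by
      rw [MvPolynomial.smul_eq_C_mul, mul_one]
    rw [MvPolynomial.pderiv_C, zero_sub, map_neg, ← coordMul_gaussMul, h, map_smul, map_smul,
      map_smul, gaussMul_one, partialDeriv_gaussian, smul_neg]
  | add p q hp hq =>
    rw [map_add (gaussMul m), map_add (partialDeriv m i), hp, hq, ← map_add (gaussMul m),
      map_add (MvPolynomial.pderiv i), mul_add, add_sub_add_comm]
  | mul_X p j hp =>
    rw [mul_comm p, ← coordMul_gaussMul, ← Module.End.mul_apply, partialDeriv_coordMul,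
      LinearMap.add_apply, Module.End.mul_apply, hp, coordMul_gaussMul]
    by_cases hij : i = j
    · subst hij
      simp only [if_true, Module.End.one_apply, ← map_add]
      congr 1
      simp
      ring
    · simp only [hij, if_false, LinearMap.zero_apply, add_zero]
      congr 1
      simp [MvPolynomial.pderiv_X_of_ne (Ne.symm hij)]
      ring

/-- Conjugation by the Gaussian cancels the coordinate in the lowering operator. Consequently `f`
becomes `Δ/4` on polynomials, and spectral questions turn into polynomial algebra. -/
lemma lower_gaussMul (i : Fin m) (p : MvPolynomial (Fin m) ℂ) :
    lower i (gaussMul m p) = gaussMul m (MvPolynomial.pderiv i p) := by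
  rw [lower, LinearMap.add_apply, coordMul_gaussMul, partialDeriv_gaussMul, ← map_add]
  congr 1; ring

lemma raise_gaussMul (i : Fin m) (p : MvPolynomial (Fin m) ℂ) :
    raise i (gaussMul m p) =
      gaussMul m ((2 : ℂ) • (MvPolynomial.X i * p) - MvPolynomial.pderiv i p) := by
  rw [raise, LinearMap.sub_apply, coordMul_gaussMul, partialDeriv_gaussMul, ← map_sub]
  congr 1; module

/-- The Laplace operator on polynomials. -/
def polyLap (m : ℕ) : MvPolynomial (Fin m) ℂ →ₗ[ℂ] MvPolynomial (Fin m) ℂ :=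
  ∑ i : Fin m,
      ((MvPolynomial.pderiv i).toLinearMap ∘ₗ (MvPolynomial.pderiv i).toLinearMap :
        MvPolynomial (Fin m) ℂ →ₗ[ℂ] MvPolynomial (Fin m) ℂ)

lemma polyLap_apply (p : MvPolynomial (Fin m) ℂ) :
    polyLap m p = ∑ i, MvPolynomial.pderiv i (MvPolynomial.pderiv i p) := by
  simp [polyLap, LinearMap.sum_apply]

lemma mem_sphericalHarmonics {k : ℕ} {H : MvPolynomial (Fin m) ℂ} :
    H ∈ sphericalHarmonics m k ↔ H.IsHomogeneous k ∧ polyLap m H = 0 := by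
  rw [sphericalHarmonics, Submodule.mem_inf, MvPolynomial.mem_homogeneousSubmodule,
    LinearMap.mem_ker, polyLap]

lemma opF_gaussMul (p : MvPolynomial (Fin m) ℂ) :
    opF m (gaussMul m p) = (1 / 4 : ℂ) • gaussMul m (polyLap m p) := by
  rw [opF_eq, polyLap_apply]
  simp [LinearMap.sum_apply, lower_gaussMul]

lemma opH_gaussMul (p : MvPolynomial (Fin m) ℂ) :
    opH m (gaussMul m p) = gaussMul m (∑ i, MvPolynomial.X i * MvPolynomial.pderiv i p
      + ((m : ℂ) / 2) • p - (1 / 2 : ℂ) • polyLap m p) := by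
  rw [opH_eq, polyLap_apply]
  simp only [LinearMap.add_apply, LinearMap.smul_apply, LinearMap.sum_apply, Module.End.mul_apply,
    lower_gaussMul, raise_gaussMul, ← map_sum, Module.End.one_apply]
  simp only [← map_smul, ← map_add, Finset.sum_sub_distrib, ← Finset.smul_sum]
  congr 1
  module

/-- The polynomial `|x|²`. -/
def polyNormSq (m : ℕ) : MvPolynomial (Fin m) ℂ := ∑ i, MvPolynomial.X i * MvPolynomial.X i

lemma polyVal_polyNormSq (x : Eu m) : polyVal (polyNormSq m) x = ((‖x‖ ^ 2 : ℝ) : ℂ) := by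
  rw [EuclideanSpace.real_norm_sq_eq]
  simp [polyVal, polyNormSq, sq]

lemma normSq_gaussMul (p : MvPolynomial (Fin m) ℂ) :
    normSq m (gaussMul m p) = gaussMul m (polyNormSq m * p) := by
  ext x
  rw [normSq_apply, gaussMul_apply, gaussMul_apply, ← polyVal_polyNormSq]
  simp [polyVal, mul_assoc]

lemma pderiv_polyNormSq (i : Fin m) :
    MvPolynomial.pderiv i (polyNormSq m) = (2 : ℂ) • MvPolynomial.X i := by
  classical
  simp [polyNormSq, MvPolynomial.pderiv_X, Pi.single_apply, Finset.sum_add_distrib, two_smul]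

lemma polyLap_polyNormSq_mul (p : MvPolynomial (Fin m) ℂ) :
    polyLap m (polyNormSq m * p) = polyNormSq m * polyLap m p +
      (4 : ℂ) • ∑ i, MvPolynomial.X i * MvPolynomial.pderiv i p + (2 * m : ℂ) • p := by
  simp only [polyLap_apply, Derivation.leibniz, pderiv_polyNormSq, map_add, smul_eq_mul,
    Derivation.map_smul, MvPolynomial.pderiv_X_self, Finset.mul_sum, Finset.smul_sum]
  rw [← Finset.sum_add_distrib]
  have : (2 * m : ℂ) • p = ∑ i : Fin m, (2 : ℂ) • p := by
    rw [Finset.sum_const, Finset.card_univ, Fintype.card_fin, ← Nat.cast_smul_eq_nsmul ℂ, smul_smul,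
      mul_comm]
  rw [this, ← Finset.sum_add_distrib]
  refine Finset.sum_congr rfl fun i _ => ?_
  simp only [MvPolynomial.smul_eq_C_mul, map_ofNat]
  ring

lemma isHomogeneous_polyNormSq : (polyNormSq m).IsHomogeneous 2 :=
  MvPolynomial.IsHomogeneous.sum _ _ _ fun i _ =>
    (MvPolynomial.isHomogeneous_X ℂ i).mul (MvPolynomial.isHomogeneous_X ℂ i)

/-- Induction through the commutator of `Δ` with `|x|²`, where Euler's identity evaluates the
first-order term by homogeneity. -/
lemma polyLap_pow_mul {k : ℕ} {H : MvPolynomial (Fin m) ℂ} (hH : H ∈ sphericalHarmonics m k)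
    (n : ℕ) : polyLap m (polyNormSq m ^ (n + 1) * H) =
      (4 * (n + 1) * (n + k + m / 2 : ℂ)) • (polyNormSq m ^ n * H) := by
  obtain ⟨h1, h2⟩ := mem_sphericalHarmonics.1 hH
  have hE : ∀ n : ℕ, ∑ i, MvPolynomial.X i * MvPolynomial.pderiv i (polyNormSq m ^ n * H) =
      (2 * n + k : ℂ) • (polyNormSq m ^ n * H) := by
    intro n
    have := ((isHomogeneous_polyNormSq (m := m)).pow n).mul h1
    rw [this.sum_X_mul_pderiv, ← Nat.cast_smul_eq_nsmul ℂ]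
    push_cast
    rfl
  induction n with
  | zero =>
    have := polyLap_polyNormSq_mul (polyNormSq m ^ 0 * H)
    rw [hE] at this
    rw [zero_add, pow_one]
    simp only [pow_zero, one_mul, h2, mul_zero, zero_add] at this ⊢
    rw [this]
    push_cast
    module
  | succ n ih =>
    rw [pow_succ', mul_assoc, polyLap_polyNormSq_mul, ih, hE, mul_smul_comm, ← mul_assoc,
      ← pow_succ']
    push_cast
    module

/-! ### The Hermite functions as eigenvectors -/

/-- The parameter `m/2 + k - 1` of the Laguerre polynomials in degree `k`. -/
def lagParam (m k : ℕ) : ℝ := (m : ℝ) / 2 + k - 1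

lemma lagParam_nonneg (hm : 2 ≤ m) (k : ℕ) : 0 ≤ lagParam m k := by
  have : (2 : ℝ) ≤ m := by exact_mod_cast hm
  have : (0 : ℝ) ≤ k := by positivity
  unfold lagParam; linarith

/-- The coefficient of `t^n` in `2^j j! L_j^α(t)`. -/
def lagCoeff (α : ℝ) (j n : ℕ) : ℝ :=
  (-1) ^ n * 2 ^ j * (j.choose n) * (Real.Gamma (j + α + 1) / Real.Gamma (n + α + 1))

lemma lagCoeff_eq_zero (α : ℝ) {j n : ℕ} (h : j < n) : lagCoeff α j n = 0 := by
  simp [lagCoeff, Nat.choose_eq_zero_of_lt h]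

lemma Gamma_ne_zero_of_nonneg {α : ℝ} (hα : 0 ≤ α) (n : ℕ) : Real.Gamma (n + α + 1) ≠ 0 :=
  (Real.Gamma_pos_of_pos (by positivity)).ne'

lemma Gamma_nat_succ {α : ℝ} (hα : 0 ≤ α) (n : ℕ) :
    Real.Gamma ((n + 1 : ℕ) + α + 1) = (n + α + 1) * Real.Gamma (n + α + 1) := by
  rw [← Real.Gamma_add_one (by positivity)]
  congr 1; push_cast; ring

lemma choose_succ_mul_cast (j n : ℕ) :
    (j.choose (n + 1) : ℝ) * (n + 1) = j.choose n * (j - n) := by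
  rcases le_or_gt n j with h | h
  · have := Nat.choose_succ_right_eq j n
    rw [← Nat.cast_sub h]; exact_mod_cast this
  · simp [Nat.choose_eq_zero_of_lt h, Nat.choose_eq_zero_of_lt (h.trans (Nat.lt_succ_self n))]

/-- Laguerre's differential equation, read on coefficients; it yields the eigenvalue of `h`. The
next three recurrences give the action of `f` and of `e`. -/
lemma lagCoeff_succ {α : ℝ} (hα : 0 ≤ α) (j n : ℕ) :
    (n + 1) * (n + 1 + α) * lagCoeff α j (n + 1) = -(j - n) * lagCoeff α j n := by
  have h1 := choose_succ_mul_cast j n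
  have h2 := Gamma_ne_zero_of_nonneg hα n
  have h3 : (n : ℝ) + α + 1 ≠ 0 := by positivity
  rw [lagCoeff, lagCoeff, Gamma_nat_succ hα]
  field_simp
  rw [pow_succ]
  linear_combination (-1) ^ n * (-1) * (n + 1 + α) * h1

lemma lagCoeff_succ_succ {α : ℝ} (hα : 0 ≤ α) (j n : ℕ) :
    (n + 1) * (n + 1 + α) * lagCoeff α (j + 1) (n + 1) =
      -(2 * (j + 1) * (j + 1 + α)) * lagCoeff α j n := by
  have h1 : ((j + 1).choose (n + 1) : ℝ) * (n + 1) = (j + 1) * j.choose n := by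
    exact_mod_cast (Nat.add_one_mul_choose_eq j n).symm
  have h2 := Gamma_ne_zero_of_nonneg hα n
  have h3 : (n : ℝ) + α + 1 ≠ 0 := by positivity
  rw [lagCoeff, lagCoeff, Gamma_nat_succ hα, Gamma_nat_succ hα]
  field_simp
  rw [pow_succ, pow_succ]
  linear_combination (-1) ^ n * (-1) * 2 * 2 ^ j * (n + 1 + α) * (j + 1 + α) * h1

lemma lagCoeff_raise_zero {α : ℝ} (hα : 0 ≤ α) (j : ℕ) :
    (1 / 2) * lagCoeff α (j + 1) 0 = (j + α + 1) * lagCoeff α j 0 := by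
  rw [lagCoeff, lagCoeff, Gamma_nat_succ hα]
  simp
  ring

lemma lagCoeff_raise_succ {α : ℝ} (hα : 0 ≤ α) (j n : ℕ) :
    (1 / 2) * lagCoeff α (j + 1) (n + 1) =
      (j + n + 2 + α) * lagCoeff α j (n + 1) - lagCoeff α j n := by
  have h1 := choose_succ_mul_cast j n
  have h2 := Gamma_ne_zero_of_nonneg hα n
  have h3 : (n : ℝ) + α + 1 ≠ 0 := by positivity
  rw [lagCoeff, lagCoeff, lagCoeff, Gamma_nat_succ hα, Gamma_nat_succ hα, Nat.choose_succ_succ]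
  field_simp
  rw [pow_succ, pow_succ]
  push_cast
  linear_combination 2 * 2 ^ j * (-1) ^ n * h1

/-- The polynomial factor of the Hermite functions. -/
def lagPoly (m j k N : ℕ) (H : MvPolynomial (Fin m) ℂ) : MvPolynomial (Fin m) ℂ :=
  ∑ n ∈ Finset.range N, (lagCoeff (lagParam m k) j n : ℂ) • (polyNormSq m ^ n * H)

/-- Coefficients beyond `j` vanish, so the length of the sum is free; this lets sums attached to
different `j` be compared termwise. -/
lemma lagPoly_eq {j N : ℕ} (h : j < N) (k : ℕ) (H : MvPolynomial (Fin m) ℂ) :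
    lagPoly m j k N H = lagPoly m j k (j + 1) H := by
  symm
  refine Finset.sum_subset (Finset.range_subset_range.2 h) fun n _ hn => ?_
  rw [lagCoeff_eq_zero _ (by simpa using hn)]
  simp

lemma hermiteFun_eq {j N : ℕ} (h : j < N) (k : ℕ) (H : MvPolynomial (Fin m) ℂ) :
    hermiteFun m j k H = gaussMul m (lagPoly m j k N H) := by
  rw [lagPoly_eq h]
  ext x
  rw [hermiteFun_apply, gaussMul_apply]
  congr 1
  have h1 : polyVal (lagPoly m j k (j + 1) H) x =
      (∑ n ∈ Finset.range (j + 1), (lagCoeff (lagParam m k) j n : ℂ) *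
        polyVal (polyNormSq m) x ^ n) * polyVal H x := by
    simp only [polyVal, lagPoly, map_sum, MvPolynomial.smul_eval, map_mul, map_pow, Finset.sum_mul,
      mul_assoc]
  rw [h1, polyVal_polyNormSq, laguerre]
  congr 1
  rw [← Complex.ofReal_natCast (j !), ← Complex.ofReal_ofNat, ← Complex.ofReal_pow]
  simp only [← Complex.ofReal_mul, ← Complex.ofReal_pow, ← Complex.ofReal_sum]
  congr 1
  rw [Finset.mul_sum]
  refine Finset.sum_congr rfl fun n hn => ?_
  have hn' : n ≤ j := Nat.lt_succ_iff.1 (Finset.mem_range.1 hn)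
  rw [lagCoeff, Nat.cast_choose ℝ hn', neg_pow]
  unfold lagParam
  field_simp

variable {k : ℕ} {H : MvPolynomial (Fin m) ℂ}

lemma polyLap_lagPoly (hH : H ∈ sphericalHarmonics m k) (j N : ℕ) :
    polyLap m (lagPoly m j k (N + 1) H) = ∑ n ∈ Finset.range N,
      ((4 * ((n + 1) * (n + 1 + lagParam m k) * lagCoeff (lagParam m k) j (n + 1)) : ℝ) : ℂ) •
        (polyNormSq m ^ n * H) := by
  rw [lagPoly, Finset.sum_range_succ', map_add, map_sum, map_smul, pow_zero, one_mul,
    (mem_sphericalHarmonics.1 hH).2, smul_zero, add_zero]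
  refine Finset.sum_congr rfl fun n _ => ?_
  rw [map_smul, polyLap_pow_mul hH, smul_smul]
  congr 1
  push_cast [lagParam]
  ring

lemma opF_hermiteFun_zero (hH : H ∈ sphericalHarmonics m k) :
    opF m (hermiteFun m 0 k H) = 0 := by
  rw [hermiteFun_eq (Nat.lt_succ_self 0), opF_gaussMul, polyLap_lagPoly hH]
  simp

lemma opF_hermiteFun_succ (hm : 2 ≤ m) (hH : H ∈ sphericalHarmonics m k) (j : ℕ) :
    opF m (hermiteFun m (j + 1) k H) =
      ((-(2 * (j + 1) * (j + 1 + lagParam m k)) : ℝ) : ℂ) • hermiteFun m j k H := by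
  rw [hermiteFun_eq (Nat.lt_succ_self (j + 1)), opF_gaussMul, polyLap_lagPoly hH,
    hermiteFun_eq (Nat.lt_succ_self j), ← map_smul, ← map_smul]
  congr 1
  rw [lagPoly, Finset.smul_sum, Finset.smul_sum]
  refine Finset.sum_congr rfl fun n _ => ?_
  rw [smul_smul, smul_smul, lagCoeff_succ_succ (lagParam_nonneg hm k)]
  congr 1
  push_cast
  ring

lemma opH_hermiteFun (hm : 2 ≤ m) (hH : H ∈ sphericalHarmonics m k) (j : ℕ) :
    opH m (hermiteFun m j k H) = ((2 * j + k + m / 2 : ℝ) : ℂ) • hermiteFun m j k H := by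
  obtain ⟨h1, h2⟩ := mem_sphericalHarmonics.1 hH
  have hE : ∀ n : ℕ, ∑ i, MvPolynomial.X i * MvPolynomial.pderiv i (polyNormSq m ^ n * H) =
      (2 * n + k : ℂ) • (polyNormSq m ^ n * H) := by
    intro n
    have := ((isHomogeneous_polyNormSq (m := m)).pow n).mul h1
    rw [this.sum_X_mul_pderiv, ← Nat.cast_smul_eq_nsmul ℂ]
    push_cast
    rfl
  rw [hermiteFun_eq (Nat.lt_succ_self j), opH_gaussMul,
    ← map_smul (gaussMul m)]
  congr 1
  have h3 : polyLap m (lagPoly m j k (j + 1) H) = ∑ n ∈ Finset.range (j + 1),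
      ((4 * ((n + 1) * (n + 1 + lagParam m k) * lagCoeff (lagParam m k) j (n + 1)) : ℝ) : ℂ) •
        (polyNormSq m ^ n * H) := by
    rw [← lagPoly_eq (Nat.lt_succ_of_lt (Nat.lt_succ_self j)), polyLap_lagPoly hH]
  have h4 : ∑ i, MvPolynomial.X i * MvPolynomial.pderiv i (lagPoly m j k (j + 1) H) =
      ∑ n ∈ Finset.range (j + 1), (lagCoeff (lagParam m k) j n : ℂ) • (2 * n + k : ℂ) •
        (polyNormSq m ^ n * H) := by
    simp only [lagPoly, map_sum, Derivation.map_smul, Finset.mul_sum]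
    rw [Finset.sum_comm]
    refine Finset.sum_congr rfl fun n _ => ?_
    rw [← hE, Finset.smul_sum]
    exact Finset.sum_congr rfl fun i _ => mul_smul_comm _ _ _
  rw [h3, h4, lagPoly, Finset.smul_sum, Finset.smul_sum, Finset.smul_sum, ← Finset.sum_add_distrib,
    ← Finset.sum_sub_distrib]
  refine Finset.sum_congr rfl fun n _ => ?_
  rw [lagCoeff_succ (lagParam_nonneg hm k)]
  simp only [smul_smul, ← add_smul, ← sub_smul]
  congr 1
  push_cast
  ring

/-- Writing `e = h + f - |x|²` reduces the claim to operators whose action is already known, without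
expanding the squares of the raising operators. -/
lemma opE_hermiteFun (hm : 2 ≤ m) (hH : H ∈ sphericalHarmonics m k) (j : ℕ) :
    opE m (hermiteFun m j k H) = (1 / 2 : ℂ) • hermiteFun m (j + 1) k H := by
  have hα := lagParam_nonneg hm k
  have h0 : opE m = opH m + opF m - normSq m := by rw [normSq_eq]; abel
  rw [h0, LinearMap.sub_apply, LinearMap.add_apply, opH_hermiteFun hm hH]
  have h3 : polyLap m (lagPoly m j k (j + 2) H) = ∑ n ∈ Finset.range (j + 2),
      ((4 * ((n + 1) * (n + 1 + lagParam m k) * lagCoeff (lagParam m k) j (n + 1)) : ℝ) : ℂ) •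
        (polyNormSq m ^ n * H) := by
    rw [lagPoly_eq (by omega), ← lagPoly_eq (N := j + 3) (by omega), polyLap_lagPoly hH]
  have h4 : polyNormSq m * lagPoly m j k (j + 1) H = ∑ n ∈ Finset.range (j + 1),
      (lagCoeff (lagParam m k) j n : ℂ) • (polyNormSq m ^ (n + 1) * H) := by
    rw [lagPoly, Finset.mul_sum]
    refine Finset.sum_congr rfl fun n _ => ?_
    rw [mul_smul_comm, pow_succ', mul_assoc]
  rw [hermiteFun_eq (N := j + 2) (by omega), hermiteFun_eq (j := j + 1) (N := j + 2) (by omega),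
    opF_gaussMul, normSq_gaussMul, h3, lagPoly_eq (N := j + 2) (by omega), h4,
    ← lagPoly_eq (N := j + 2) (by omega)]
  simp only [← map_smul, ← map_add, ← map_sub]
  congr 1
  rw [lagPoly, lagPoly, Finset.smul_sum, Finset.smul_sum, Finset.smul_sum, ← Finset.sum_add_distrib,
    Finset.sum_range_succ' _ (j + 1), Finset.sum_range_succ' _ (j + 1), add_sub_right_comm, ← Finset.sum_sub_distrib]
  congr 1
  · refine Finset.sum_congr rfl fun n _ => ?_
    have h5 := lagCoeff_raise_succ hα j n
    have h6 := lagCoeff_succ hα j (n + 1)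
    rw [h6]
    simp only [smul_smul, ← add_smul, ← sub_smul]
    congr 1
    have h8 := congrArg Complex.ofReal h5
    push_cast [lagParam] at h8 ⊢
    linear_combination -h8
  · have h5 := lagCoeff_raise_zero hα j
    have h6 := lagCoeff_succ hα j 0
    simp only [pow_zero, one_mul]
    rw [h6]
    simp only [smul_smul, ← add_smul]
    congr 1
    have h8 := congrArg Complex.ofReal h5
    push_cast [lagParam] at h8 ⊢
    linear_combination -h8

/-- With `α = m/2 + k - 1`, the terms of `Ω` contribute `1 + (2j+α+1)² - 2j(j+α) - 2(j+1)(j+1+α)`,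
where `j` cancels and `α²` remains. -/
lemma casimir_hermiteFun (hm : 2 ≤ m) (hH : H ∈ sphericalHarmonics m k) (j : ℕ) :
    casimir m (hermiteFun m j k H) = ((lagParam m k ^ 2 : ℝ) : ℂ) • hermiteFun m j k H := by
  rw [casimir]
  simp only [LinearMap.add_apply, LinearMap.smul_apply, Module.End.mul_apply, pow_two (opH m),
    opH_hermiteFun hm hH, opE_hermiteFun hm hH, map_smul, Module.End.one_apply]
  have h1 := opF_hermiteFun_succ hm hH j
  rw [h1]
  cases j with
  | zero =>
    rw [opF_hermiteFun_zero hH, map_zero]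
    unfold lagParam
    push_cast
    module
  | succ j =>
    rw [opF_hermiteFun_succ hm hH j, map_smul, opE_hermiteFun hm hH]
    unfold lagParam
    push_cast
    module

/-- The Hermite functions as a linear map of the spherical harmonic. -/
def hermiteLM (m j k : ℕ) : sphericalHarmonics m k →ₗ[ℂ] Sch m where
  toFun H := hermiteFun m j k H
  map_add' p q := by
    ext x
    rw [add_apply]
    simp only [hermiteFun_apply]
    simp [polyVal]
    ring
  map_smul' c p := by
    ext x
    rw [smul_apply]
    simp only [hermiteFun_apply]
    simp [polyVal]
    ring

lemma hermiteLM_apply (j : ℕ) (H : sphericalHarmonics m k) :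
    hermiteLM m j k H = hermiteFun m j k H := rfl

/-- The span of the Hermite functions attached to `j` and `k`. -/
def hermiteSpace (m j k : ℕ) : Submodule ℂ (Sch m) := LinearMap.range (hermiteLM m j k)

lemma mem_hermiteSpace {j k : ℕ} {u : Sch m} :
    u ∈ hermiteSpace m j k ↔ ∃ H ∈ sphericalHarmonics m k, hermiteFun m j k H = u := by
  simp [hermiteSpace, hermiteLM_apply]

/-! ### Polynomials are spanned by `|x|^{2j} H` -/

/-- The span of all Hermite functions. -/
def hermiteSpan (m : ℕ) : Submodule ℂ (Sch m) := ⨆ j, ⨆ k, hermiteSpace m j k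

lemma hermiteFun_mem_hermiteSpan (j : ℕ) {k : ℕ} {H : MvPolynomial (Fin m) ℂ}
    (hH : H ∈ sphericalHarmonics m k) : hermiteFun m j k H ∈ hermiteSpan m :=
  le_iSup_of_le (f := fun j => ⨆ k, hermiteSpace m j k) j
    (le_iSup (fun k => hermiteSpace m j k) k) (mem_hermiteSpace.2 ⟨H, hH, rfl⟩)

lemma hermiteSpan_le {V : Submodule ℂ (Sch m)}
    (h : ∀ j k, ∀ H ∈ sphericalHarmonics m k, hermiteFun m j k H ∈ V) : hermiteSpan m ≤ V := by
  refine iSup_le fun j => iSup_le fun k => ?_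
  intro u hu
  obtain ⟨H, hH, rfl⟩ := mem_hermiteSpace.1 hu
  exact h j k H hH

lemma normSq_hermiteFun_mem (hm : 2 ≤ m) (j : ℕ) {k : ℕ} {H : MvPolynomial (Fin m) ℂ}
    (hH : H ∈ sphericalHarmonics m k) : normSq m (hermiteFun m j k H) ∈ hermiteSpan m := by
  rw [normSq_eq, LinearMap.sub_apply, LinearMap.add_apply, opH_hermiteFun hm hH,
    opE_hermiteFun hm hH]
  refine Submodule.sub_mem _ (Submodule.add_mem _ ?_ ?_) ?_
  · exact Submodule.smul_mem _ _ (hermiteFun_mem_hermiteSpan j hH)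
  · cases j with
    | zero => rw [opF_hermiteFun_zero hH]; exact Submodule.zero_mem _
    | succ j =>
      rw [opF_hermiteFun_succ hm hH]
      exact Submodule.smul_mem _ _ (hermiteFun_mem_hermiteSpan j hH)
  · exact Submodule.smul_mem _ _ (hermiteFun_mem_hermiteSpan (j + 1) hH)

lemma hermiteSpan_le_comap_normSq (hm : 2 ≤ m) :
    hermiteSpan m ≤ (hermiteSpan m).comap (normSq m) :=
  hermiteSpan_le fun j _ _ hH => normSq_hermiteFun_mem hm j hH

lemma hermiteFun_zero (hm : 2 ≤ m) (k : ℕ) (H : MvPolynomial (Fin m) ℂ) :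
    hermiteFun m 0 k H = gaussMul m H := by
  rw [hermiteFun_eq zero_lt_one]
  have h := Gamma_ne_zero_of_nonneg (lagParam_nonneg hm k) 0
  have h2 : lagCoeff (lagParam m k) 0 0 = 1 := by
    simp only [lagCoeff, Nat.choose_self, pow_zero, Nat.cast_one, mul_one, div_self h]
  simp [lagPoly, h2]

lemma gaussMul_pow_mul_mem (hm : 2 ≤ m) {k : ℕ} {H : MvPolynomial (Fin m) ℂ}
    (hH : H ∈ sphericalHarmonics m k) (j : ℕ) :
    gaussMul m (polyNormSq m ^ j * H) ∈ hermiteSpan m := by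
  induction j with
  | zero =>
    rw [pow_zero, one_mul, ← hermiteFun_zero hm k]
    exact hermiteFun_mem_hermiteSpan 0 hH
  | succ j ih =>
    rw [pow_succ', mul_assoc, ← normSq_gaussMul]
    exact hermiteSpan_le_comap_normSq hm ih

/-- The span of the polynomials `|x|^{2j} H` of degree `d`, with `H` a spherical harmonic. -/
def radialSpan (m d : ℕ) : Submodule ℂ (MvPolynomial (Fin m) ℂ) :=
  Submodule.span ℂ {p | ∃ j k, 2 * j + k = d ∧ ∃ H ∈ sphericalHarmonics m k,
    p = polyNormSq m ^ j * H}

/-- The factor in `polyLap_pow_mul` is nonzero, so each generator has an explicit preimage two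
degrees higher. -/
lemma radialSpan_le_map_polyLap (hm : 2 ≤ m) (d : ℕ) :
    radialSpan m d ≤ (radialSpan m (d + 2)).map (polyLap m) := by
  refine Submodule.span_le.2 ?_
  rintro _ ⟨j, k, hd, H, hH, rfl⟩
  have hc : (4 * (j + 1) * (j + k + m / 2 : ℂ)) ≠ 0 := by
    have : (4 * (j + 1) * (j + k + m / 2 : ℝ)) ≠ 0 := by
      have : (0 : ℝ) < m := by exact_mod_cast (by omega : 0 < m)
      positivity
    have h2 : (4 * (j + 1) * (j + k + m / 2 : ℂ)) =
        ((4 * (j + 1) * (j + k + m / 2 : ℝ) : ℝ) : ℂ) := by push_cast; rfl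
    rw [h2]
    exact Complex.ofReal_ne_zero.2 this
  refine ⟨(4 * (j + 1) * (j + k + m / 2 : ℂ))⁻¹ • (polyNormSq m ^ (j + 1) * H),
    Submodule.smul_mem _ _ (Submodule.subset_span ⟨j + 1, k, by omega, H, hH, rfl⟩), ?_⟩
  rw [map_smul, polyLap_pow_mul hH, smul_smul, inv_mul_cancel₀ hc, one_smul]

lemma radialSpan_le_homogeneous (d : ℕ) :
    radialSpan m d ≤ MvPolynomial.homogeneousSubmodule (Fin m) ℂ d := by
  refine Submodule.span_le.2 ?_
  rintro _ ⟨j, k, rfl, H, hH, rfl⟩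
  exact (isHomogeneous_polyNormSq.pow j).mul (mem_sphericalHarmonics.1 hH).1

lemma polyLap_isHomogeneous {d : ℕ} {p : MvPolynomial (Fin m) ℂ} (hp : p.IsHomogeneous (d + 2)) :
    (polyLap m p).IsHomogeneous d := by
  rw [polyLap_apply]
  exact MvPolynomial.IsHomogeneous.sum _ _ _ fun i _ => hp.pderiv.pderiv

lemma mem_radialSpan_of_polyLap_eq_zero {d : ℕ} {p : MvPolynomial (Fin m) ℂ}
    (hp : p.IsHomogeneous d) (h : polyLap m p = 0) : p ∈ radialSpan m d :=
  Submodule.subset_span ⟨0, d, by omega, p, mem_sphericalHarmonics.2 ⟨hp, h⟩, by simp⟩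

lemma pderiv_eq_zero_of_isHomogeneous_zero {p : MvPolynomial (Fin m) ℂ} (hp : p.IsHomogeneous 0)
    (i : Fin m) : MvPolynomial.pderiv i p = 0 := by
  rw [MvPolynomial.totalDegree_eq_zero_iff_eq_C.1
    ((MvPolynomial.totalDegree_zero_iff_isHomogeneous _).2 hp)]
  simp

/-- The decomposition `p = ∑ |x|^{2j} H_j`, by induction on the degree: `Δp` is radial by induction,
hence equals `Δq` for a radial `q` of degree `d`, and `p - q` is harmonic. -/
lemma mem_radialSpan (hm : 2 ≤ m) (d : ℕ) {p : MvPolynomial (Fin m) ℂ} (hp : p.IsHomogeneous d) :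
    p ∈ radialSpan m d := by
  induction d using Nat.strong_induction_on generalizing p with
  | _ d ih =>
    match d, hp, ih with
    | 0, hp, _ =>
      refine mem_radialSpan_of_polyLap_eq_zero hp ?_
      rw [polyLap_apply]
      simp [pderiv_eq_zero_of_isHomogeneous_zero hp]
    | 1, hp, _ =>
      refine mem_radialSpan_of_polyLap_eq_zero hp ?_
      rw [polyLap_apply]
      exact Finset.sum_eq_zero fun i _ => pderiv_eq_zero_of_isHomogeneous_zero hp.pderiv i
    | d + 2, hp, ih =>
      obtain ⟨q, hq, hqp⟩ := radialSpan_le_map_polyLap hm d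
        (ih d (by omega) (polyLap_isHomogeneous hp))
      have hq' := radialSpan_le_homogeneous (d + 2) hq
      have : p - q ∈ radialSpan m (d + 2) :=
        mem_radialSpan_of_polyLap_eq_zero
          (Submodule.sub_mem (MvPolynomial.homogeneousSubmodule (Fin m) ℂ (d + 2)) hp hq')
          (by rw [map_sub, hqp, sub_self])
      simpa using Submodule.add_mem _ this hq

lemma gaussMul_mem_hermiteSpan (hm : 2 ≤ m) (p : MvPolynomial (Fin m) ℂ) :
    gaussMul m p ∈ hermiteSpan m := by
  rw [← MvPolynomial.sum_homogeneousComponent p, map_sum]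
  refine Submodule.sum_mem _ fun d _ => ?_
  have h := mem_radialSpan hm d (MvPolynomial.homogeneousComponent_isHomogeneous d p)
  have h2 : radialSpan m d ≤ (hermiteSpan m).comap (gaussMul m) := by
    refine Submodule.span_le.2 ?_
    rintro _ ⟨j, k, -, H, hH, rfl⟩
    exact gaussMul_pow_mul_mem hm hH j
  exact h2 h

/-! ### Completeness in `L²` -/

lemma memLp_gaussian_mul_exp (c : ℝ) :
    MemLp (fun x : Eu m => Real.exp (-‖x‖ ^ 2 / 2) * Real.exp (c * ‖x‖)) 2 volume := by
  have hc : Continuous (fun x : Eu m => Real.exp (-‖x‖ ^ 2 / 2) * Real.exp (c * ‖x‖)) := by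
    fun_prop
  rw [memLp_two_iff_integrable_sq hc.aestronglyMeasurable]
  -- The constant comes from completing the square: `-r² + 2cr ≤ 2c² - r²/2`.
  refine ((gaussianReal m).integrable (μ := volume)).const_mul (Real.exp (2 * c ^ 2)) |>.mono'
    (hc.pow 2).aestronglyMeasurable (Filter.Eventually.of_forall fun x => ?_)
  rw [Real.norm_of_nonneg (by positivity)]
  change _ ≤ Real.exp (2 * c ^ 2) * Real.exp (-(1 / 2) * ‖x‖ ^ 2)
  rw [mul_pow, ← Real.exp_nat_mul, ← Real.exp_nat_mul, ← Real.exp_add, ← Real.exp_add]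
  refine Real.exp_le_exp.2 ?_
  push_cast
  nlinarith [sq_nonneg (‖x‖ - 2 * c)]

lemma integrable_mul_gaussian_mul_exp (u : L2 m) (c : ℝ) :
    Integrable (fun x : Eu m => ‖u x‖ * (Real.exp (-‖x‖ ^ 2 / 2) * Real.exp (c * ‖x‖))) volume :=
  (Lp.memLp u).norm.integrable_mul (memLp_gaussian_mul_exp c)

lemma integrable_mul_gaussian (u : L2 m) :
    Integrable (fun x : Eu m => u x * (Real.exp (-‖x‖ ^ 2 / 2) : ℂ)) volume := by
  have h := integrable_mul_gaussian_mul_exp u 0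
  refine h.mono' ((Lp.aestronglyMeasurable u).mul
    (by fun_prop : Continuous _).aestronglyMeasurable) (Filter.Eventually.of_forall fun x => ?_)
  rw [norm_mul, Complex.norm_real, Real.norm_of_nonneg (Real.exp_pos _).le]
  simp

/-- Powers of a linear form are polynomials, so orthogonality to all `p e^{-|x|²/2}` kills these
moments. -/
lemma integral_mul_gaussian_mul_inner_pow (u : L2 m)
    (hu : ∀ p, inner ℂ (toL2 m (gaussMul m p)) u = 0) (ξ : Eu m) (n : ℕ) :
    ∫ x, (u x * (Real.exp (-‖x‖ ^ 2 / 2) : ℂ)) * ((inner ℝ x ξ : ℝ) : ℂ) ^ n = 0 := by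
  set p : MvPolynomial (Fin m) ℂ :=
    (∑ i, MvPolynomial.C ((ξ i : ℝ) : ℂ) * MvPolynomial.X i) ^ n with hp
  have hval : ∀ x : Eu m, polyVal p x = (((inner ℝ x ξ : ℝ) ^ n : ℝ) : ℂ) := by
    intro x
    have : (inner ℝ x ξ : ℝ) = ∑ i, ξ i * x i := by
      simp [PiLp.inner_apply]
    rw [this, hp]
    simp [polyVal]
  rw [← hu p, toL2_apply, L2.inner_def]
  refine integral_congr_ae ?_
  filter_upwards [(gaussMul m p).coeFn_toLp 2 volume] with x hx
  rw [hx, gaussMul_apply, hval]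
  simp only [RCLike.inner_apply, map_mul, Complex.conj_ofReal]
  push_cast
  ring

/-- The exponential is expanded into moments. Termwise integration is allowed because the absolute
series sums to `|u| e^{-|x|²/2} e^{c|x|}`, which is integrable. -/
lemma fourier_mul_gaussian_eq_zero (u : L2 m)
    (hu : ∀ p, inner ℂ (toL2 m (gaussMul m p)) u = 0) (ξ : Eu m) :
    ∫ x, Complex.exp ((-2 * Real.pi * inner ℝ x ξ : ℝ) * Complex.I) *
      (u x * (Real.exp (-‖x‖ ^ 2 / 2) : ℂ)) = 0 := by
  set w : Eu m → ℂ := fun x => u x * (Real.exp (-‖x‖ ^ 2 / 2) : ℂ) with hw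
  have hwm : AEStronglyMeasurable w volume := (integrable_mul_gaussian u).aestronglyMeasurable
  have hnorm : ∀ x, ‖w x‖ = ‖u x‖ * Real.exp (-‖x‖ ^ 2 / 2) := by
    intro x
    rw [hw, norm_mul, Complex.norm_real, Real.norm_of_nonneg (Real.exp_pos _).le]
  set c : ℝ := 2 * Real.pi * ‖ξ‖ with hc
  have hpos : 0 ≤ c := by positivity
  have key := hasSum_integral_of_dominated_convergence (μ := (volume : Measure (Eu m)))
    (F := fun n x => ((-2 * Real.pi * inner ℝ x ξ : ℝ) * Complex.I) ^ n / (n ! : ℂ) * w x)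
    (f := fun x => Complex.exp ((-2 * Real.pi * inner ℝ x ξ : ℝ) * Complex.I) * w x)
    (fun n x => (c * ‖x‖) ^ n / (n ! : ℝ) * ‖w x‖) ?_ ?_ ?_ ?_ ?_
  · have hz : ∀ n : ℕ, ∫ x : Eu m,
        ((-2 * Real.pi * inner ℝ x ξ : ℝ) * Complex.I) ^ n / (n ! : ℂ) * w x = 0 := by
      intro n
      have h0 := integral_mul_gaussian_mul_inner_pow u hu ξ n
      have h1 : ∀ x, ((-2 * Real.pi * inner ℝ x ξ : ℝ) * Complex.I) ^ n / (n ! : ℂ) * w x =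
          ((-2 * Real.pi * Complex.I) ^ n / (n ! : ℂ)) * (w x * ((inner ℝ x ξ : ℝ) : ℂ) ^ n) := by
        intro x
        push_cast
        rw [mul_right_comm, mul_pow _ ((inner ℝ x ξ : ℝ) : ℂ)]
        ring
      simp_rw [h1]
      rw [integral_const_mul, h0, mul_zero]
    simp only [hz] at key
    exact key.unique hasSum_zero
  · intro n
    exact (by fun_prop : Continuous _).aestronglyMeasurable.mul hwm
  · intro n
    refine Filter.Eventually.of_forall fun x => ?_
    rw [norm_mul, norm_div, norm_pow, norm_mul, Complex.norm_I, mul_one, Complex.norm_real,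
      Complex.norm_natCast]
    gcongr
    rw [Real.norm_eq_abs, abs_mul, abs_mul, abs_neg, abs_two, abs_of_pos Real.pi_pos, hc]
    have := abs_real_inner_le_norm x ξ
    calc 2 * Real.pi * |inner ℝ x ξ| ≤ 2 * Real.pi * (‖x‖ * ‖ξ‖) := by gcongr
      _ = _ := by ring
  · refine Filter.Eventually.of_forall fun x => ?_
    exact (Real.summable_pow_div_factorial _).mul_right _
  · have h1 : ∀ x : Eu m, ∑' n : ℕ, (c * ‖x‖) ^ n / (n ! : ℝ) * ‖w x‖ =
        ‖u x‖ * (Real.exp (-‖x‖ ^ 2 / 2) * Real.exp (c * ‖x‖)) := by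
      intro x
      rw [tsum_mul_right, hnorm, Real.exp_eq_exp_ℝ, NormedSpace.exp_eq_tsum_div]
      ring
    simp_rw [h1]
    exact integrable_mul_gaussian_mul_exp u c
  · refine Filter.Eventually.of_forall fun x => ?_
    have := NormedSpace.expSeries_div_hasSum_exp
      (((-2 * Real.pi * inner ℝ x ξ : ℝ) * Complex.I : ℂ))
    rw [← Complex.exp_eq_exp_ℂ] at this
    exact this.mul_right _

/-- The Fourier transform of `u e^{-|x|²/2}` vanishes. Moving the transform onto a test function,
and using that every Schwartz function is a Fourier transform, shows that the product vanishes
almost everywhere; the Gaussian has no zeros. -/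
lemma eq_zero_of_forall_gaussMul (u : L2 m)
    (hu : ∀ p, inner ℂ (toL2 m (gaussMul m p)) u = 0) : u = 0 := by
  set w : Eu m → ℂ := fun x => u x * (Real.exp (-‖x‖ ^ 2 / 2) : ℂ) with hw
  have hwi : Integrable w volume := integrable_mul_gaussian u
  have hF : FourierTransform.fourier w = 0 := by
    ext ξ
    rw [Real.fourier_eq']
    exact fourier_mul_gaussian_eq_zero u hu ξ
  have hS : ∀ g : Sch m, ∫ x, g x * w x = 0 := by
    intro g
    have h1 := VectorFourier.integral_fourierIntegral_smul_eq_flip (L := innerₗ (Eu m))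
      (μ := volume) (ν := volume) (f := ⇑(FourierTransformInv.fourierInv g)) (g := w)
      Real.continuous_fourierChar continuous_inner
      ((FourierTransformInv.fourierInv g).integrable) hwi
    rw [flip_innerₗ] at h1
    have h2 : VectorFourier.fourierIntegral Real.fourierChar volume (innerₗ (Eu m)) w = 0 := hF
    have h3 : VectorFourier.fourierIntegral Real.fourierChar volume (innerₗ (Eu m))
        ⇑(FourierTransformInv.fourierInv g) = ⇑g := by
      change ⇑(FourierTransform.fourier (FourierTransformInv.fourierInv g)) = ⇑g
      rw [FourierTransform.fourier_fourierInv_eq]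
    rw [h2, h3] at h1
    simpa using h1
  have hae : ∀ᵐ x ∂(volume : Measure (Eu m)), w x = 0 := by
    refine ae_eq_zero_of_integral_contDiff_smul_eq_zero hwi.locallyIntegrable fun g hg hgs => ?_
    have hsupp : HasCompactSupport (fun x => (g x : ℂ)) :=
      hgs.comp_left (g := fun t : ℝ => (t : ℂ)) Complex.ofReal_zero
    have hsm : ContDiff ℝ ∞ (fun x => (g x : ℂ)) := Complex.ofRealCLM.contDiff.comp hg
    have := hS (hsupp.toSchwartzMap hsm)
    simpa using this
  rw [Lp.eq_zero_iff_ae_eq_zero]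
  filter_upwards [hae] with x hx
  simpa [hw] using hx

/-- The Hermite functions are complete in `L²`. -/
lemma eq_zero_of_forall_hermiteFun (hm : 2 ≤ m) (u : L2 m)
    (hu : ∀ j k, ∀ H ∈ sphericalHarmonics m k, inner ℂ (toL2 m (hermiteFun m j k H)) u = 0) :
    u = 0 := by
  refine eq_zero_of_forall_gaussMul u fun p => ?_
  have h : hermiteSpan m ≤ (LinearMap.ker (innerₛₗ ℂ u)).comap (toL2 m) := by
    refine hermiteSpan_le fun j k H hH => ?_
    simpa [inner_eq_zero_symm] using hu j k H hH
  have := h (gaussMul_mem_hermiteSpan hm p)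
  simpa [inner_eq_zero_symm] using this

/-! ### The norms `‖h^N g‖` control the Schwartz seminorms -/

/-- The norm `‖h^N g‖` in `L²`. -/
def hNorm (N : ℕ) (g : Sch m) : ℝ := ‖toL2 m ((opH m ^ N) g)‖

lemma hNorm_nonneg (N : ℕ) (g : Sch m) : 0 ≤ hNorm N g := norm_nonneg _

lemma hNorm_zero (g : Sch m) : hNorm 0 g = ‖toL2 m g‖ := by simp [hNorm]

lemma hNorm_opH (N : ℕ) (g : Sch m) : hNorm N (opH m g) = hNorm (N + 1) g := by
  rw [hNorm, hNorm, pow_succ, Module.End.mul_apply]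

lemma hNorm_add_le (N : ℕ) (f g : Sch m) : hNorm N (f + g) ≤ hNorm N f + hNorm N g := by
  simp only [hNorm, map_add]; exact norm_add_le _ _

lemma hNorm_sub_le (N : ℕ) (f g : Sch m) : hNorm N (f - g) ≤ hNorm N f + hNorm N g := by
  simp only [hNorm, map_sub]; exact norm_sub_le _ _

lemma hNorm_smul (N : ℕ) (c : ℂ) (g : Sch m) : hNorm N (c • g) = ‖c‖ * hNorm N g := by
  simp only [hNorm, map_smul, norm_smul]

lemma ip_self (g : Sch m) : ip g g = ((‖toL2 m g‖ ^ 2 : ℝ) : ℂ) := by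
  rw [ip, inner_self_eq_norm_sq_to_K]; push_cast; rfl

lemma norm_ip_le (f g : Sch m) : ‖ip f g‖ ≤ ‖toL2 m f‖ * ‖toL2 m g‖ := norm_inner_le_norm _ _

lemma ip_sum_right {ι : Type*} (s : Finset ι) (f : Sch m) (g : ι → Sch m) :
    ip f (∑ i ∈ s, g i) = ∑ i ∈ s, ip f (g i) := by
  simp [ip, map_sum, inner_sum]

lemma ip_opH_self (g : Sch m) :
    ip g (opH m g) = ((1 / 2 * ∑ i, ‖toL2 m (lower i g)‖ ^ 2 + m / 2 * ‖toL2 m g‖ ^ 2 : ℝ) : ℂ) := by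
  rw [opH_eq]
  simp only [LinearMap.add_apply, LinearMap.smul_apply, LinearMap.sum_apply, Module.End.mul_apply,
    Module.End.one_apply, ip_add_right, ip_smul_right, ip_sum_right, ← isAdj_lower _ _ _, ip_self]
  push_cast
  rfl

lemma sum_lower_add_le (g : Sch m) :
    1 / 2 * ∑ i, ‖toL2 m (lower i g)‖ ^ 2 + m / 2 * ‖toL2 m g‖ ^ 2 ≤
      ‖toL2 m g‖ * ‖toL2 m (opH m g)‖ := by
  refine le_trans ?_ (norm_ip_le g (opH m g))
  rw [ip_opH_self, Complex.norm_real]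
  exact le_abs_self _

/-- Here `m ≥ 2` gives `h ≥ m/2 ≥ 1` in the sense of forms. This makes the norms `‖h^N g‖`
increasing in `N`. -/
lemma norm_le_norm_opH (hm : 2 ≤ m) (g : Sch m) : ‖toL2 m g‖ ≤ ‖toL2 m (opH m g)‖ := by
  have h := sum_lower_add_le g
  have h1 : 0 ≤ ∑ i, ‖toL2 m (lower i g)‖ ^ 2 := Finset.sum_nonneg fun i _ => sq_nonneg _
  have h2 : (2 : ℝ) ≤ m := by exact_mod_cast hm
  have h3 := norm_nonneg (toL2 m g)
  rcases h3.eq_or_lt with h4 | h4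
  · rw [← h4]; exact norm_nonneg _
  · refine le_of_mul_le_mul_left ?_ h4
    nlinarith [sq_nonneg ‖toL2 m g‖]

/-- The term `2‖g‖²` is kept on the left because it is exactly the difference between the squared
norms of the raised and the lowered function, so one inequality serves both. -/
lemma norm_lower_sq_le (hm : 2 ≤ m) (i : Fin m) (g : Sch m) :
    ‖toL2 m (lower i g)‖ ^ 2 + 2 * ‖toL2 m g‖ ^ 2 ≤ 2 * ‖toL2 m (opH m g)‖ ^ 2 := by
  have h := sum_lower_add_le g
  have h1 : ‖toL2 m (lower i g)‖ ^ 2 ≤ ∑ i, ‖toL2 m (lower i g)‖ ^ 2 :=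
    Finset.single_le_sum (f := fun i => ‖toL2 m (lower i g)‖ ^ 2) (fun i _ => sq_nonneg _)
      (Finset.mem_univ i)
  have h2 : (2 : ℝ) ≤ m := by exact_mod_cast hm
  have h3 := norm_nonneg (toL2 m g)
  have h4 := norm_le_norm_opH hm g
  nlinarith [sq_nonneg ‖toL2 m g‖]

lemma norm_lower_le (hm : 2 ≤ m) (i : Fin m) (g : Sch m) :
    ‖toL2 m (lower i g)‖ ≤ 2 * ‖toL2 m (opH m g)‖ := by
  have h := norm_lower_sq_le hm i g
  refine abs_le_of_sq_le_sq' ?_ (by positivity) |>.2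
  nlinarith [sq_nonneg ‖toL2 m g‖, sq_nonneg ‖toL2 m (opH m g)‖]

lemma norm_raise_le (hm : 2 ≤ m) (i : Fin m) (g : Sch m) :
    ‖toL2 m (raise i g)‖ ≤ 2 * ‖toL2 m (opH m g)‖ := by
  have h := norm_lower_sq_le hm i g
  have h1 : ‖toL2 m (raise i g)‖ ^ 2 = ‖toL2 m (lower i g)‖ ^ 2 + 2 * ‖toL2 m g‖ ^ 2 := by
    have h2 : ip (raise i g) (raise i g) = ip (lower i g) (lower i g) + 2 * ip g g := by
      rw [(isAdj_lower i).symm, ← Module.End.mul_apply, lower_mul_raise, if_pos rfl,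
        LinearMap.add_apply, ip_add_right, Module.End.mul_apply, ← isAdj_lower,
        ← ip_smul_right]
      congr 2
      rw [show (2 : Module.End ℂ (Sch m)) = 1 + 1 from one_add_one_eq_two.symm, two_smul]
      rfl
    rw [ip_self, ip_self, ip_self] at h2
    exact_mod_cast h2
  refine abs_le_of_sq_le_sq' ?_ (by positivity) |>.2
  nlinarith [sq_nonneg ‖toL2 m g‖, sq_nonneg ‖toL2 m (opH m g)‖]

lemma hNorm_succ_le (hm : 2 ≤ m) (N : ℕ) (g : Sch m) : hNorm N g ≤ hNorm (N + 1) g := by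
  rw [hNorm, hNorm, pow_succ', Module.End.mul_apply]
  exact norm_le_norm_opH hm _

lemma hNorm_mono (hm : 2 ≤ m) {N M : ℕ} (h : N ≤ M) (g : Sch m) : hNorm N g ≤ hNorm M g :=
  monotone_nat_of_le_succ (f := fun N => hNorm N g) (fun N => hNorm_succ_le hm N g) h

/-- Commuting one factor `h` past the lowering operator produces one extra term of the same kind,
whence the doubling at each step. -/
lemma hNorm_lower_le (hm : 2 ≤ m) (i : Fin m) (N : ℕ) (g : Sch m) :
    hNorm N (lower i g) ≤ 2 * 2 ^ N * hNorm (N + 1) g := by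
  induction N generalizing g with
  | zero => simpa [hNorm] using norm_lower_le hm i g
  | succ N ih =>
    have h : opH m (lower i g) = lower i (opH m g) - lower i g := by
      rw [← Module.End.mul_apply, opH_mul_lower]; rfl
    rw [← hNorm_opH, h]
    have h1 := hNorm_sub_le N (lower i (opH m g)) (lower i g)
    have h2 := ih (opH m g)
    rw [hNorm_opH] at h2
    have h3 := (ih g).trans (mul_le_mul_of_nonneg_left (hNorm_succ_le hm (N + 1) g)
      (by positivity : (0 : ℝ) ≤ 2 * 2 ^ N))
    rw [pow_succ (2 : ℝ) N]
    linarith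

lemma hNorm_raise_le (hm : 2 ≤ m) (i : Fin m) (N : ℕ) (g : Sch m) :
    hNorm N (raise i g) ≤ 2 * 2 ^ N * hNorm (N + 1) g := by
  induction N generalizing g with
  | zero => simpa [hNorm] using norm_raise_le hm i g
  | succ N ih =>
    have h : opH m (raise i g) = raise i (opH m g) + raise i g := by
      rw [← Module.End.mul_apply, opH_mul_raise]; rfl
    rw [← hNorm_opH, h]
    have h1 := hNorm_add_le N (raise i (opH m g)) (raise i g)
    have h2 := ih (opH m g)
    rw [hNorm_opH] at h2
    have h3 := (ih g).trans (mul_le_mul_of_nonneg_left (hNorm_succ_le hm (N + 1) g)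
      (by positivity : (0 : ℝ) ≤ 2 * 2 ^ N))
    rw [pow_succ (2 : ℝ) N]
    linarith

/-- Operators that are bounded for the scale of norms `‖h^N g‖`. -/
def IsTame (X : Module.End ℂ (Sch m)) : Prop :=
  ∀ N, ∃ N' : ℕ, ∃ C : ℝ, 0 ≤ C ∧ ∀ g, hNorm N (X g) ≤ C * hNorm N' g

lemma isTame_one : IsTame (1 : Module.End ℂ (Sch m)) := fun N => ⟨N, 1, zero_le_one, by simp⟩

lemma IsTame.mul {X Y : Module.End ℂ (Sch m)} (hX : IsTame X) (hY : IsTame Y) :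
    IsTame (X * Y) := by
  intro N
  obtain ⟨N₁, C₁, hC₁, h₁⟩ := hX N
  obtain ⟨N₂, C₂, hC₂, h₂⟩ := hY N₁
  refine ⟨N₂, C₁ * C₂, by positivity, fun g => ?_⟩
  rw [Module.End.mul_apply, mul_assoc]
  exact (h₁ _).trans (mul_le_mul_of_nonneg_left (h₂ g) hC₁)

lemma IsTame.pow {X : Module.End ℂ (Sch m)} (hX : IsTame X) (n : ℕ) : IsTame (X ^ n) := by
  induction n with
  | zero => exact isTame_one
  | succ n ih => rw [pow_succ]; exact ih.mul hX

lemma IsTame.smul {X : Module.End ℂ (Sch m)} (hX : IsTame X) (c : ℂ) : IsTame (c • X) := by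
  intro N
  obtain ⟨N₁, C₁, hC₁, h₁⟩ := hX N
  refine ⟨N₁, ‖c‖ * C₁, by positivity, fun g => ?_⟩
  rw [LinearMap.smul_apply, hNorm_smul, mul_assoc]
  exact mul_le_mul_of_nonneg_left (h₁ g) (norm_nonneg c)

lemma IsTame.add (hm : 2 ≤ m) {X Y : Module.End ℂ (Sch m)} (hX : IsTame X) (hY : IsTame Y) :
    IsTame (X + Y) := by
  intro N
  obtain ⟨N₁, C₁, hC₁, h₁⟩ := hX N
  obtain ⟨N₂, C₂, hC₂, h₂⟩ := hY N
  refine ⟨max N₁ N₂, C₁ + C₂, by positivity, fun g => ?_⟩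
  rw [LinearMap.add_apply, add_mul]
  refine (hNorm_add_le _ _ _).trans (add_le_add ((h₁ g).trans ?_) ((h₂ g).trans ?_))
  · exact mul_le_mul_of_nonneg_left (hNorm_mono hm (le_max_left _ _) g) hC₁
  · exact mul_le_mul_of_nonneg_left (hNorm_mono hm (le_max_right _ _) g) hC₂

lemma IsTame.sum (hm : 2 ≤ m) {ι : Type*} (s : Finset ι) {X : ι → Module.End ℂ (Sch m)}
    (hX : ∀ i, IsTame (X i)) : IsTame (∑ i ∈ s, X i) := by
  classical
  induction s using Finset.induction_on with
  | empty => exact fun N => ⟨N, 0, le_rfl, fun g => by simp [hNorm]⟩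
  | insert a s ha ih => rw [Finset.sum_insert ha]; exact (hX a).add hm ih

lemma isTame_lower (hm : 2 ≤ m) (i : Fin m) : IsTame (lower i) := fun N =>
  ⟨N + 1, 2 * 2 ^ N, by positivity, hNorm_lower_le hm i N⟩

lemma isTame_raise (hm : 2 ≤ m) (i : Fin m) : IsTame (raise i) := fun N =>
  ⟨N + 1, 2 * 2 ^ N, by positivity, hNorm_raise_le hm i N⟩

lemma isTame_coordMul (hm : 2 ≤ m) (i : Fin m) : IsTame (coordMul m i) := by
  have : coordMul m i = (1 / 2 : ℂ) • (lower i + raise i) := by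
    simp only [lower, raise]; module
  rw [this]
  exact ((isTame_lower hm i).add hm (isTame_raise hm i)).smul _

lemma isTame_partialDeriv (hm : 2 ≤ m) (i : Fin m) : IsTame (partialDeriv m i) := by
  have : partialDeriv m i = (1 / 2 : ℂ) • (lower i + (-1 : ℂ) • raise i) := by
    simp only [lower, raise]; module
  rw [this]
  exact ((isTame_lower hm i).add hm ((isTame_raise hm i).smul _)).smul _

lemma isTame_normSq (hm : 2 ≤ m) : IsTame (normSq m) := by
  rw [normSq_eq_sum]
  exact IsTame.sum hm _ fun i => (isTame_coordMul hm i).mul (isTame_coordMul hm i)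

lemma isTame_lap (hm : 2 ≤ m) : IsTame (lap m) := by
  rw [lap_eq_sum]
  exact IsTame.sum hm _ fun i => (isTame_partialDeriv hm i).mul (isTame_partialDeriv hm i)

lemma one_add_normSq_pow_apply (M : ℕ) (g : Sch m) (x : Eu m) :
    ((1 + normSq m) ^ M) g x = (((1 + ‖x‖ ^ 2) ^ M : ℝ) : ℂ) * g x := by
  induction M generalizing g with
  | zero => simp
  | succ M ih =>
    rw [pow_succ, Module.End.mul_apply, ih, LinearMap.add_apply, Module.End.one_apply, add_apply,
      normSq_apply]
    push_cast
    ring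

/-! ### A Sobolev inequality from the Fourier transform. -/

/-- The inverse Fourier transform as a linear operator. -/
def invFourier (m : ℕ) : Module.End ℂ (Sch m) where
  toFun g := FourierTransformInv.fourierInv g
  map_add' f g := FourierTransform.fourierInv_add f g
  map_smul' c g := FourierTransform.fourierInv_smul c g

lemma coordMul_invFourier (i : Fin m) :
    coordMul m i * invFourier m =
      (Complex.I / (2 * Real.pi) : ℂ) • (invFourier m * partialDeriv m i) := by
  ext g x
  have h := SchwartzMap.fourierInv_lineDerivOp_eq g (EuclideanSpace.single i (1 : ℝ))
  have h2 : invFourier m (partialDeriv m i g) =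
      (-(2 * Real.pi * Complex.I) : ℂ) • coordMul m i (invFourier m g) := by
    refine h.trans ?_
    congr 1
    ext x
    rw [coordMul_apply, SchwartzMap.smulLeftCLM_apply_apply (by fun_prop)]
    simp [EuclideanSpace.inner_single_right, invFourier]
  rw [LinearMap.smul_apply, Module.End.mul_apply, Module.End.mul_apply, h2, smul_smul]
  have h3 : (Complex.I / (2 * Real.pi) : ℂ) * -(2 * Real.pi * Complex.I) = 1 := by
    have : (Real.pi : ℂ) ≠ 0 := by exact_mod_cast Real.pi_ne_zero
    field_simp
    simp
  rw [h3, one_smul]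

lemma normSq_invFourier :
    normSq m * invFourier m =
      invFourier m * ((Complex.I / (2 * Real.pi) : ℂ) ^ 2 • lap m) := by
  rw [normSq_eq_sum, lap_eq_sum, Finset.sum_mul, Finset.smul_sum, Finset.mul_sum]
  refine Finset.sum_congr rfl fun i _ => ?_
  rw [mul_assoc, coordMul_invFourier, mul_smul_comm, ← mul_assoc, coordMul_invFourier,
    smul_mul_assoc, smul_smul, mul_smul_comm, mul_assoc, sq]

lemma one_add_normSq_pow_invFourier (M : ℕ) :
    (1 + normSq m) ^ M * invFourier m =
      invFourier m * (1 + (Complex.I / (2 * Real.pi) : ℂ) ^ 2 • lap m) ^ M := by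
  have h : SemiconjBy (invFourier m) (1 + (Complex.I / (2 * Real.pi) : ℂ) ^ 2 • lap m)
      (1 + normSq m) := by
    rw [SemiconjBy, add_mul, normSq_invFourier, mul_add, mul_one, one_mul]
  exact (h.pow_right M).symm

lemma norm_invFourier (g : Sch m) : ‖toL2 m (invFourier m g)‖ = ‖toL2 m g‖ := by
  have := SchwartzMap.norm_fourier_toL2_eq (FourierTransformInv.fourierInv g : Sch m)
  rw [FourierTransform.fourier_fourierInv_eq] at this
  exact this.symm

lemma memLp_inv_one_add_norm_sq_pow (hm : 2 ≤ m) :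
    MemLp (fun x : Eu m => ((1 + ‖x‖ ^ 2) ^ m : ℝ)⁻¹) 2 volume := by
  have hc : Continuous (fun x : Eu m => ((1 + ‖x‖ ^ 2) ^ m : ℝ)⁻¹) :=
    Continuous.inv₀ (by fun_prop) fun x => by positivity
  rw [memLp_two_iff_integrable_sq hc.aestronglyMeasurable]
  have h2 : (2 : ℝ) ≤ m := by exact_mod_cast hm
  -- The squared weight is `(1+|x|²)^{-2m} = (1+|x|²)^{-r/2}` with `r = 4m`, which exceeds the
  -- dimension.
  refine (integrable_rpow_neg_one_add_norm_sq (E := Eu m) (r := 4 * m) (μ := volume) ?_).congr ?_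
  · rw [finrank_euclideanSpace_fin]; linarith
  · refine Filter.Eventually.of_forall fun x => ?_
    have h3 : -(4 * (m : ℝ)) / 2 = -((m * 2 : ℕ) : ℝ) := by push_cast; ring
    simp only
    rw [h3, Real.rpow_neg (by positivity), Real.rpow_natCast, inv_pow, pow_mul]

/-- Cauchy–Schwarz against the square-integrable weight `(1+|x|²)^{-m}`. -/
lemma exists_norm_toLp_one_le (hm : 2 ≤ m) :
    ∃ C : ℝ, 0 ≤ C ∧ ∀ g : Sch m, ‖g.toLp 1 volume‖ ≤ C * ‖toL2 m (((1 + normSq m) ^ m) g)‖ := by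
  set w : Eu m → ℝ := fun x => ((1 + ‖x‖ ^ 2) ^ m : ℝ)⁻¹ with hw
  have hwL := memLp_inv_one_add_norm_sq_pow hm
  refine ⟨(eLpNorm w 2 volume).toReal, ENNReal.toReal_nonneg, fun g => ?_⟩
  set v : Sch m := ((1 + normSq m) ^ m) g with hv
  have hg : ⇑g = w • ⇑v := by
    ext x
    rw [Pi.smul_apply', hv, one_add_normSq_pow_apply, hw]
    have : (1 + ‖x‖ ^ 2) ^ m ≠ 0 := by positivity
    simp only [Complex.real_smul]
    rw [← mul_assoc, ← Complex.ofReal_mul, inv_mul_cancel₀ this, Complex.ofReal_one, one_mul]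
  rw [SchwartzMap.norm_toLp, toL2_apply, SchwartzMap.norm_toLp, ← ENNReal.toReal_mul, hg]
  refine ENNReal.toReal_mono (ENNReal.mul_ne_top hwL.2.ne (v.memLp 2 volume).2.ne) ?_
  exact eLpNorm_smul_le_mul_eLpNorm (v.memLp 2 volume).1 hwL.1

/-- The sup norm is at most the `L¹` norm of the inverse Fourier transform, hence at most a weighted
`L²` norm of it. Passing the weight through the transform turns it into a power of `1 - Δ/(4π²)`, a
tame operator, and the transform is an `L²` isometry. -/
lemma exists_norm_apply_le (hm : 2 ≤ m) :
    ∃ N : ℕ, ∃ C : ℝ, 0 ≤ C ∧ ∀ (g : Sch m) (x : Eu m), ‖g x‖ ≤ C * hNorm N g := by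
  obtain ⟨C, hC, h⟩ := exists_norm_toLp_one_le hm
  have ht : IsTame ((1 + (Complex.I / (2 * Real.pi) : ℂ) ^ 2 • lap m) ^ m) :=
    (isTame_one.add hm ((isTame_lap hm).smul _)).pow m
  obtain ⟨N, C', hC', h'⟩ := ht 0
  refine ⟨N, C * C', by positivity, fun g x => ?_⟩
  have h1 := SchwartzMap.norm_fourier_apply_le_toLp_one (FourierTransformInv.fourierInv g) x
  rw [FourierTransform.fourier_fourierInv_eq] at h1
  refine h1.trans ((h (invFourier m g)).trans ?_)
  rw [← Module.End.mul_apply, one_add_normSq_pow_invFourier, Module.End.mul_apply, norm_invFourier,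
    mul_assoc, ← hNorm_zero]
  exact mul_le_mul_of_nonneg_left (h' g) hC

/-- The total derivative is a fixed linear combination of partial derivatives, so raising the order
by one costs one application of the tame operators `∂_i`. -/
lemma iteratedFDeriv_succ_norm_le (n : ℕ) (g : Sch m) (x : Eu m) :
    ‖iteratedFDeriv ℝ (n + 1) g x‖ ≤
      ∑ i, ‖(ContinuousLinearMap.smulRightL ℝ (Eu m) ℂ) (EuclideanSpace.proj (𝕜 := ℝ) i)‖ *
        ‖iteratedFDeriv ℝ n (partialDeriv m i g) x‖ := by
  have h : fderiv ℝ g = fun y => ∑ i : Fin m,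
      ((ContinuousLinearMap.smulRightL ℝ (Eu m) ℂ) (EuclideanSpace.proj (𝕜 := ℝ) i) ∘
        ⇑(partialDeriv m i g)) y := by
    ext y v
    rw [sum_apply]
    have hv : v = ∑ i, v i • EuclideanSpace.single i (1 : ℝ) := by
      have := (EuclideanSpace.basisFun (Fin m) ℝ).sum_repr v
      simpa using this.symm
    conv_lhs => rw [hv]
    rw [map_sum]
    refine Finset.sum_congr rfl fun i _ => ?_
    rw [map_smul]
    simp [partialDeriv_apply]
  have hsm : ∀ (f : Sch m), ContDiff ℝ n f := fun f => f.smooth n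
  rw [← norm_iteratedFDeriv_fderiv, h, iteratedFDeriv_fun_sum_apply]
  · refine (norm_sum_le _ _).trans (Finset.sum_le_sum fun i _ => ?_)
    exact ContinuousLinearMap.norm_iteratedFDeriv_comp_left _ (hsm _).contDiffAt le_rfl
  · intro i _
    exact (ContinuousLinearMap.contDiff _).contDiffAt.comp _ (hsm _).contDiffAt

/-- The Schwartz seminorms are bounded by the norms `‖h^N g‖`. -/
lemma exists_seminorm_le (hm : 2 ≤ m) (k n : ℕ) :
    ∃ N : ℕ, ∃ C : ℝ, 0 ≤ C ∧ ∀ (g : Sch m) (x : Eu m),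
      ‖x‖ ^ k * ‖iteratedFDeriv ℝ n g x‖ ≤ C * hNorm N g := by
  induction n with
  | zero =>
    obtain ⟨N, C, hC, h⟩ := exists_norm_apply_le hm
    obtain ⟨N', C', hC', h'⟩ := ((isTame_one.add hm (isTame_normSq hm)).pow k) N
    refine ⟨N', C * C', by positivity, fun g x => ?_⟩
    rw [norm_iteratedFDeriv_zero]
    have h1 := h (((1 + normSq m) ^ k) g) x
    rw [one_add_normSq_pow_apply, norm_mul, Complex.norm_real,
      Real.norm_of_nonneg (by positivity)] at h1
    have h2 : ‖x‖ ^ k ≤ (1 + ‖x‖ ^ 2) ^ k := by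
      refine pow_le_pow_left₀ (norm_nonneg x) ?_ k
      nlinarith [sq_nonneg (‖x‖ - 1)]
    calc ‖x‖ ^ k * ‖g x‖ ≤ (1 + ‖x‖ ^ 2) ^ k * ‖g x‖ := by gcongr
      _ ≤ C * hNorm N (((1 + normSq m) ^ k) g) := h1
      _ ≤ C * (C' * hNorm N' g) := by gcongr; exact h' g
      _ = _ := by ring
  | succ n ih =>
    obtain ⟨N, C, hC, h⟩ := ih
    set c : Fin m → ℝ := fun i =>
      ‖(ContinuousLinearMap.smulRightL ℝ (Eu m) ℂ) (EuclideanSpace.proj (𝕜 := ℝ) i)‖ with hc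
    have hc0 : ∀ i, 0 ≤ c i := fun i => by simp only [hc]; positivity
    choose N' C' hC' h' using fun i : Fin m => isTame_partialDeriv hm i N
    set M := Finset.univ.sup N' with hM
    refine ⟨M, ∑ i, c i * (C * C' i), Finset.sum_nonneg fun i _ => ?_, fun g x => ?_⟩
    · have := hC' i
      have : 0 ≤ c i := hc0 i
      positivity
    · refine (mul_le_mul_of_nonneg_left (iteratedFDeriv_succ_norm_le n g x)
        (by positivity)).trans ?_
      rw [Finset.mul_sum, Finset.sum_mul]
      refine Finset.sum_le_sum fun i _ => ?_
      have h1 : 0 ≤ c i := hc0 i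
      have h2 := hC' i
      have h3 : N' i ≤ M := Finset.le_sup (Finset.mem_univ i)
      calc ‖x‖ ^ k * (c i * ‖iteratedFDeriv ℝ n (partialDeriv m i g) x‖)
          = c i * (‖x‖ ^ k * ‖iteratedFDeriv ℝ n (partialDeriv m i g) x‖) := by ring
        _ ≤ c i * (C * hNorm N (partialDeriv m i g)) := mul_le_mul_of_nonneg_left (h _ x) h1
        _ ≤ c i * (C * (C' i * hNorm (N' i) g)) := by gcongr; exact h' i g
        _ ≤ c i * (C * (C' i * hNorm M g)) := by gcongr; exact hNorm_mono hm h3 g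
        _ = _ := by ring

/-! ### Orthogonality of the Hermite functions -/

lemma ip_eq_zero_of_eigenvalue_ne {D : Module.End ℂ (Sch m)} (hD : IsAdj D D) {a b : ℝ}
    (hab : a ≠ b) {f g : Sch m} (hf : D f = (a : ℂ) • f) (hg : D g = (b : ℂ) • g) :
    ip f g = 0 := by
  have h := hD f g
  rw [hf, hg, ip_smul_left, ip_smul_right, Complex.conj_ofReal] at h
  have h2 : ((a - b : ℝ) : ℂ) * ip f g = 0 := by push_cast; rw [sub_mul, h, sub_self]
  rcases mul_eq_zero.1 h2 with h3 | h3
  · exact absurd (sub_eq_zero.1 (Complex.ofReal_eq_zero.1 h3)) hab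
  · exact h3

lemma lagParam_sq_injective (hm : 2 ≤ m) : Function.Injective fun k => lagParam m k ^ 2 := by
  intro k k' h
  have := (sq_eq_sq₀ (lagParam_nonneg hm k) (lagParam_nonneg hm k')).1 h
  unfold lagParam at this
  exact_mod_cast (by linarith : (k : ℝ) = k')

/-- The eigenvalue of `h` on the Hermite functions attached to `j` and `k`. -/
def hEig (m j k : ℕ) : ℝ := 2 * j + k + m / 2

lemma opH_of_mem {j k : ℕ} (hm : 2 ≤ m) {u : Sch m} (hu : u ∈ hermiteSpace m j k) :
    opH m u = (hEig m j k : ℂ) • u := by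
  obtain ⟨H, hH, rfl⟩ := mem_hermiteSpace.1 hu
  exact opH_hermiteFun hm hH j

lemma casimir_of_mem {j k : ℕ} (hm : 2 ≤ m) {u : Sch m} (hu : u ∈ hermiteSpace m j k) :
    casimir m u = ((lagParam m k ^ 2 : ℝ) : ℂ) • u := by
  obtain ⟨H, hH, rfl⟩ := mem_hermiteSpace.1 hu
  exact casimir_hermiteFun hm hH j

/-- The pair `(h, Ω)` separates the components: `Ω` detects `k`, and for equal `k` the operator `h`
detects `j`. -/
lemma ip_hermiteSpace_eq_zero (hm : 2 ≤ m) {j k j' k' : ℕ} (h : (j, k) ≠ (j', k')) {u v : Sch m}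
    (hu : u ∈ hermiteSpace m j k) (hv : v ∈ hermiteSpace m j' k') : ip u v = 0 := by
  by_cases hk : k = k'
  · subst hk
    have hj : j ≠ j' := fun hj => h (by rw [hj])
    refine ip_eq_zero_of_eigenvalue_ne isAdj_opH (a := hEig m j k) (b := hEig m j' k) ?_
      (opH_of_mem hm hu) (opH_of_mem hm hv)
    intro he
    unfold hEig at he
    exact hj (by exact_mod_cast (by linarith : (j : ℝ) = j'))
  · exact ip_eq_zero_of_eigenvalue_ne isAdj_casimir
      (fun he => hk (lagParam_sq_injective hm he)) (casimir_of_mem hm hu) (casimir_of_mem hm hv)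

lemma eq_zero_of_ip_hermiteSpace (hm : 2 ≤ m) {u : Sch m}
    (hu : ∀ j k, ∀ v ∈ hermiteSpace m j k, ip v u = 0) : u = 0 := by
  refine toL2_injective ((eq_zero_of_forall_hermiteFun hm (toL2 m u) fun j k H hH => ?_).trans
    (map_zero _).symm)
  exact hu j k _ (mem_hermiteSpace.2 ⟨H, hH, rfl⟩)

lemma eq_of_ip_hermiteSpace (hm : 2 ≤ m) {u u' : Sch m}
    (hu : ∀ j k, ∀ v ∈ hermiteSpace m j k, ip v u = ip v u') : u = u' :=
  sub_eq_zero.1 (eq_zero_of_ip_hermiteSpace hm fun j k v hv => by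
    rw [ip_sub_right, hu j k v hv, sub_self])

/-! ### Projection on the span of the Hermite functions attached to `j` and `k` -/

instance finiteDimensional_sphericalHarmonics (k : ℕ) :
    FiniteDimensional ℂ (sphericalHarmonics m k) := by
  have h : FiniteDimensional ℂ (MvPolynomial.homogeneousSubmodule (Fin m) ℂ k) :=
    Module.Finite.iff_fg.2 (MvPolynomial.homogeneousSubmodule_fg _ _ k)
  exact Submodule.finiteDimensional_of_le inf_le_left

/-- Each component is finite-dimensional, so the orthogonal projection in `L²` exists and its value
is again a Schwartz function. -/
lemma exists_hermiteProj (j k : ℕ) (g : Sch m) :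
    ∃ u ∈ hermiteSpace m j k, ∀ v ∈ hermiteSpace m j k, ip v u = ip v g := by
  have : FiniteDimensional ℂ (hermiteSpace m j k) := by
    unfold hermiteSpace; infer_instance
  set W := (hermiteSpace m j k).map (toL2 m) with hW
  obtain ⟨u, hu, hu2⟩ : W.starProjection (toL2 m g) ∈ W := Submodule.starProjection_apply_mem _ _
  refine ⟨u, hu, fun v hv => ?_⟩
  have hv' : toL2 m v ∈ W := ⟨v, hv, rfl⟩
  rw [ip, ip, hu2, ← Submodule.inner_starProjection_left_eq_right,
    Submodule.starProjection_eq_self_iff.2 hv']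

/-- The orthogonal projection of `g` on the span of the Hermite functions attached to `j, k`. -/
def hermiteProj (j k : ℕ) (g : Sch m) : Sch m := (exists_hermiteProj j k g).choose

lemma hermiteProj_mem (j k : ℕ) (g : Sch m) : hermiteProj j k g ∈ hermiteSpace m j k :=
  (exists_hermiteProj j k g).choose_spec.1

lemma ip_hermiteProj (j k : ℕ) (g : Sch m) {v : Sch m} (hv : v ∈ hermiteSpace m j k) :
    ip v (hermiteProj j k g) = ip v g :=
  (exists_hermiteProj j k g).choose_spec.2 v hv

lemma hEig_pos (hm : 2 ≤ m) (j k : ℕ) : (j + 1) * (k + 1) ≤ hEig m j k ^ 2 ∧ 0 < hEig m j k := by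
  have h2 : (2 : ℝ) ≤ m := by exact_mod_cast hm
  have hj : (0 : ℝ) ≤ j := by positivity
  have hk : (0 : ℝ) ≤ k := by positivity
  have h1 : (j : ℝ) + 1 ≤ hEig m j k := by unfold hEig; linarith
  have h2 : (k : ℝ) + 1 ≤ hEig m j k := by unfold hEig; linarith
  have h0 : 0 ≤ hEig m j k := by linarith
  exact ⟨by rw [sq]; gcongr, by linarith⟩

lemma opH_pow_of_mem (hm : 2 ≤ m) {j k : ℕ} {u : Sch m} (hu : u ∈ hermiteSpace m j k) (N : ℕ) :
    (opH m ^ N) u = ((hEig m j k ^ N : ℝ) : ℂ) • u := by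
  induction N with
  | zero => simp
  | succ N ih =>
    rw [pow_succ', Module.End.mul_apply, ih, map_smul, opH_of_mem hm hu, smul_smul]
    push_cast
    rw [pow_succ]

lemma hNorm_of_mem (hm : 2 ≤ m) {j k : ℕ} {u : Sch m} (hu : u ∈ hermiteSpace m j k) (N : ℕ) :
    hNorm N u = hEig m j k ^ N * ‖toL2 m u‖ := by
  rw [hNorm, opH_pow_of_mem hm hu, map_smul, norm_smul, Complex.norm_real,
    Real.norm_of_nonneg (pow_nonneg (hEig_pos hm j k).2.le N)]

lemma hNorm_hermiteProj_le (hm : 2 ≤ m) (j k N : ℕ) (g : Sch m) :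
    hNorm N (hermiteProj j k g) ≤ hNorm N g := by
  set u := hermiteProj j k g with hu
  have hmem : u ∈ hermiteSpace m j k := hermiteProj_mem j k g
  rw [hNorm_of_mem hm hmem]
  rcases (norm_nonneg (toL2 m u)).eq_or_lt with h0 | h0
  · rw [← h0, mul_zero]; exact hNorm_nonneg _ _
  refine le_of_mul_le_mul_left ?_ h0
  have h1 : ((hEig m j k ^ N : ℝ) : ℂ) * ip u u = ip u ((opH m ^ N) g) := by
    rw [← isAdj_opH.pow N, opH_pow_of_mem hm hmem, ip_smul_left, Complex.conj_ofReal, hu,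
      ip_hermiteProj j k g hmem]
  have h2 := norm_ip_le u ((opH m ^ N) g)
  rw [← h1, ip_self, ← Complex.ofReal_mul, Complex.norm_real] at h2
  calc ‖toL2 m u‖ * (hEig m j k ^ N * ‖toL2 m u‖) = hEig m j k ^ N * ‖toL2 m u‖ ^ 2 := by ring
    _ ≤ _ := (le_abs_self _).trans h2

/-- Four extra powers of `h` contribute the fourth power of its eigenvalue, which dominates
`((j+1)(k+1))²`; the resulting weights are summable over both indices. -/
lemma hNorm_hermiteProj_le_div (hm : 2 ≤ m) (j k N : ℕ) (g : Sch m) :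
    hNorm N (hermiteProj j k g) ≤
      hNorm (N + 4) g * ((1 / ((j : ℝ) + 1) ^ 2) * (1 / ((k : ℝ) + 1) ^ 2)) := by
  have h1 := hNorm_hermiteProj_le hm j k (N + 4) g
  have hmem := hermiteProj_mem j k g
  obtain ⟨h2, h3⟩ := hEig_pos hm j k
  rw [hNorm_of_mem hm hmem] at h1 ⊢
  rw [div_mul_div_comm, one_mul, mul_one_div, le_div_iff₀ (by positivity)]
  refine le_trans ?_ h1
  calc hEig m j k ^ N * ‖toL2 m (hermiteProj j k g)‖ * (((j : ℝ) + 1) ^ 2 * ((k : ℝ) + 1) ^ 2)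
      = hEig m j k ^ N * ‖toL2 m (hermiteProj j k g)‖ * (((j : ℝ) + 1) * ((k : ℝ) + 1)) ^ 2 := by
        ring
    _ ≤ hEig m j k ^ N * ‖toL2 m (hermiteProj j k g)‖ * (hEig m j k ^ 2) ^ 2 := by gcongr
    _ = _ := by ring

lemma summable_weights : Summable fun p : ℕ × ℕ =>
    (1 / ((p.1 : ℝ) + 1) ^ 2) * (1 / ((p.2 : ℝ) + 1) ^ 2) := by
  have h : Summable fun n : ℕ => 1 / ((n : ℝ) + 1) ^ 2 := by
    have := (summable_nat_add_iff 1).2 (Real.summable_one_div_nat_pow.2 one_lt_two)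
    simpa using this
  exact h.mul_of_nonneg h (fun _ => by positivity) (fun _ => by positivity)

/-! ### Multipliers of the Hermite expansion -/

/-- The operator `A` multiplies the component of a function along the Hermite functions attached
to `j, k` by `s j k`. -/
def IsMult (A : Module.End ℂ (Sch m)) (s : ℕ → ℕ → ℂ) : Prop :=
  ∀ j k, ∀ v ∈ hermiteSpace m j k, ∀ g, ip v (A g) = s j k * ip v g

/-- The series of rescaled projections of `g` converges absolutely in every Schwartz seminorm, so it
can be differentiated termwise and paired termwise with `v`; orthogonality leaves one term. -/
lemma exists_mult_apply (hm : 2 ≤ m) {s : ℕ → ℕ → ℂ} (hs : ∀ j k, ‖s j k‖ ≤ 1) (g : Sch m) :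
    ∃ u : Sch m, ∀ j k, ∀ v ∈ hermiteSpace m j k, ip v u = s j k * ip v g := by
  set f : ℕ × ℕ → Sch m := fun p => s p.1 p.2 • hermiteProj p.1 p.2 g with hf
  have hbound : ∀ k n : ℕ, ∃ v : ℕ × ℕ → ℝ, Summable v ∧
      ∀ p (x : Eu m), ‖x‖ ^ k * ‖iteratedFDeriv ℝ n (f p) x‖ ≤ v p := by
    intro k n
    obtain ⟨N, C, hC, h⟩ := exists_seminorm_le hm k n
    refine ⟨fun p => C * (hNorm (N + 4) g * ((1 / ((p.1 : ℝ) + 1) ^ 2) *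
      (1 / ((p.2 : ℝ) + 1) ^ 2))), (summable_weights.mul_left _).mul_left _, fun p x => ?_⟩
    refine (h (f p) x).trans (mul_le_mul_of_nonneg_left ?_ hC)
    refine le_trans ?_ (hNorm_hermiteProj_le_div hm p.1 p.2 N g)
    rw [hf, hNorm_smul]
    exact mul_le_of_le_one_left (hNorm_nonneg _ _) (hs _ _)
  choose V hVs hV using hbound
  have hsm : ∀ p, ContDiff ℝ ((⊤ : ℕ∞) : WithTop ℕ∞) (f p) := fun p => (f p).smooth ⊤
  have hV0 : ∀ (n : ℕ) p (x : Eu m), (n : ℕ∞) ≤ ⊤ → ‖iteratedFDeriv ℝ n (f p) x‖ ≤ V 0 n p := by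
    intro n p x _
    simpa using hV 0 n p x
  have hiter : ∀ n : ℕ, (iteratedFDeriv ℝ n fun y => ∑' p, f p y) =
      fun x => ∑' p, iteratedFDeriv ℝ n (f p) x := fun n =>
    iteratedFDeriv_tsum (N := ⊤) hsm (fun n _ => hVs 0 n) hV0 le_top
  let u : Sch m :=
    { toFun := fun x => ∑' p, f p x
      smooth' := contDiff_tsum (N := ⊤) hsm (fun n _ => hVs 0 n) hV0
      decay' := by
        intro k n
        refine ⟨∑' p, V k n p, fun x => ?_⟩
        rw [hiter n]
        have hs1 : Summable fun p => ‖iteratedFDeriv ℝ n (f p) x‖ :=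
          Summable.of_nonneg_of_le (fun _ => norm_nonneg _) (fun p => hV0 n p x le_top) (hVs 0 n)
        calc ‖x‖ ^ k * ‖∑' p, iteratedFDeriv ℝ n (f p) x‖
            ≤ ‖x‖ ^ k * ∑' p, ‖iteratedFDeriv ℝ n (f p) x‖ := by
              gcongr; exact norm_tsum_le_tsum_norm hs1
          _ = ∑' p, ‖x‖ ^ k * ‖iteratedFDeriv ℝ n (f p) x‖ := tsum_mul_left.symm
          _ ≤ ∑' p, V k n p := (hs1.mul_left _).tsum_le_tsum (fun p => hV k n p x) (hVs k n) }
  have hfV : ∀ p x, ‖f p x‖ ≤ V 0 0 p := fun p x => by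
    simpa using hV0 0 p x le_top
  refine ⟨u, fun j k v hv => ?_⟩
  have hsum : HasSum (fun p => ip v (f p)) (ip v u) := by
    simp only [ip_eq_integral]
    refine hasSum_integral_of_dominated_convergence (fun p x => ‖v x‖ * V 0 0 p) ?_ ?_ ?_ ?_ ?_
    · intro p
      exact ((Complex.continuous_conj.comp v.continuous).mul (f p).continuous).aestronglyMeasurable
    · intro p
      refine Filter.Eventually.of_forall fun x => ?_
      rw [norm_mul, RCLike.norm_conj]
      gcongr
      exact hfV p x
    · exact Filter.Eventually.of_forall fun x => (hVs 0 0).mul_left _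
    · simp only [tsum_mul_left]
      exact v.integrable.norm.mul_const _
    · refine Filter.Eventually.of_forall fun x => ?_
      have : Summable fun p => f p x := Summable.of_norm_bounded (hVs 0 0) fun p => hfV p x
      exact this.hasSum.mul_left _
  refine hsum.unique ?_
  have h1 : s j k * ip v g = ip v (f (j, k)) := by
    simp only [hf, ip_smul_right, ip_hermiteProj j k g hv]
  rw [h1]
  refine hasSum_single (j, k) fun p hp => ?_
  simp only [hf, ip_smul_right]
  rw [ip_hermiteSpace_eq_zero hm (Ne.symm hp) hv (hermiteProj_mem p.1 p.2 g), mul_zero]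

/-- Bounded multipliers preserve the space of rapidly decreasing functions. -/
lemma exists_isMult (hm : 2 ≤ m) {s : ℕ → ℕ → ℂ} (hs : ∀ j k, ‖s j k‖ ≤ 1) :
    ∃ A : Module.End ℂ (Sch m), IsMult A s := by
  choose A hA using exists_mult_apply hm hs
  refine ⟨{ toFun := A, map_add' := fun f g => ?_, map_smul' := fun c g => ?_ },
    fun j k v hv g => hA g j k v hv⟩
  · refine eq_of_ip_hermiteSpace hm fun j k v hv => ?_
    rw [ip_add_right, hA _ j k v hv, hA _ j k v hv, hA _ j k v hv, ip_add_right]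
    ring
  · refine eq_of_ip_hermiteSpace hm fun j k v hv => ?_
    rw [RingHom.id_apply, ip_smul_right, hA _ j k v hv, hA _ j k v hv, ip_smul_right]
    ring

lemma IsMult.mul {A B : Module.End ℂ (Sch m)} {s t : ℕ → ℕ → ℂ} (hA : IsMult A s)
    (hB : IsMult B t) : IsMult (A * B) fun j k => s j k * t j k := by
  intro j k v hv g
  rw [Module.End.mul_apply, hA j k v hv, hB j k v hv, mul_assoc]

lemma IsMult.pow {A : Module.End ℂ (Sch m)} {s : ℕ → ℕ → ℂ} (hA : IsMult A s) (n : ℕ) :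
    IsMult (A ^ n) fun j k => s j k ^ n := by
  induction n with
  | zero => intro j k v hv g; simp
  | succ n ih => simp only [pow_succ]; exact ih.mul hA

lemma IsMult.unique (hm : 2 ≤ m) {A B : Module.End ℂ (Sch m)} {s : ℕ → ℕ → ℂ} (hA : IsMult A s)
    (hB : IsMult B s) : A = B :=
  LinearMap.ext fun g => eq_of_ip_hermiteSpace hm fun j k v hv => by
    rw [hA j k v hv, hB j k v hv]

lemma IsMult.apply_of_mem (hm : 2 ≤ m) {A : Module.End ℂ (Sch m)} {s : ℕ → ℕ → ℂ}
    (hA : IsMult A s) {j k : ℕ} {u : Sch m} (hu : u ∈ hermiteSpace m j k) :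
    A u = s j k • u := by
  refine eq_of_ip_hermiteSpace hm fun j' k' v hv => ?_
  rw [hA j' k' v hv, ip_smul_right]
  by_cases h : (j', k') = (j, k)
  · obtain ⟨rfl, rfl⟩ := Prod.mk.inj h; rfl
  · rw [ip_hermiteSpace_eq_zero hm h hv hu, mul_zero, mul_zero]

/-! ### Functions of symmetric operators as multipliers -/

lemma spectralSpace_isOrtho {D : Module.End ℂ (Sch m)} (hD : IsAdj D D) {a b : ℝ} (hab : a ≠ b) :
    spectralSpace D a ⟂ spectralSpace D b := by
  unfold spectralSpace
  rw [Submodule.isOrtho_iff_le, Submodule.orthogonal_closure]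
  refine Submodule.topologicalClosure_minimal _ ?_ (Submodule.isClosed_orthogonal _)
  rintro _ ⟨f, hf, rfl⟩
  rw [Submodule.mem_orthogonal]
  rintro _ ⟨g, hg, rfl⟩
  exact ip_eq_zero_of_eigenvalue_ne hD (Ne.symm hab) (Module.End.mem_eigenspace_iff.1 hg)
    (Module.End.mem_eigenspace_iff.1 hf)

lemma orthogonalFamily_spectralSpace {D : Module.End ℂ (Sch m)} (hD : IsAdj D D) :
    OrthogonalFamily ℂ (fun ν : ℝ => spectralSpace D ν)
      fun ν => (spectralSpace D ν).subtypeₗᵢ := by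
  intro a b hab x y
  exact Submodule.isOrtho_iff_inner_eq.1 (spectralSpace_isOrtho hD hab) _ x.2 _ y.2

/-- Bessel's inequality. It makes the family defining `opFun`, indexed by all real numbers,
summable, so that the `tsum` does not take its default value 0. -/
lemma sum_norm_starProjection_sq_le {D : Module.End ℂ (Sch m)} (hD : IsAdj D D) (u : L2 m)
    (s : Finset ℝ) :
    ∑ ν ∈ s, ‖(spectralSpace D ν).starProjection u‖ ^ 2 ≤ ‖u‖ ^ 2 := by
  set w := ∑ ν ∈ s, (spectralSpace D ν).starProjection u with hw
  have h1 : ‖w‖ ^ 2 = ∑ ν ∈ s, ‖(spectralSpace D ν).starProjection u‖ ^ 2 :=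
    (orthogonalFamily_spectralSpace hD).norm_sum
      (fun ν => (spectralSpace D ν).orthogonalProjectionOnto u) s
  have h2 : inner ℂ w u = ((‖w‖ ^ 2 : ℝ) : ℂ) := by
    rw [h1, hw, sum_inner]
    push_cast
    refine Finset.sum_congr rfl fun ν _ => ?_
    rw [← Submodule.starProjection_eq_self_iff.2
      (Submodule.starProjection_apply_mem (spectralSpace D ν) u),
      Submodule.inner_starProjection_left_eq_right, inner_self_eq_norm_sq_to_K,
      Submodule.starProjection_eq_self_iff.2
      (Submodule.starProjection_apply_mem (spectralSpace D ν) u)]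
    rfl
  have h3 := norm_inner_le_norm (𝕜 := ℂ) w u
  rw [h2, Complex.norm_real, Real.norm_of_nonneg (sq_nonneg _)] at h3
  rw [← h1]
  rcases (norm_nonneg w).eq_or_lt with h0 | h0
  · rw [← h0, zero_pow two_ne_zero]; exact sq_nonneg _
  · have : ‖w‖ ≤ ‖u‖ := by
      refine le_of_mul_le_mul_left ?_ h0
      rwa [← sq]
    gcongr

lemma summable_smul_starProjection {D : Module.End ℂ (Sch m)} (hD : IsAdj D D) {G : ℝ → ℂ}
    (hG : ∀ ν, ‖G ν‖ ≤ 1) (u : L2 m) :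
    Summable fun ν : ℝ => G ν • (spectralSpace D ν).starProjection u := by
  have h := (orthogonalFamily_spectralSpace hD).summable_iff_norm_sq_summable
    (fun ν => G ν • (spectralSpace D ν).orthogonalProjectionOnto u)
  refine h.2 ?_
  have h1 : Summable fun ν => ‖(spectralSpace D ν).starProjection u‖ ^ 2 :=
    summable_of_sum_le (fun _ => sq_nonneg _) (sum_norm_starProjection_sq_le hD u)
  refine Summable.of_nonneg_of_le (fun _ => sq_nonneg _) (fun ν => ?_) h1
  rw [norm_smul]
  have h2 : ‖(spectralSpace D ν).orthogonalProjectionOnto u‖ =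
    ‖(spectralSpace D ν).starProjection u‖ := rfl
  rw [h2]
  gcongr
  exact mul_le_of_le_one_left (norm_nonneg _) (hG ν)

lemma inner_opFun {D : Module.End ℂ (Sch m)} (hD : IsAdj D D) {G : ℝ → ℂ}
    (hG : ∀ ν, ‖G ν‖ ≤ 1) {v : Sch m} {a : ℝ} (hv : D v = (a : ℂ) • v) (u : L2 m) :
    inner ℂ (toL2 m v) (opFun D G u) = G a * inner ℂ (toL2 m v) u := by
  have hmem : toL2 m v ∈ spectralSpace D a :=
    Submodule.le_topologicalClosure _ ⟨v, Module.End.mem_eigenspace_iff.2 hv, rfl⟩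
  have h := (summable_smul_starProjection hD hG u).hasSum.mapL (innerSL ℂ (toL2 m v))
  refine h.unique ?_
  have h1 : ∀ ν : ℝ, innerSL ℂ (toL2 m v) (G ν • (spectralSpace D ν).starProjection u) =
      G ν * inner ℂ ((spectralSpace D ν).starProjection (toL2 m v)) u := by
    intro ν
    rw [map_smul, innerSL_apply_apply, Submodule.inner_starProjection_left_eq_right, smul_eq_mul]
  have h2 : G a * inner ℂ (toL2 m v) u =
      innerSL ℂ (toL2 m v) (G a • (spectralSpace D a).starProjection u) := by
    rw [h1, Submodule.starProjection_eq_self_iff.2 hmem]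
  rw [h2]
  refine hasSum_single a fun ν hν => ?_
  rw [h1]
  have h3 : (spectralSpace D ν).starProjection (toL2 m v) = 0 := by
    rw [Submodule.starProjection_apply_eq_zero_iff]
    exact (Submodule.isOrtho_iff_le.1 (spectralSpace_isOrtho hD (Ne.symm hν))) hmem
  rw [h3, inner_zero_left, mul_zero]

/-- Pairing with an eigenfunction isolates one term of the spectral sum; completeness of the Hermite
functions turns these scalar identities back into an identity in `L²`. -/
lemma isOpFun_iff_isMult (hm : 2 ≤ m) {A D : Module.End ℂ (Sch m)} (hD : IsAdj D D) {G : ℝ → ℂ}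
    (hG : ∀ ν, ‖G ν‖ ≤ 1) {e : ℕ → ℕ → ℝ}
    (he : ∀ j k, ∀ v ∈ hermiteSpace m j k, D v = (e j k : ℂ) • v) :
    IsOpFun A D G ↔ IsMult A fun j k => G (e j k) := by
  constructor
  · intro h j k v hv g
    rw [ip, toL2_apply (A g), h g, inner_opFun hD hG (he j k v hv)]
    rfl
  · intro h g
    rw [← sub_eq_zero]
    refine eq_zero_of_forall_hermiteFun hm _ fun j k H hH => ?_
    have hv : hermiteFun m j k H ∈ hermiteSpace m j k := mem_hermiteSpace.2 ⟨H, hH, rfl⟩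
    rw [inner_sub_right, inner_opFun hD hG (he j k _ hv), sub_eq_zero]
    exact h j k _ hv g

lemma norm_exp_I_mul (c x : ℝ) : ‖Complex.exp (Complex.I * c * x)‖ ≤ 1 := by
  rw [mul_assoc, ← Complex.ofReal_mul, mul_comm, Complex.norm_exp_ofReal_mul_I]

/-- The multiplier of `exp(i π/2 F(√Ω)) exp(i π/2 (h - m/2))`. -/
def phaseMult (m : ℕ) (F : ℝ → ℝ) (j k : ℕ) : ℂ :=
  Complex.exp (Complex.I * (Real.pi / 2 : ℝ) * (F (lagParam m k) : ℝ)) *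
    Complex.exp (Complex.I * (Real.pi / 2 : ℝ) * ((2 * j + k : ℝ) : ℝ))

lemma isExpProduct_iff (hm : 2 ≤ m) (F : ℝ → ℝ) (T : Module.End ℂ (Sch m)) :
    IsExpProduct F T ↔ IsMult T (phaseMult m F) := by
  have hG₁ : ∀ ν : ℝ,
      ‖Complex.exp (Complex.I * (Real.pi / 2 : ℝ) * (F (Real.sqrt ν) : ℝ))‖ ≤ 1 :=
    fun ν => norm_exp_I_mul _ _
  have hG₂ : ∀ ν : ℝ,
      ‖Complex.exp (Complex.I * (Real.pi / 2 : ℝ) * (ν - (m : ℝ) / 2 : ℝ))‖ ≤ 1 :=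
    fun ν => norm_exp_I_mul _ _
  have key : ∀ A B, IsOpFun A (casimir m)
      (fun ν => Complex.exp (Complex.I * (Real.pi / 2 : ℝ) * (F (Real.sqrt ν) : ℝ))) →
      IsOpFun B (opH m)
      (fun ν => Complex.exp (Complex.I * (Real.pi / 2 : ℝ) * (ν - (m : ℝ) / 2 : ℝ))) →
      IsMult (A * B) (phaseMult m F) := by
    intro A B hA hB
    have h1 := (isOpFun_iff_isMult hm isAdj_casimir hG₁ (e := fun _ k => lagParam m k ^ 2)
      fun j k v hv => casimir_of_mem hm hv).1 hA
    have h2 := (isOpFun_iff_isMult hm isAdj_opH hG₂ fun j k v hv => opH_of_mem hm hv).1 hB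
    convert h1.mul h2 using 3 with j k
    rw [Real.sqrt_sq (lagParam_nonneg hm k), phaseMult, hEig, add_sub_cancel_right]
  constructor
  · rintro ⟨A, B, hA, hB, rfl⟩
    exact key A B hA hB
  · intro hT
    obtain ⟨A, hA⟩ := exists_isMult (m := m) hm (s := fun _ k =>
      Complex.exp (Complex.I * (Real.pi / 2 : ℝ) * (F (Real.sqrt (lagParam m k ^ 2)) : ℝ)))
      fun _ _ => norm_exp_I_mul _ _
    obtain ⟨B, hB⟩ := exists_isMult (m := m) hm (s := fun j k =>
      Complex.exp (Complex.I * (Real.pi / 2 : ℝ) * (hEig m j k - (m : ℝ) / 2 : ℝ)))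
      fun _ _ => norm_exp_I_mul _ _
    have hA' := (isOpFun_iff_isMult hm isAdj_casimir hG₁ (e := fun _ k => lagParam m k ^ 2)
      fun j k v hv => casimir_of_mem hm hv).2 hA
    have hB' := (isOpFun_iff_isMult hm isAdj_opH hG₂ fun j k v hv => opH_of_mem hm hv).2 hB
    exact ⟨A, B, hA', hB', hT.unique hm (key A B hA' hB')⟩

/-! ### A nonzero spherical harmonic in each degree -/

/-- The witness is `(x₀ + i x₁)^k`: its linear form has isotropic coefficient vector, so `Δ` kills
all its powers. Two variables are needed here. -/
lemma exists_sphericalHarmonic (hm : 2 ≤ m) (k : ℕ) :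
    ∃ H ∈ sphericalHarmonics m k, polyVal H (EuclideanSpace.single ⟨0, by omega⟩ 1) = 1 := by
  set i₀ : Fin m := ⟨0, by omega⟩ with hi₀
  set i₁ : Fin m := ⟨1, by omega⟩ with hi₁
  have hne : i₀ ≠ i₁ := by simp [hi₀, hi₁]
  set z : MvPolynomial (Fin m) ℂ := MvPolynomial.X i₀ + Complex.I • MvPolynomial.X i₁ with hz
  set c : Fin m → ℂ := fun i => (if i₀ = i then 1 else 0) + (if i₁ = i then Complex.I else 0)
    with hc
  have hz1 : ∀ i, MvPolynomial.pderiv i z = MvPolynomial.C (c i) := by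
    intro i
    have hp : ∀ j, MvPolynomial.pderiv i (MvPolynomial.X j : MvPolynomial (Fin m) ℂ) =
        if j = i then 1 else 0 := fun j => by
      rw [MvPolynomial.pderiv_X, Pi.single_apply]
    rw [hz, map_add, Derivation.map_smul, hp, hp, MvPolynomial.smul_eq_C_mul]
    simp only [hc]
    split_ifs <;> simp
  have hc2 : ∑ i, c i * c i = 0 := by
    have h1 : ∀ i, c i * c i = (if i₀ = i then 1 else 0) + (if i₁ = i then -1 else 0) := by
      intro i
      simp only [hc]
      by_cases h0 : i₀ = i
      · have h1 : i₁ ≠ i := fun h1 => hne (h0.trans h1.symm)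
        simp [h0, h1]
      · by_cases h1 : i₁ = i
        · simp [h0, h1]
        · simp [h0, h1]
    simp [h1, Finset.sum_add_distrib]
  have hder : ∀ (n : ℕ) i, MvPolynomial.pderiv i (z ^ n) =
      MvPolynomial.C (n * c i) * z ^ (n - 1) := by
    intro n i
    rw [Derivation.leibniz_pow, hz1, smul_eq_mul, nsmul_eq_mul]
    simp only [map_mul, map_natCast]
    ring
  refine ⟨z ^ k, mem_sphericalHarmonics.2 ⟨?_, ?_⟩, ?_⟩
  · have : z.IsHomogeneous 1 := by
      rw [hz, MvPolynomial.smul_eq_C_mul]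
      have h2 := (MvPolynomial.isHomogeneous_C (Fin m) Complex.I).mul
        (MvPolynomial.isHomogeneous_X ℂ i₁)
      rw [zero_add] at h2
      exact (MvPolynomial.isHomogeneous_X ℂ i₀).add h2
    simpa using this.pow k
  · rw [polyLap_apply]
    have h : ∀ i, MvPolynomial.pderiv i (MvPolynomial.pderiv i (z ^ k)) =
        MvPolynomial.C (c i * c i) *
          (MvPolynomial.C ((k : ℂ) * ((k - 1 : ℕ) : ℂ)) * z ^ (k - 1 - 1)) := by
      intro i
      rw [hder, MvPolynomial.pderiv_C_mul, hder, ← mul_assoc, ← mul_assoc, ← MvPolynomial.C_mul,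
        ← MvPolynomial.C_mul]
      congr 2
      ring
    simp only [h, ← Finset.sum_mul, ← map_sum, hc2, map_zero, zero_mul]
  · simp [polyVal, hz, Ne.symm hne]

lemma exists_hermiteFun_ne_zero (hm : 2 ≤ m) (k : ℕ) :
    ∃ H ∈ sphericalHarmonics m k, ∀ j, hermiteFun m j k H ≠ 0 := by
  obtain ⟨H, hH, h1⟩ := exists_sphericalHarmonic hm k
  refine ⟨H, hH, fun j => ?_⟩
  induction j with
  | zero =>
    intro h
    have h2 := congrArg (fun g : Sch m => g (EuclideanSpace.single ⟨0, by omega⟩ 1)) h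
    simp only [hermiteFun_zero hm] at h2
    rw [gaussMul_apply, h1, one_mul] at h2
    exact (Complex.ofReal_ne_zero.2 (Real.exp_pos _).ne') h2
  | succ j ih =>
    intro h
    have h2 := opF_hermiteFun_succ hm hH j
    rw [h, map_zero] at h2
    have hα := lagParam_nonneg hm k
    rcases smul_eq_zero.1 h2.symm with h3 | h3
    · rw [Complex.ofReal_eq_zero, neg_eq_zero] at h3
      have : 0 < 2 * ((j : ℝ) + 1) * (j + 1 + lagParam m k) := by positivity
      exact this.ne' h3
    · exact ih h3

/-! ### From multipliers to the algebraic properties -/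

/-- Passing to the adjoint `Y` means that only its action on Hermite functions matters, and no
expansion of a general `g` is required. -/
lemma IsMult.intertwine (hm : 2 ≤ m) {T X Y : Module.End ℂ (Sch m)} {s : ℕ → ℕ → ℂ}
    (hT : IsMult T s) (hX : IsAdj Y X) {c : ℂ} (hY : ∀ j k, ∀ v ∈ hermiteSpace m j k,
      ∃ j', Y v ∈ hermiteSpace m j' k ∧ s j k = c * s j' k) : T * X = c • (X * T) := by
  refine LinearMap.ext fun g => eq_of_ip_hermiteSpace hm fun j k v hv => ?_
  obtain ⟨j', hj', hs⟩ := hY j k v hv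
  rw [Module.End.mul_apply, hT j k v hv, LinearMap.smul_apply, ip_smul_right, Module.End.mul_apply,
    ← hX, ← hX, hT j' k _ hj', hs, mul_assoc]

lemma opE_mem (hm : 2 ≤ m) {j k : ℕ} {v : Sch m} (hv : v ∈ hermiteSpace m j k) :
    opE m v ∈ hermiteSpace m (j + 1) k := by
  obtain ⟨H, hH, rfl⟩ := mem_hermiteSpace.1 hv
  rw [opE_hermiteFun hm hH]
  exact Submodule.smul_mem _ _ (mem_hermiteSpace.2 ⟨H, hH, rfl⟩)

lemma opF_mem_succ (hm : 2 ≤ m) {j k : ℕ} {v : Sch m} (hv : v ∈ hermiteSpace m (j + 1) k) :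
    opF m v ∈ hermiteSpace m j k := by
  obtain ⟨H, hH, rfl⟩ := mem_hermiteSpace.1 hv
  rw [opF_hermiteFun_succ hm hH]
  exact Submodule.smul_mem _ _ (mem_hermiteSpace.2 ⟨H, hH, rfl⟩)

lemma opF_eq_zero_of_mem {k : ℕ} {v : Sch m} (hv : v ∈ hermiteSpace m 0 k) :
    opF m v = 0 := by
  obtain ⟨H, hH, rfl⟩ := mem_hermiteSpace.1 hv
  exact opF_hermiteFun_zero hH

lemma IsMult.isPeriodicTransform (hm : 2 ≤ m) {ι : ℕ → Type*}
    (b : ∀ k, Module.Basis (ι k) ℂ (sphericalHarmonics m k)) {T : Module.End ℂ (Sch m)}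
    {ρ : ℕ → ℂ} (hT : IsMult T fun j k => (-1) ^ j * ρ k) (hρ : ∀ k, ρ (k + 4) = ρ k)
    (hρ4 : ∀ k, ρ k ^ 4 = 1) : IsPeriodicTransform b T := by
  have hh : T * opH m = opH m * T := by
    have := hT.intertwine hm isAdj_opH (c := 1) fun j k v hv => ⟨j, by
      rw [opH_of_mem hm hv]; exact Submodule.smul_mem _ _ hv, by simp⟩
    rwa [one_smul] at this
  have ha : IsAdj (-opE m) (opF m) := by
    have := (isAdj_opE (m := m)).neg
    rwa [neg_neg] at this
  have hf : T * opF m = -(opF m * T) := by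
    have := hT.intertwine hm ha (c := -1) fun j k v hv => ⟨j + 1,
      Submodule.neg_mem _ (opE_mem hm hv), by rw [pow_succ]; ring⟩
    rwa [neg_one_smul] at this
  have ha' : IsAdj (-opF m) (opE m) := by
    have := (isAdj_opF (m := m)).neg
    rwa [neg_neg] at this
  have he : T * opE m = -(opE m * T) := by
    have := hT.intertwine hm ha' (c := -1) fun j k v hv => by
      cases j with
      | zero =>
        -- The vector `f v` is zero and lies in every component; the index 1 is chosen to make the
        -- sign condition hold.
        refine ⟨1, ?_, by ring⟩
        rw [LinearMap.neg_apply, opF_eq_zero_of_mem hv, neg_zero]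
        exact Submodule.zero_mem _
      | succ j => exact ⟨j, Submodule.neg_mem _ (opF_mem_succ hm hv), by rw [pow_succ]; ring⟩
    rwa [neg_one_smul] at this
  refine ⟨?_, ?_, ⟨fun j k => (-1) ^ j * ρ k, ?_, ?_⟩, ?_⟩
  · rw [lap_eq, normSq_eq, mul_sub, mul_sub, hh, hf, he, sub_mul, add_mul]
    abel
  · rw [lap_eq, normSq_eq, mul_sub, mul_add, hh, hf, he, sub_mul, sub_mul]
    abel
  · intro j k l
    exact hT.apply_of_mem hm (mem_hermiteSpace.2 ⟨_, (b k l).2, rfl⟩)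
  · intro j k
    simp only [hρ]
  · refine IsMult.unique hm (hT.pow 4) fun j k v hv g => ?_
    rw [Module.End.one_apply, mul_pow, hρ4, ← pow_mul, mul_comm j 4, pow_mul]
    norm_num

/-! ### From the algebraic properties to multipliers -/

lemma helmholtz_opH {T : Module.End ℂ (Sch m)} (h₁ : T * lap m = -(normSq m * T))
    (h₂ : T * normSq m = -(lap m * T)) : T * opH m = opH m * T := by
  simp only [opH, mul_add, add_mul, mul_neg, neg_mul, mul_smul_comm, smul_mul_assoc, h₁, h₂]
  module

/-- The sum `Δ + |x|² = 2(f - e)` anticommutes with `T` directly. The other combination `f + e =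
-½[h, f - e]` does so because `T` commutes with `h`. -/
lemma helmholtz_opF_opE {T : Module.End ℂ (Sch m)} (h₁ : T * lap m = -(normSq m * T))
    (h₂ : T * normSq m = -(lap m * T)) :
    T * opF m = -(opF m * T) ∧ T * opE m = -(opE m * T) := by
  have hh := helmholtz_opH h₁ h₂
  set d := opF m - opE m with hd
  have hd1 : T * d = -(d * T) := by
    have : d = (1 / 2 : ℂ) • (lap m + normSq m) := by
      rw [hd, lap_eq, normSq_eq]; module
    rw [this]
    simp only [mul_add, add_mul, mul_smul_comm, smul_mul_assoc, h₁, h₂]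
    module
  have hs : opF m + opE m = -((1 / 2 : ℂ) • (opH m * d - d * opH m)) := by
    rw [hd, mul_sub, sub_mul, opH_mul_opF, opH_mul_opE]; module
  have hs1 : T * (opF m + opE m) = -((opF m + opE m) * T) := by
    have h3 : T * (opH m * d) = -(opH m * d * T) := by
      rw [← mul_assoc, hh, mul_assoc, hd1, mul_neg, mul_assoc]
    have h4 : T * (d * opH m) = -(d * opH m * T) := by
      rw [← mul_assoc, hd1, neg_mul, mul_assoc, hh, mul_assoc]
    rw [hs]
    simp only [mul_neg, neg_mul, mul_smul_comm, smul_mul_assoc, mul_sub, sub_mul, h3, h4]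
    module
  have hF : opF m = (1 / 2 : ℂ) • (opF m + opE m + d) := by rw [hd]; module
  have hE : opE m = (1 / 2 : ℂ) • (opF m + opE m - d) := by rw [hd]; module
  constructor
  · rw [hF]
    simp only [mul_smul_comm, smul_mul_assoc, mul_add _ _ d, add_mul _ d, hs1, hd1]
    module
  · rw [hE]
    simp only [mul_smul_comm, smul_mul_assoc, mul_sub _ _ d, sub_mul _ d, hs1, hd1]
    module

lemma helmholtz_casimir {T : Module.End ℂ (Sch m)} (h₁ : T * lap m = -(normSq m * T))
    (h₂ : T * normSq m = -(lap m * T)) : Commute T (casimir m) := by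
  have hh : Commute T (opH m) := helmholtz_opH h₁ h₂
  obtain ⟨hf, he⟩ := helmholtz_opF_opE h₁ h₂
  have h3 : Commute T (opE m * opF m) := by
    rw [Commute, SemiconjBy, ← mul_assoc, he, neg_mul, mul_assoc, hf, mul_neg, neg_neg, mul_assoc]
  have h4 : Commute T (opF m * opE m) := by
    rw [Commute, SemiconjBy, ← mul_assoc, hf, neg_mul, mul_assoc, he, mul_neg, neg_neg, mul_assoc]
  exact (((Commute.one_right T).add_right (hh.pow_right 2)).add_right (h3.smul_right _)).add_right
    (h4.smul_right _)

/-- The differences of the eigenvalues of `h` and of `Ω` are integers, even for odd `m`, and they do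
not vanish simultaneously. A uniform gap follows. -/
lemma one_le_eigenvalue_gap (hm : 2 ≤ m) {j k j' k' : ℕ} (h : (j', k') ≠ (j, k)) :
    1 ≤ (hEig m j' k' - hEig m j k) ^ 2 + (lagParam m k' ^ 2 - lagParam m k ^ 2) ^ 2 := by
  have h1 : (hEig m j' k' - hEig m j k) ^ 2 + (lagParam m k' ^ 2 - lagParam m k ^ 2) ^ 2 =
      (((2 * (j' - j) + (k' - k)) ^ 2 + ((k' - k) * (k' + k + m - 2)) ^ 2 : ℤ) : ℝ) := by
    unfold hEig lagParam; push_cast; ring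
  rw [h1]
  have h2 : (0 : ℤ) < (2 * ((j' : ℤ) - j) + (k' - k)) ^ 2 + ((k' - k) * (k' + k + m - 2)) ^ 2 := by
    by_cases hk : k' = k
    · subst hk
      have hj : (j' : ℤ) - j ≠ 0 := fun hj => h (by rw [show j' = j by omega])
      have : (2 * ((j' : ℤ) - j) + (k' - k')) ≠ 0 := by omega
      positivity
    · have h3 : (k' : ℤ) - k ≠ 0 := by omega
      have h4 : (k' : ℤ) + k + m - 2 ≠ 0 := by omega
      have h5 := mul_ne_zero h3 h4
      positivity
  exact_mod_cast h2

/-- The operator `(h - a)² + (Ω - b)²`. -/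
def gapOp (m : ℕ) (a b : ℝ) : Module.End ℂ (Sch m) :=
  (opH m - (a : ℂ) • 1) ^ 2 + (casimir m - (b : ℂ) • 1) ^ 2

lemma isAdj_gapOp (a b : ℝ) : IsAdj (gapOp m a b) (gapOp m a b) := by
  rw [gapOp, sub_eq_add_neg, sub_eq_add_neg]
  exact ((isAdj_opH.add (isAdj_one.smul a).neg).pow 2).add
    ((isAdj_casimir.add (isAdj_one.smul b).neg).pow 2)

lemma commute_gapOp {T : Module.End ℂ (Sch m)} (hh : Commute T (opH m))
    (hΩ : Commute T (casimir m)) (a b : ℝ) : Commute T (gapOp m a b) :=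
  ((hh.sub_right ((Commute.one_right T).smul_right _)).pow_right 2).add_right
    ((hΩ.sub_right ((Commute.one_right T).smul_right _)).pow_right 2)

lemma gapOp_of_mem (hm : 2 ≤ m) (a b : ℝ) {j k : ℕ} {v : Sch m} (hv : v ∈ hermiteSpace m j k) :
    gapOp m a b v = (((hEig m j k - a) ^ 2 + (lagParam m k ^ 2 - b) ^ 2 : ℝ) : ℂ) • v := by
  have h1 : (opH m - (a : ℂ) • 1) v = ((hEig m j k : ℂ) - a) • v := by
    rw [LinearMap.sub_apply, opH_of_mem hm hv, LinearMap.smul_apply, Module.End.one_apply, sub_smul]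
  have h2 : (casimir m - (b : ℂ) • 1) v = (((lagParam m k ^ 2 : ℝ) : ℂ) - b) • v := by
    rw [LinearMap.sub_apply, casimir_of_mem hm hv, LinearMap.smul_apply, Module.End.one_apply,
      sub_smul]
  rw [gapOp, LinearMap.add_apply, pow_two, pow_two, Module.End.mul_apply, Module.End.mul_apply, h1,
    h2, map_smul, map_smul, h1, h2, smul_smul, smul_smul, ← add_smul]
  congr 1
  push_cast
  ring

/-- An operator which commutes with `h` and `Ω` and is diagonal on the Hermite functions is a
multiplier, even when it is not known to be continuous. -/
lemma isMult_of_commute (hm : 2 ≤ m) {T : Module.End ℂ (Sch m)} {μ : ℕ → ℕ → ℂ}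
    (hh : Commute T (opH m)) (hΩ : Commute T (casimir m))
    (hμ : ∀ j k, ∀ v ∈ hermiteSpace m j k, T v = μ j k • v) : IsMult T μ := by
  intro j k v hv g
  obtain ⟨K, hK⟩ : ∃ K, K = gapOp m (hEig m j k) (lagParam m k ^ 2) := ⟨_, rfl⟩
  have hKT : Commute T K := hK ▸ commute_gapOp hh hΩ _ _
  have hKadj : IsAdj K K := hK ▸ isAdj_gapOp _ _
  obtain ⟨κ, hκ⟩ : ∃ κ : ℕ → ℕ → ℝ, κ = fun j' k' =>
    (hEig m j' k' - hEig m j k) ^ 2 + (lagParam m k' ^ 2 - lagParam m k ^ 2) ^ 2 := ⟨_, rfl⟩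
  have hκ1 : ∀ j' k', (j', k') ≠ (j, k) → 1 ≤ κ j' k' := fun j' k' h => by
    rw [hκ]; exact one_le_eigenvalue_gap hm h
  have hκ0 : κ j k = 0 := by simp [hκ]
  have hKv : ∀ j' k', ∀ v' ∈ hermiteSpace m j' k', K v' = (κ j' k' : ℂ) • v' :=
    fun j' k' v' hv' => by rw [hK, hκ]; exact gapOp_of_mem hm _ _ hv'
  have hbound : ∀ j' k',
      ‖if (j', k') = (j, k) then (0 : ℂ) else (κ j' k' : ℂ)⁻¹‖ ≤ 1 := by
    intro j' k'
    split_ifs with h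
    · simp
    · have h1 := hκ1 j' k' h
      rw [norm_inv, Complex.norm_real, Real.norm_of_nonneg (zero_le_one.trans h1)]
      exact inv_le_one_of_one_le₀ h1
  obtain ⟨M, hM⟩ := exists_isMult (m := m) hm hbound
  -- `K` vanishes on the `(j,k)` component and `M` inverts it on all others. As `T` commutes with
  -- `K` and `K v = 0`, the second summand contributes nothing to the pairing of `v` with `T g`.
  have hdecomp : g = hermiteProj j k g + K (M g) := by
    refine eq_of_ip_hermiteSpace hm fun j' k' v' hv' => ?_
    have hM' : ip v' (M g) =
        (if (j', k') = (j, k) then (0 : ℂ) else (κ j' k' : ℂ)⁻¹) * ip v' g := hM j' k' v' hv' g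
    rw [ip_add_right, ← hKadj, hKv j' k' v' hv', ip_smul_left, Complex.conj_ofReal, hM']
    by_cases h : (j', k') = (j, k)
    · obtain ⟨rfl, rfl⟩ := Prod.mk.inj h
      rw [ip_hermiteProj _ _ _ hv', hκ0, Complex.ofReal_zero, zero_mul, add_zero]
    · rw [if_neg h, ip_hermiteSpace_eq_zero hm h hv' (hermiteProj_mem j k g), zero_add, ← mul_assoc,
        mul_inv_cancel₀ (Complex.ofReal_ne_zero.2 (zero_lt_one.trans_le (hκ1 j' k' h)).ne'),
        one_mul]
  have hKv0 : K v = 0 := by rw [hKv j k v hv, hκ0, Complex.ofReal_zero, zero_smul]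
  have hTK : T (K (M g)) = K (T (M g)) := LinearMap.congr_fun hKT.eq (M g)
  have hTg : T g = μ j k • hermiteProj j k g + K (T (M g)) := by
    conv_lhs => rw [hdecomp]
    rw [map_add, hμ j k _ (hermiteProj_mem j k g), hTK]
  rw [hTg, ip_add_right, ← hKadj, hKv0, ip_zero_left, add_zero, ip_smul_right,
    ip_hermiteProj j k g hv]

lemma IsPeriodicTransform.exists_isMult (hm : 2 ≤ m) {ι : ℕ → Type*}
    {b : ∀ k, Module.Basis (ι k) ℂ (sphericalHarmonics m k)} {T : Module.End ℂ (Sch m)}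
    (hT : IsPeriodicTransform b T) :
    ∃ ρ : ℕ → ℂ, (∀ k, ρ (k + 4) = ρ k) ∧ (∀ k, ρ k ^ 4 = 1) ∧
      IsMult T fun j k => (-1) ^ j * ρ k := by
  obtain ⟨h₁, h₂, ⟨μ, hμ, hper⟩, h4⟩ := hT
  obtain ⟨hf, -⟩ := helmholtz_opF_opE h₁ h₂
  have hμ' : ∀ j k, ∀ v ∈ hermiteSpace m j k, T v = μ j k • v := by
    intro j k v hv
    obtain ⟨H, hH, rfl⟩ := mem_hermiteSpace.1 hv
    have : T ∘ₗ hermiteLM m j k = μ j k • hermiteLM m j k := (b k).ext fun l => hμ j k l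
    exact LinearMap.congr_fun this ⟨H, hH⟩
  have hmult := isMult_of_commute hm (helmholtz_opH h₁ h₂) (helmholtz_casimir h₁ h₂) hμ'
  have hstep : ∀ j k, μ (j + 1) k = -μ j k := by
    intro j k
    obtain ⟨H, hH, hne⟩ := exists_hermiteFun_ne_zero hm k
    have hα := lagParam_nonneg hm k
    have hmem : ∀ j, hermiteFun m j k H ∈ hermiteSpace m j k := fun j =>
      mem_hermiteSpace.2 ⟨H, hH, rfl⟩
    have h5 := LinearMap.congr_fun hf (hermiteFun m (j + 1) k H)
    rw [LinearMap.neg_apply, Module.End.mul_apply, Module.End.mul_apply, hμ' _ _ _ (hmem _),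
      map_smul, opF_hermiteFun_succ hm hH, map_smul, hμ' _ _ _ (hmem _), smul_smul, smul_smul,
      ← neg_smul, ← sub_eq_zero, ← sub_smul] at h5
    have h6 := (smul_eq_zero.1 h5).resolve_right (hne j)
    have h7 : ((-(2 * ((j : ℝ) + 1) * (j + 1 + lagParam m k)) : ℝ) : ℂ) ≠ 0 := by
      rw [Complex.ofReal_ne_zero, neg_ne_zero]
      positivity
    refine mul_left_cancel₀ h7 ?_
    linear_combination h6
  have hpow : ∀ j k, μ j k = (-1) ^ j * μ 0 k := by
    intro j k
    induction j with
    | zero => simp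
    | succ j ih => rw [hstep, ih, pow_succ]; ring
  refine ⟨μ 0, fun k => hper 0 k, fun k => ?_, ?_⟩
  · obtain ⟨H, hH, hne⟩ := exists_hermiteFun_ne_zero hm k
    have hmem : hermiteFun m 0 k H ∈ hermiteSpace m 0 k := mem_hermiteSpace.2 ⟨H, hH, rfl⟩
    have h5 := (hmult.pow 4).apply_of_mem hm hmem
    rw [h4, Module.End.one_apply] at h5
    have h6 : (μ 0 k ^ 4 - 1) • hermiteFun m 0 k H = 0 := by
      rw [sub_smul, one_smul, ← h5, sub_self]
    exact sub_eq_zero.1 ((smul_eq_zero.1 h6).resolve_right (hne 0))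
  · simpa only [← hpow] using hmult

/-! ### Generating functions modulo 4 -/

section Periodic

variable {R : Type*} [CommRing R]

/-- The sum `∑_{1 ≤ n ≤ M} (f(2^n) + ∑_{1 ≤ j < n} 2 f(2^n + 2^j))`. -/
def dyadicComb {S : Type*} [Semiring S] (M : ℕ) (f : ℕ → S) : S :=
  ∑ n ∈ Finset.range (M + 1), if 1 ≤ n then
    f (2 ^ n) + ∑ j ∈ Finset.Ico 1 n, 2 * f (2 ^ n + 2 ^ j) else 0

lemma map_dyadicComb {S S' : Type*} [Semiring S] [Semiring S'] (g : S →+ S') (M : ℕ) (f : ℕ → S) :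
    g (dyadicComb M f) = dyadicComb M fun n => g (f n) := by
  rw [dyadicComb, dyadicComb, map_sum]
  refine Finset.sum_congr rfl fun n _ => ?_
  split_ifs with h
  · rw [map_add, map_sum]
    congr 1
    refine Finset.sum_congr rfl fun j _ => ?_
    rw [two_mul, two_mul, map_add]
  · exact map_zero g

lemma mul_dyadicComb (c : R) (M : ℕ) (f : ℕ → R) :
    c * dyadicComb M f = dyadicComb M fun n => c * f n :=
  map_dyadicComb (AddMonoidHom.mulLeft c) M f

/-- The sum `∑_{1 ≤ n ≤ M} (u^{2^n} + ∑_{1 ≤ j < n} 2 u^{2^n + 2^j})`. -/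
def dyadicSum (M : ℕ) (u : R) : R := dyadicComb M fun n => u ^ n

lemma dyadicSum_succ (M : ℕ) (u : R) : dyadicSum (M + 1) u = dyadicSum M u +
    (u ^ (2 ^ (M + 1)) + 2 * u ^ (2 ^ (M + 1)) * ∑ j ∈ Finset.range M, (u ^ 2) ^ (2 ^ j)) := by
  rw [dyadicSum, dyadicComb, Finset.sum_range_succ, ← dyadicComb, ← dyadicSum, if_pos (by omega),
    Finset.sum_Ico_eq_sum_range, Finset.mul_sum, Nat.add_sub_cancel]
  congr 2
  refine Finset.sum_congr rfl fun j _ => ?_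
  rw [pow_add, ← pow_mul, ← pow_succ', mul_assoc, add_comm 1 j]

/-- In the square of `∑ (u²)^{2^j}` the cross terms are the doubled terms of the dyadic sum. The
diagonal is `u⁴, …, u^{2^{M+1}}` instead of `u², …, u^{2^M}`, which the two end terms correct. -/
lemma dyadicSum_eq (M : ℕ) (u : R) : dyadicSum M u =
    (∑ j ∈ Finset.range M, (u ^ 2) ^ (2 ^ j)) ^ 2 + u ^ 2 - (u ^ 2) ^ (2 ^ M) := by
  induction M with
  | zero => simp [dyadicSum, dyadicComb]
  | succ M ih =>
    rw [dyadicSum_succ, ih, Finset.sum_range_succ]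
    have h1 : u ^ (2 ^ (M + 1)) = (u ^ 2) ^ (2 ^ M) := by rw [← pow_mul, pow_succ']
    have h2 : (u ^ 2) ^ (2 ^ (M + 1)) = (u ^ 2) ^ (2 ^ M) * (u ^ 2) ^ (2 ^ M) := by
      rw [← pow_add, ← mul_two, ← pow_succ]
    rw [h1, h2]
    ring

lemma exists_pow_two_pow_sub (B : R) (M : ℕ) :
    ∃ Q, (B - B ^ 2) ^ (2 ^ M) = B ^ (2 ^ M) - B ^ (2 ^ (M + 1)) + 2 * Q := by
  induction M with
  | zero => exact ⟨0, by simp⟩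
  | succ M ih =>
    obtain ⟨Q, hQ⟩ := ih
    have h2 : ∀ x : R, ∀ n, x ^ (2 ^ (n + 1)) = (x ^ (2 ^ n)) ^ 2 := fun x n => by
      rw [← pow_mul, pow_succ]
    rw [h2, hQ, h2 B (M + 1), h2 B M]
    set a := B ^ (2 ^ M)
    exact ⟨a ^ 4 - a * a ^ 2 + 2 * Q * (a - a ^ 2) + 2 * Q ^ 2, by ring⟩

/-- Modulo 2, Frobenius makes the sum telescope. -/
lemma exists_sum_pow_two_pow (B : R) (M : ℕ) :
    ∃ Q, ∑ j ∈ Finset.range M, (B - B ^ 2) ^ (2 ^ j) = B - B ^ (2 ^ M) + 2 * Q := by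
  induction M with
  | zero => exact ⟨0, by simp⟩
  | succ M ih =>
    obtain ⟨Q, hQ⟩ := ih
    obtain ⟨Q', hQ'⟩ := exists_pow_two_pow_sub B M
    exact ⟨Q + Q', by rw [Finset.sum_range_succ, hQ, hQ']; ring⟩

/-- A congruence modulo 2 becomes one modulo 4 after squaring, so the telescoped sum may be used
inside `dyadicSum_eq`. The error is divisible by a high power of `B`. -/
lemma exists_dyadicSum_eq (h4 : (4 : R) = 0) {u B : R} (hu : u ^ 2 = B - B ^ 2) (M : ℕ) :
    ∃ Z, dyadicSum M u = B + B ^ (2 ^ M) * Z := by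
  obtain ⟨Q, hQ⟩ := exists_sum_pow_two_pow B M
  have h1 : (B - B ^ 2) ^ (2 ^ M) = B ^ (2 ^ M) * (1 - B) ^ (2 ^ M) := by
    rw [← mul_pow]; congr 1; ring
  refine ⟨-2 * B + B ^ (2 ^ M) - (1 - B) ^ (2 ^ M), ?_⟩
  rw [dyadicSum_eq, hu, hQ, h1]
  linear_combination (Q * (B - B ^ (2 ^ M)) + Q ^ 2) * h4

/-! ### Rational generating series over `ℤ/4`. -/

open PowerSeries

lemma four_eq_zero_powerSeries : (4 : (ZMod 4)⟦X⟧) = 0 := by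
  have h : (4 : (ZMod 4)⟦X⟧) = C (4 : ZMod 4) := (map_ofNat C 4).symm
  rw [h, show (4 : ZMod 4) = 0 from rfl, map_zero]

/-- The power series `1/(1 - X)`. -/
def geomSeries : (ZMod 4)⟦X⟧ := (invOneSubPow (ZMod 4) 1).val

lemma one_sub_mul_geomSeries : (1 - X) * geomSeries = 1 := by
  have h := (invOneSubPow (ZMod 4) 1).inv_val
  rwa [invOneSubPow_inv_eq_one_sub_pow, pow_one] at h

/-- The power series `1/(1 + X²)`. -/
def altSeries : (ZMod 4)⟦X⟧ := invOfUnit (1 + X ^ 2) 1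

lemma one_add_sq_mul_altSeries : (1 + X ^ 2) * altSeries = 1 :=
  mul_invOfUnit _ _ (by simp)

/-- The power series `X/(1 - X)²`. -/
def kroneckerSeries : (ZMod 4)⟦X⟧ := X * geomSeries ^ 2

lemma coeff_kroneckerSeries_pow (n N : ℕ) :
    coeff N (kroneckerSeries ^ n * geomSeries) = (((N + n).choose (2 * n) : ℕ) : ZMod 4) := by
  have h1 : geomSeries ^ (2 * n + 1) = (invOneSubPow (ZMod 4) (2 * n + 1)).val := by
    have : (invOneSubPow (ZMod 4) (2 * n + 1)) = (invOneSubPow (ZMod 4) 1) ^ (2 * n + 1) := by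
      rw [invOneSubPow_eq_inv_one_sub_pow, invOneSubPow_eq_inv_one_sub_pow, pow_one]
    rw [this]; rfl
  have h2 : kroneckerSeries ^ n * geomSeries = X ^ n * (invOneSubPow (ZMod 4) (2 * n + 1)).val := by
    rw [← h1, kroneckerSeries]; ring
  rw [h2, coeff_X_pow_mul', invOneSubPow_val_succ_eq_mk_add_choose]
  split_ifs with h
  · rw [coeff_mk, show 2 * n + (N - n) = N + n by omega]
  · rw [Nat.choose_eq_zero_of_lt (by omega), Nat.cast_zero]

lemma one_sub_pow_four_mul_mk (q : ZMod 4 → ZMod 4) :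
    (1 - X ^ 4) * (mk fun n : ℕ => q n) = C (q 0) + C (q 1) * X + C (q 2) * X ^ 2 +
      C (q 3) * X ^ 3 := by
  ext n
  rw [sub_mul, one_mul, map_sub, coeff_X_pow_mul', coeff_mk]
  simp only [map_add, coeff_C_mul, coeff_X_pow, coeff_C, coeff_X]
  match n with
  | 0 => simp
  | 1 => simp
  | 2 => simp
  | 3 => simp
  | n + 4 =>
    have : ((n + 4 : ℕ) : ZMod 4) = n := by
      push_cast; rw [show (4 : ZMod 4) = 0 from rfl, add_zero]
    simp [this]

lemma coeff_eq_of_one_sub_pow_four_mul {G : (ZMod 4)⟦X⟧} {q : ZMod 4 → ZMod 4}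
    (h : (1 - X ^ 4) * G = C (q 0) + C (q 1) * X + C (q 2) * X ^ 2 + C (q 3) * X ^ 3) (N : ℕ) :
    coeff N G = q N := by
  have h1 : (1 - X ^ 4) * G = (1 - X ^ 4) * (mk fun n : ℕ => q n) := by
    rw [h, one_sub_pow_four_mul_mk]
  have h2 : IsUnit (1 - X ^ 4 : (ZMod 4)⟦X⟧) := by
    rw [isUnit_iff_constantCoeff]; simp
  rw [h2.mul_left_cancel h1, coeff_mk]

lemma geomSeries_sq_mul : geomSeries ^ 2 * (1 + X) ^ 2 = 1 := by
  linear_combination geomSeries ^ 2 * X * four_eq_zero_powerSeries +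
    ((1 - X) * geomSeries + 1) * one_sub_mul_geomSeries

/-- Modulo 4, `(1-X)^4 = 1 + 2X² + X^4 = (1+X²)²`. -/
lemma geomSeries_pow_four : geomSeries ^ 4 = altSeries ^ 2 := by
  have hV : (1 - X) ^ 4 * geomSeries ^ 4 = 1 := by
    rw [← mul_pow, one_sub_mul_geomSeries, one_pow]
  have hW : (1 + X ^ 2) ^ 2 * altSeries ^ 2 = 1 := by
    rw [← mul_pow, one_add_sq_mul_altSeries, one_pow]
  linear_combination altSeries ^ 2 * hV - geomSeries ^ 4 * hW +
    geomSeries ^ 4 * altSeries ^ 2 * (X - X ^ 2 + X ^ 3) * four_eq_zero_powerSeries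

lemma kroneckerSeries_sq :
    kroneckerSeries ^ 2 = X ^ 2 * altSeries - (X ^ 2 * altSeries) ^ 2 := by
  rw [kroneckerSeries]
  linear_combination X ^ 2 * geomSeries_pow_four + X ^ 2 * altSeries * one_add_sq_mul_altSeries

lemma kroneckerSeries_add_two_mul :
    kroneckerSeries + 2 * kroneckerSeries ^ 2 = X * altSeries := by
  have h1 : geomSeries ^ 2 = (1 - X) ^ 2 * altSeries ^ 2 := by
    rw [← geomSeries_pow_four]
    linear_combination -geomSeries ^ 2 * ((1 - X) * geomSeries + 1) * one_sub_mul_geomSeries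
  have h2 : kroneckerSeries ^ 2 = X ^ 2 * altSeries ^ 2 := by
    rw [kroneckerSeries, ← geomSeries_pow_four]; ring
  rw [h2, kroneckerSeries, h1]
  linear_combination X * altSeries * one_add_sq_mul_altSeries

lemma kroneckerSeries_mul : kroneckerSeries * (1 + X) ^ 2 = X := by
  rw [kroneckerSeries, mul_assoc, geomSeries_sq_mul, mul_one]

lemma one_sub_pow_four_mul_geomSeries (G : (ZMod 4)⟦X⟧) :
    (1 - X ^ 4) * (G * geomSeries) = G * ((1 + X) * (1 + X ^ 2)) := by
  linear_combination G * (1 + X) * (1 + X ^ 2) * one_sub_mul_geomSeries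

/-- Take `B = X²/(1+X²)`: the error term carries `B^{2^M}`, hence the factor `X^{2^{M+1}}`, and is
invisible in degree `N`. -/
lemma coeff_mul_dyadicSum (K : (ZMod 4)⟦X⟧) {N M : ℕ} (h : N < 2 ^ (M + 1)) :
    coeff N (dyadicSum M kroneckerSeries * K) = coeff N (X ^ 2 * altSeries * K) := by
  obtain ⟨Z, hZ⟩ := exists_dyadicSum_eq four_eq_zero_powerSeries kroneckerSeries_sq M
  have h1 : dyadicSum M kroneckerSeries * K =
      X ^ 2 * altSeries * K + X ^ (2 ^ (M + 1)) * (altSeries ^ (2 ^ M) * Z * K) := by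
    rw [hZ, mul_pow, ← pow_mul, ← pow_succ']; ring
  rw [h1, map_add, coeff_X_pow_mul', if_neg (by omega), add_zero]

lemma coeff_D0110 (N : ℕ) :
    coeff N ((kroneckerSeries + 2 * kroneckerSeries ^ 2) * geomSeries) =
      if (N : ZMod 4) = 1 ∨ (N : ZMod 4) = 2 then 1 else 0 := by
  refine coeff_eq_of_one_sub_pow_four_mul (q := fun t => if t = 1 ∨ t = 2 then 1 else 0) ?_ N
  rw [one_sub_pow_four_mul_geomSeries, kroneckerSeries_add_two_mul]
  trans X + X ^ 2
  · linear_combination X * (1 + X) * one_add_sq_mul_altSeries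
  · have h : (3 : ZMod 4) ≠ 1 ∧ (3 : ZMod 4) ≠ 2 ∧ (0 : ZMod 4) ≠ 1 ∧ (0 : ZMod 4) ≠ 2 := by decide
    simp [h]

lemma coeff_D0011 {N M : ℕ} (h : N < 2 ^ (M + 1)) :
    coeff N (dyadicSum M kroneckerSeries * geomSeries) =
      if (N : ZMod 4) = 2 ∨ (N : ZMod 4) = 3 then 1 else 0 := by
  rw [coeff_mul_dyadicSum _ h]
  refine coeff_eq_of_one_sub_pow_four_mul (q := fun t => if t = 2 ∨ t = 3 then 1 else 0) ?_ N
  rw [one_sub_pow_four_mul_geomSeries]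
  trans X ^ 2 + X ^ 3
  · linear_combination X ^ 2 * (1 + X) * one_add_sq_mul_altSeries
  · have h : (0 : ZMod 4) ≠ 2 ∧ (0 : ZMod 4) ≠ 3 ∧ (1 : ZMod 4) ≠ 2 ∧ (1 : ZMod 4) ≠ 3 := by decide
    simp [h]

lemma coeff_D0010 {N M : ℕ} (h : N < 2 ^ (M + 1)) :
    coeff N ((2 * kroneckerSeries ^ 3 + kroneckerSeries ^ 2 +
      kroneckerSeries * dyadicSum M kroneckerSeries) * geomSeries) =
      if (N : ZMod 4) = 2 then 1 else 0 := by
  rw [show (2 * kroneckerSeries ^ 3 + kroneckerSeries ^ 2 +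
      kroneckerSeries * dyadicSum M kroneckerSeries) * geomSeries =
      (2 * kroneckerSeries ^ 3 + kroneckerSeries ^ 2) * geomSeries +
      dyadicSum M kroneckerSeries * (kroneckerSeries * geomSeries) by ring, map_add,
    coeff_mul_dyadicSum _ h, ← map_add]
  refine coeff_eq_of_one_sub_pow_four_mul (q := fun t => if t = 2 then 1 else 0) ?_ N
  trans X ^ 2
  · rw [show (2 * kroneckerSeries ^ 3 + kroneckerSeries ^ 2) * geomSeries +
      X ^ 2 * altSeries * (kroneckerSeries * geomSeries) =
      (2 * kroneckerSeries ^ 3 + kroneckerSeries ^ 2 + X ^ 2 * altSeries * kroneckerSeries) *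
        geomSeries by ring, one_sub_pow_four_mul_geomSeries]
    linear_combination kroneckerSeries * (1 + X) * (1 + X ^ 2) * kroneckerSeries_add_two_mul +
      X * altSeries * (1 + X ^ 2) * kroneckerSeries_mul + X ^ 2 * one_add_sq_mul_altSeries
  · have h : (0 : ZMod 4) ≠ 2 ∧ (1 : ZMod 4) ≠ 2 ∧ (3 : ZMod 4) ≠ 2 := by decide
    simp [h]

lemma coeff_E0101 (N : ℕ) :
    coeff N (kroneckerSeries * (geomSeries * (1 + X))) =
      if (N : ZMod 4) = 1 ∨ (N : ZMod 4) = 3 then 1 else 0 := by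
  refine coeff_eq_of_one_sub_pow_four_mul (q := fun t => if t = 1 ∨ t = 3 then 1 else 0) ?_ N
  rw [show kroneckerSeries * (geomSeries * (1 + X)) = kroneckerSeries * (1 + X) * geomSeries by ring,
    one_sub_pow_four_mul_geomSeries]
  trans X + X ^ 3
  · linear_combination (1 + X ^ 2) * kroneckerSeries_mul
  · have h : (2 : ZMod 4) ≠ 1 ∧ (2 : ZMod 4) ≠ 3 ∧ (0 : ZMod 4) ≠ 1 ∧ (0 : ZMod 4) ≠ 3 := by decide
    simp [h]

lemma coeff_E0010 (N : ℕ) :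
    coeff N ((kroneckerSeries ^ 2 + 2 * kroneckerSeries ^ 3) * (geomSeries * (1 + X))) =
      if (N : ZMod 4) = 2 then 1 else 0 := by
  refine coeff_eq_of_one_sub_pow_four_mul (q := fun t => if t = 2 then 1 else 0) ?_ N
  rw [show (kroneckerSeries ^ 2 + 2 * kroneckerSeries ^ 3) * (geomSeries * (1 + X)) =
    (kroneckerSeries ^ 2 + 2 * kroneckerSeries ^ 3) * (1 + X) * geomSeries by ring,
    one_sub_pow_four_mul_geomSeries]
  trans X ^ 2
  · linear_combination kroneckerSeries * (1 + X) ^ 2 * (1 + X ^ 2) * kroneckerSeries_add_two_mul +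
      X * altSeries * (1 + X ^ 2) * kroneckerSeries_mul + X ^ 2 * one_add_sq_mul_altSeries
  · have h : (0 : ZMod 4) ≠ 2 ∧ (1 : ZMod 4) ≠ 2 ∧ (3 : ZMod 4) ≠ 2 := by decide
    simp [h]

lemma coeff_E0001 {N M : ℕ} (h : N < 2 ^ (M + 1)) :
    coeff N (kroneckerSeries * dyadicSum M kroneckerSeries * (geomSeries * (1 + X))) =
      if (N : ZMod 4) = 3 then 1 else 0 := by
  rw [mul_comm kroneckerSeries, mul_assoc, coeff_mul_dyadicSum _ h]
  refine coeff_eq_of_one_sub_pow_four_mul (q := fun t => if t = 3 then 1 else 0) ?_ N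
  rw [show X ^ 2 * altSeries * (kroneckerSeries * (geomSeries * (1 + X))) =
    X ^ 2 * altSeries * (kroneckerSeries * (1 + X)) * geomSeries by ring,
    one_sub_pow_four_mul_geomSeries]
  trans X ^ 3
  · linear_combination X ^ 2 * altSeries * (1 + X ^ 2) * kroneckerSeries_mul +
      X ^ 3 * one_add_sq_mul_altSeries
  · have h : (0 : ZMod 4) ≠ 3 ∧ (1 : ZMod 4) ≠ 3 ∧ (2 : ZMod 4) ≠ 3 := by decide
    simp [h]

end Periodic

/-! ### Values of the integer-valued polynomials -/

lemma choose_succ_succ_mul_cast (n k : ℕ) :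
    ((n + 1).choose (k + 1) : ℝ) * (k + 1) = (n + 1) * n.choose k := by
  exact_mod_cast (Nat.add_one_mul_choose_eq n k).symm

/-- The new factor at `x = N + 1/2` is `(N-n)(N+n+1)`, the numerator of the ratio of consecutive
binomial coefficients. -/
lemma polyD_add_half (n N : ℕ) : polyD n (N + 1 / 2) = (N + n).choose (2 * n) := by
  induction n with
  | zero => simp [polyD]
  | succ n ih =>
    have h1 : polyD (n + 1) (N + 1 / 2) * ((2 * n + 1) * (2 * n + 2)) =
        polyD n (N + 1 / 2) * ((N - n) * (N + n + 1)) := by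
      rw [polyD, polyD, Finset.prod_range_succ, show 2 * (n + 1) = 2 * n + 1 + 1 by ring,
        Nat.factorial_succ, Nat.factorial_succ]
      have := Nat.factorial_ne_zero (2 * n)
      push_cast
      field_simp
      ring
    have h2 := choose_succ_succ_mul_cast (N + n) (2 * n + 1)
    have h3 := choose_succ_mul_cast (N + n) (2 * n)
    rw [ih] at h1
    have h4 : ((2 * n + 1) * (2 * n + 2) : ℝ) ≠ 0 := by positivity
    apply mul_right_cancel₀ h4
    rw [h1, show N + (n + 1) = N + n + 1 by ring, show 2 * (n + 1) = 2 * n + 1 + 1 by ring]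
    push_cast at h2 h3 ⊢
    linear_combination -(2 * n + 1) * h2 - (N + n + 1) * h3

lemma polyE_natCast {n : ℕ} (hn : 1 ≤ n) (N : ℕ) :
    polyE n N = ((N + n).choose (2 * n) + (N + n - 1).choose (2 * n) : ℕ) := by
  induction n, hn using Nat.le_induction with
  | base =>
    have h2 := choose_succ_mul_cast N 1
    have h3 := choose_succ_mul_cast (N + 1) 1
    simp only [polyE, Nat.choose_one_right, Nat.factorial] at h2 h3 ⊢
    push_cast at h2 h3 ⊢
    simp
    linear_combination -h2 / 2 - h3 / 2
  | succ n hn ih =>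
    have h1 : polyE (n + 1) N * ((2 * n + 1) * (2 * n + 2)) = polyE n N * (N ^ 2 - n ^ 2) := by
      rw [polyE, polyE, if_neg (by omega), if_neg (by omega), Finset.prod_range_succ,
        show 2 * (n + 1) = 2 * n + 1 + 1 by ring, Nat.factorial_succ, Nat.factorial_succ]
      have := Nat.factorial_ne_zero (2 * n)
      push_cast
      field_simp
      ring
    obtain ⟨K, hK⟩ : ∃ K, N + n = K + 1 := ⟨N + n - 1, by omega⟩
    have hK' : (N + n : ℝ) = K + 1 := by exact_mod_cast hK
    have a1 := choose_succ_succ_mul_cast (K + 1) (2 * n + 1)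
    have a2 := choose_succ_mul_cast (K + 1) (2 * n)
    have a3 := choose_succ_succ_mul_cast K (2 * n + 1)
    have a4 := choose_succ_mul_cast K (2 * n)
    have a5 := choose_succ_succ_mul_cast K (2 * n)
    rw [ih] at h1
    have h4 : ((2 * n + 1) * (2 * n + 2) : ℝ) ≠ 0 := by positivity
    apply mul_right_cancel₀ h4
    rw [h1, show N + (n + 1) = K + 1 + 1 by omega, show 2 * (n + 1) = 2 * n + 1 + 1 by ring, hK,
      Nat.add_sub_cancel, Nat.add_sub_cancel]
    have hN : (N : ℝ) = K + 1 - n := by linarith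
    rw [hN]
    push_cast at a1 a2 a3 a4 a5 ⊢
    linear_combination -(K + 1) * (a2 - a5) - (2 * n + 1) * a1 - (K + 2) * a5 -
      (2 * n + 1) * a3 - (K + 1) * a4

lemma tsum_dyadic {f : ℕ → ℝ} {N : ℕ} (hf : ∀ n, N < n → f n = 0) :
    (∑' n : ℕ, if 1 ≤ n then f (2 ^ n) + ∑ j ∈ Finset.Ico 1 n, 2 * f (2 ^ n + 2 ^ j) else 0) =
      dyadicComb N f := by
  refine tsum_eq_sum fun n hn => ?_
  have hN : N < 2 ^ n := by
    have := Nat.lt_two_pow_self (n := n)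
    rw [Finset.mem_range] at hn
    omega
  rw [hf _ hN, Finset.sum_eq_zero fun j _ => by rw [hf _ (by lia), mul_zero], add_zero, ite_self]

/-- Here the outer sum starts at `n = 0`, whose inner sum is empty; that term is the isolated `f 2`.
-/
lemma tsum_dyadic_succ {f : ℕ → ℝ} {N : ℕ} (hf : ∀ n, N < n → f n = 0) :
    (∑' n : ℕ, (f (2 ^ n + 1) + ∑ j ∈ Finset.Ico 1 n, 2 * f (2 ^ n + 1 + 2 ^ j))) =
      f 2 + dyadicComb N fun n => f (n + 1) := by
  rw [tsum_eq_sum (s := Finset.range (N + 1)), dyadicComb, Finset.sum_range_succ',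
    Finset.sum_range_succ' _ N]
  · simp [add_comm (f 2), add_right_comm]
  · intro n hn
    have hN : N < 2 ^ n := by
      have := Nat.lt_two_pow_self (n := n)
      rw [Finset.mem_range] at hn
      omega
    rw [hf _ (by omega), Finset.sum_eq_zero fun j _ => by rw [hf _ (by lia), mul_zero], add_zero]

lemma dyadicComb_natCast {S : Type*} [Semiring S] (M : ℕ) (f : ℕ → ℕ) :
    ((dyadicComb M f : ℕ) : S) = dyadicComb M fun n => (f n : S) :=
  map_dyadicComb (Nat.castAddMonoidHom S) M f

lemma polyD_eq_zero {n N : ℕ} (h : N < n) : polyD n (N + 1 / 2) = 0 := by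
  rw [polyD_add_half, Nat.choose_eq_zero_of_lt (by omega), Nat.cast_zero]

lemma polyE_eq_zero {n N : ℕ} (h : N < n) : polyE n N = 0 := by
  rw [polyE_natCast (by omega), Nat.choose_eq_zero_of_lt (by omega),
    Nat.choose_eq_zero_of_lt (by omega), Nat.cast_zero]

open PowerSeries

lemma coeff_kroneckerSeries_pow_mul {n : ℕ} (hn : 1 ≤ n) (N : ℕ) :
    coeff N (kroneckerSeries ^ n * (geomSeries * (1 + X))) =
      (((N + n).choose (2 * n) + (N + n - 1).choose (2 * n) : ℕ) : ZMod 4) := by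
  rw [show kroneckerSeries ^ n * (geomSeries * (1 + X)) = kroneckerSeries ^ n * geomSeries +
    kroneckerSeries ^ n * geomSeries * X by ring, map_add, coeff_kroneckerSeries_pow]
  cases N with
  | zero =>
    rw [coeff_zero_mul_X, Nat.choose_eq_zero_of_lt (by omega),
      Nat.choose_eq_zero_of_lt (by omega)]
    simp
  | succ N =>
    rw [coeff_succ_mul_X, coeff_kroneckerSeries_pow, show N + 1 + n - 1 = N + n by omega]
    push_cast
    rfl

lemma coeff_mul_dyadicSum_mul (K G : (ZMod 4)⟦X⟧) (N M : ℕ) :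
    coeff N (K * dyadicSum M kroneckerSeries * G) =
      dyadicComb M fun n => coeff N (K * kroneckerSeries ^ n * G) := by
  rw [dyadicSum, mul_right_comm, mul_dyadicComb]
  simp only [mul_right_comm K _ G]
  exact map_dyadicComb (coeff N : (ZMod 4)⟦X⟧ →ₗ[ZMod 4] ZMod 4).toAddMonoidHom M
    fun n => K * G * kroneckerSeries ^ n

lemma lt_two_pow_succ (N : ℕ) : N < 2 ^ (N + 1) :=
  Nat.lt_two_pow_self.trans (Nat.pow_lt_pow_right (by norm_num) (by omega))

lemma exists_D0110_eq (N : ℕ) : ∃ v : ℕ, D0110 (N + 1 / 2) = v ∧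
    (v : ZMod 4) = if (N : ZMod 4) = 1 ∨ (N : ZMod 4) = 2 then 1 else 0 := by
  refine ⟨(N + 1).choose (2 * 1) + 2 * (N + 2).choose (2 * 2), ?_, ?_⟩
  · rw [D0110, polyD_add_half, polyD_add_half]; push_cast; rfl
  · rw [← coeff_D0110, show (kroneckerSeries + 2 * kroneckerSeries ^ 2) * geomSeries =
      kroneckerSeries ^ 1 * geomSeries + (kroneckerSeries ^ 2 * geomSeries +
        kroneckerSeries ^ 2 * geomSeries) by ring]
    simp only [map_add, coeff_kroneckerSeries_pow]
    push_cast
    ring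

lemma exists_D0011_eq (N : ℕ) : ∃ v : ℕ, D0011 (N + 1 / 2) = v ∧
    (v : ZMod 4) = if (N : ZMod 4) = 2 ∨ (N : ZMod 4) = 3 then 1 else 0 := by
  refine ⟨dyadicComb N fun n => (N + n).choose (2 * n), ?_, ?_⟩
  · rw [D0011, tsum_dyadic (f := fun n => polyD n (N + 1 / 2)) fun n => polyD_eq_zero,
      dyadicComb_natCast]
    simp only [polyD_add_half]
  · rw [← coeff_D0011 (lt_two_pow_succ N), ← one_mul (dyadicSum _ _), coeff_mul_dyadicSum_mul,
      dyadicComb_natCast]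
    simp only [one_mul, coeff_kroneckerSeries_pow]

lemma exists_D0010_eq (N : ℕ) : ∃ v : ℕ, D0010 (N + 1 / 2) = v ∧
    (v : ZMod 4) = if (N : ZMod 4) = 2 then 1 else 0 := by
  refine ⟨2 * (N + 3).choose (2 * 3) + ((N + 2).choose (2 * 2) +
    dyadicComb N fun n => (N + (n + 1)).choose (2 * (n + 1))), ?_, ?_⟩
  · rw [D0010, tsum_dyadic_succ (f := fun n => polyD n (N + 1 / 2)) fun n => polyD_eq_zero]
    simp only [polyD_add_half]
    rw [Nat.cast_add, Nat.cast_add, dyadicComb_natCast]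
    push_cast
    rfl
  · rw [← coeff_D0010 (lt_two_pow_succ N), show (2 * kroneckerSeries ^ 3 + kroneckerSeries ^ 2 +
      kroneckerSeries * dyadicSum N kroneckerSeries) * geomSeries =
      kroneckerSeries ^ 3 * geomSeries + kroneckerSeries ^ 3 * geomSeries +
      (kroneckerSeries ^ 2 * geomSeries +
      kroneckerSeries * dyadicSum N kroneckerSeries * geomSeries) by ring, map_add, map_add, map_add,
      coeff_mul_dyadicSum_mul, Nat.cast_add, Nat.cast_add, dyadicComb_natCast]
    simp only [← pow_succ', coeff_kroneckerSeries_pow]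
    push_cast
    ring

lemma exists_E0101_eq (N : ℕ) : ∃ v : ℕ, E0101 N = v ∧
    (v : ZMod 4) = if (N : ZMod 4) = 1 ∨ (N : ZMod 4) = 3 then 1 else 0 := by
  refine ⟨_, polyE_natCast le_rfl N, ?_⟩
  rw [← coeff_E0101, ← coeff_kroneckerSeries_pow_mul le_rfl, pow_one]

lemma exists_E0010_eq (N : ℕ) : ∃ v : ℕ, E0010 N = v ∧
    (v : ZMod 4) = if (N : ZMod 4) = 2 then 1 else 0 := by
  refine ⟨((N + 2).choose (2 * 2) + (N + 2 - 1).choose (2 * 2)) +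
    2 * ((N + 3).choose (2 * 3) + (N + 3 - 1).choose (2 * 3)), ?_, ?_⟩
  · rw [E0010, polyE_natCast (by norm_num), polyE_natCast (by norm_num)]; push_cast; rfl
  · rw [← coeff_E0010, show (kroneckerSeries ^ 2 + 2 * kroneckerSeries ^ 3) *
      (geomSeries * (1 + X)) = kroneckerSeries ^ 2 * (geomSeries * (1 + X)) +
      (kroneckerSeries ^ 3 * (geomSeries * (1 + X)) +
        kroneckerSeries ^ 3 * (geomSeries * (1 + X))) by ring, map_add, map_add,
      coeff_kroneckerSeries_pow_mul (by norm_num), coeff_kroneckerSeries_pow_mul (by norm_num)]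
    push_cast
    ring

lemma exists_E0001_eq (N : ℕ) : ∃ v : ℕ, E0001 N = v ∧
    (v : ZMod 4) = if (N : ZMod 4) = 3 then 1 else 0 := by
  refine ⟨dyadicComb N fun n => (N + (n + 1)).choose (2 * (n + 1)) +
    (N + (n + 1) - 1).choose (2 * (n + 1)), ?_, ?_⟩
  · have h := tsum_dyadic (f := fun n => polyE (n + 1) N) (N := N)
      fun n hn => polyE_eq_zero (by omega)
    rw [dyadicComb_natCast]
    simp only [← polyE_natCast (Nat.succ_le_succ (Nat.zero_le _))]
    rw [← h, E0001]
    simp only [add_right_comm]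
  · rw [← coeff_E0001 (lt_two_pow_succ N), coeff_mul_dyadicSum_mul, dyadicComb_natCast]
    simp only [← pow_succ', coeff_kroneckerSeries_pow_mul (Nat.succ_le_succ (Nat.zero_le _))]

/-! ### The phases -/

lemma exists_phaseFun_even (m : ℕ) (h : Even m) (a b c d : Fin 4) (N : ℕ) :
    ∃ v : ℕ, phaseFun m a b c d N = v ∧
      (v : ZMod 4) = (a : ℕ) + (b : ℕ) * (if (N : ZMod 4) = 1 ∨ (N : ZMod 4) = 3 then 1 else 0) +
        (c : ℕ) * (if (N : ZMod 4) = 2 then 1 else 0) +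
        (d : ℕ) * (if (N : ZMod 4) = 3 then 1 else 0) := by
  obtain ⟨v₁, h₁, h₁'⟩ := exists_E0101_eq N
  obtain ⟨v₂, h₂, h₂'⟩ := exists_E0010_eq N
  obtain ⟨v₃, h₃, h₃'⟩ := exists_E0001_eq N
  refine ⟨(a : ℕ) + (b : ℕ) * v₁ + (c : ℕ) * v₂ + (d : ℕ) * v₃, ?_, ?_⟩
  · rw [phaseFun, if_pos h, h₁, h₂, h₃]; push_cast; rfl
  · rw [← h₁', ← h₂', ← h₃']; push_cast; rfl

lemma exists_phaseFun_odd (m : ℕ) (h : ¬Even m) (a b c d : Fin 4) (N : ℕ) :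
    ∃ v : ℕ, phaseFun m a b c d (N + 1 / 2) = v ∧
      (v : ZMod 4) = (a : ℕ) + (b : ℕ) * (if (N : ZMod 4) = 1 ∨ (N : ZMod 4) = 2 then 1 else 0) +
        (c : ℕ) * (if (N : ZMod 4) = 2 ∨ (N : ZMod 4) = 3 then 1 else 0) +
        (d : ℕ) * (if (N : ZMod 4) = 2 then 1 else 0) := by
  obtain ⟨v₁, h₁, h₁'⟩ := exists_D0110_eq N
  obtain ⟨v₂, h₂, h₂'⟩ := exists_D0011_eq N
  obtain ⟨v₃, h₃, h₃'⟩ := exists_D0010_eq N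
  refine ⟨(a : ℕ) + (b : ℕ) * v₁ + (c : ℕ) * v₂ + (d : ℕ) * v₃, ?_, ?_⟩
  · rw [phaseFun, if_neg h, h₁, h₂, h₃]; push_cast; rfl
  · rw [← h₁', ← h₂', ← h₃']; push_cast; rfl

/-- The residue of `phaseFun m a b c d` modulo 4 as a function of `k`. -/
def phaseResidue (m : ℕ) (a b c d : Fin 4) (t : ZMod 4) : ZMod 4 :=
  if Even m then
    (a : ℕ) + (b : ℕ) * (if t = 1 ∨ t = 3 then 1 else 0) + (c : ℕ) * (if t = 2 then 1 else 0) +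
        (d : ℕ) * (if t = 3 then 1 else 0)
  else
    (a : ℕ) + (b : ℕ) * (if t = 1 ∨ t = 2 then 1 else 0) +
        (c : ℕ) * (if t = 2 ∨ t = 3 then 1 else 0) + (d : ℕ) * (if t = 2 then 1 else 0)

/-- The shift is `m/2 - 1` for even `m` and `(m-3)/2` for odd `m`; it depends on neither `k` nor the
coefficients. -/
lemma exists_phaseFun_lagParam {m : ℕ} (hm : 2 ≤ m) : ∃ s : ℕ, ∀ (a b c d : Fin 4) (k : ℕ),
    ∃ v : ℕ, phaseFun m a b c d (lagParam m k) = v ∧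
      (v : ZMod 4) = phaseResidue m a b c d (k + s) := by
  by_cases h : Even m
  · obtain ⟨n, rfl⟩ := h
    obtain ⟨s, rfl⟩ : ∃ s, n = s + 1 := ⟨n - 1, by omega⟩
    refine ⟨s, fun a b c d k => ?_⟩
    have h : Even (s + 1 + (s + 1)) := ⟨_, rfl⟩
    obtain ⟨v, h₁, h₂⟩ := exists_phaseFun_even _ h a b c d (k + s)
    refine ⟨v, ?_, ?_⟩
    · rw [← h₁, lagParam]; congr 1; push_cast; ring
    · rw [phaseResidue, if_pos h, h₂]; push_cast; rfl
  · obtain ⟨n, rfl⟩ := Nat.not_even_iff_odd.mp h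
    obtain ⟨s, rfl⟩ : ∃ s, n = s + 1 := ⟨n - 1, by omega⟩
    refine ⟨s, fun a b c d k => ?_⟩
    obtain ⟨v, h₁, h₂⟩ := exists_phaseFun_odd _ h a b c d (k + s)
    refine ⟨v, ?_, ?_⟩
    · rw [← h₁, lagParam]; congr 1; push_cast; ring
    · rw [phaseResidue, if_neg h, h₂]; push_cast; rfl

/-- For even `m` the values at 0, 1, 2, 3 are `a`, `a+b`, `a+c`, `a+b+d`; for odd `m` they are `a`,
`a+b`, `a+b+c+d`, `a+c`. Both systems are triangular with unit pivots. -/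
lemma exists_phaseResidue_eq (m : ℕ) (θ : ZMod 4 → ZMod 4) :
    ∃ a b c d : Fin 4, ∀ t, phaseResidue m a b c d t = θ t := by
  have hcast : ∀ x : ZMod 4, ∃ a : Fin 4, ((a : ℕ) : ZMod 4) = x := by decide
  have hval : ∀ t : ZMod 4, t = 0 ∨ t = 1 ∨ t = 2 ∨ t = 3 := by decide
  obtain ⟨a, ha⟩ := hcast (θ 0)
  obtain ⟨b, hb⟩ := hcast (θ 1 - θ 0)
  have h : (0 : ZMod 4) ≠ 1 ∧ (0 : ZMod 4) ≠ 2 ∧ (0 : ZMod 4) ≠ 3 ∧ (1 : ZMod 4) ≠ 2 ∧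
    (1 : ZMod 4) ≠ 3 ∧ (2 : ZMod 4) ≠ 1 ∧ (2 : ZMod 4) ≠ 3 ∧ (3 : ZMod 4) ≠ 1 ∧
    (3 : ZMod 4) ≠ 2 := by decide
  by_cases hm : Even m
  · obtain ⟨c, hc⟩ := hcast (θ 2 - θ 0)
    obtain ⟨d, hd⟩ := hcast (θ 3 - θ 1)
    refine ⟨a, b, c, d, fun t => ?_⟩
    simp only [phaseResidue, if_pos hm, ha, hb, hc, hd]
    rcases hval t with rfl | rfl | rfl | rfl <;> simp [h]
  · obtain ⟨c, hc⟩ := hcast (θ 3 - θ 0)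
    obtain ⟨d, hd⟩ := hcast (θ 2 - θ 1 - θ 3 + θ 0)
    refine ⟨a, b, c, d, fun t => ?_⟩
    simp only [phaseResidue, if_neg hm, ha, hb, hc, hd]
    rcases hval t with rfl | rfl | rfl | rfl <;> simp [h]
    ring

lemma exp_I_mul_natCast (n : ℕ) :
    Complex.exp (Complex.I * (Real.pi / 2 : ℝ) * ((n : ℝ) : ℂ)) = Complex.I ^ n := by
  rw [show Complex.I * (Real.pi / 2 : ℝ) * ((n : ℝ) : ℂ) = n * (Real.pi / 2 * Complex.I) by
    push_cast; ring, Complex.exp_nat_mul, Complex.exp_pi_div_two_mul_I]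

lemma I_pow_eq_of_natCast_eq {n n' : ℕ} (h : (n : ZMod 4) = n') : Complex.I ^ n = Complex.I ^ n' := by
  rw [Complex.I_pow_eq_pow_mod, Complex.I_pow_eq_pow_mod n', (ZMod.natCast_eq_natCast_iff' _ _ 4).mp h]

lemma exists_I_pow_eq {z : ℂ} (h : z ^ 4 = 1) : ∃ r : ZMod 4, z = Complex.I ^ r.val := by
  have h1 : (z - 1) * (z - Complex.I) * (z + 1) * (z + Complex.I) = 0 := by
    linear_combination h + (1 - z ^ 2) * Complex.I_sq
  have hv : (0 : ZMod 4).val = 0 ∧ (1 : ZMod 4).val = 1 ∧ (2 : ZMod 4).val = 2 ∧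
    (3 : ZMod 4).val = 3 := by decide
  simp only [mul_eq_zero] at h1
  rcases h1 with ((h1 | h1) | h1) | h1
  · exact ⟨0, by rw [hv.1]; linear_combination h1⟩
  · exact ⟨1, by rw [hv.2.1]; linear_combination h1⟩
  · exact ⟨2, by rw [hv.2.2.1, Complex.I_sq]; linear_combination h1⟩
  · exact ⟨3, by rw [hv.2.2.2, Complex.I_pow_three]; linear_combination h1⟩

/-- There is a shift `s` such that the multiplier of the exponential product is `(-1)^j i^n` with
`n` congruent to `phaseResidue m a b c d (k + s) + k` modulo 4. -/
lemma exists_phaseMult_eq {m : ℕ} (hm : 2 ≤ m) : ∃ s : ℕ, ∀ (a b c d : Fin 4) (j k : ℕ),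
    phaseMult m (phaseFun m a b c d) j k =
      (-1) ^ j * Complex.I ^ (phaseResidue m a b c d (k + s) + k).val := by
  obtain ⟨s, hs⟩ := exists_phaseFun_lagParam hm
  refine ⟨s, fun a b c d j k => ?_⟩
  obtain ⟨v, h₁, h₂⟩ := hs a b c d k
  have h3 : Complex.I ^ (phaseResidue m a b c d (k + s) + k).val = Complex.I ^ (v + k) :=
    I_pow_eq_of_natCast_eq (by rw [ZMod.natCast_zmod_val, ← h₂]; push_cast; rfl)
  rw [phaseMult, h₁, exp_I_mul_natCast, show (2 * j + k : ℝ) = ((2 * j + k : ℕ) : ℝ) by push_cast; rfl,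
    exp_I_mul_natCast, h3, pow_add, pow_add, pow_mul, Complex.I_sq]
  ring

end GenFourier

end

/-! ### The classification. -/

theorem theorem2p9 (m : ℕ) (hm : 2 ≤ m) (ι : ℕ → Type*)
    (b : ∀ k, Module.Basis (ι k) ℂ (GenFourier.sphericalHarmonics m k)) :
    (∀ T : Module.End ℂ (GenFourier.Sch m),
      GenFourier.IsPeriodicTransform b T →
        ∃ a₀ a₁ a₂ a₃ : Fin 4,
          GenFourier.IsExpProduct (GenFourier.phaseFun m a₀ a₁ a₂ a₃) T) ∧
    (∀ a₀ a₁ a₂ a₃ : Fin 4,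
      (∃ T : Module.End ℂ (GenFourier.Sch m),
        GenFourier.IsExpProduct (GenFourier.phaseFun m a₀ a₁ a₂ a₃) T) ∧
      ∀ T : Module.End ℂ (GenFourier.Sch m),
        GenFourier.IsExpProduct (GenFourier.phaseFun m a₀ a₁ a₂ a₃) T →
          GenFourier.IsPeriodicTransform b T) := by
  obtain ⟨s, hs⟩ := GenFourier.exists_phaseMult_eq hm
  have h4 : (4 : ZMod 4) = 0 := rfl
  refine ⟨fun T hT => ?_, fun a₀ a₁ a₂ a₃ => ⟨?_, fun T hT => ?_⟩⟩
  · obtain ⟨ρ, hρ, hρ4, hT'⟩ := hT.exists_isMult hm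
    choose r hr using fun k => GenFourier.exists_I_pow_eq (hρ4 k)
    have hper : ∀ k, ρ (k % 4) = ρ k := fun k => (Function.Periodic.map_mod_nat hρ k)
    obtain ⟨a₀, a₁, a₂, a₃, h⟩ := GenFourier.exists_phaseResidue_eq m
      -- At `t = k + s` the difference `t - s` is `k` modulo 4. The residue of `F` must be the
      -- exponent of `ρ_k` minus `k`, since the second exponential already supplies `i^k`.
      fun t => r (t - s).val - (t - s)
    refine ⟨a₀, a₁, a₂, a₃, (GenFourier.isExpProduct_iff hm _ _).mpr ?_⟩
    convert hT' using 3 with j k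
    rw [hs, h, add_sub_cancel_right, sub_add_cancel, ← hr, ZMod.val_natCast, hper]
  · obtain ⟨T, hT⟩ := GenFourier.exists_isMult (s := GenFourier.phaseMult m
      (GenFourier.phaseFun m a₀ a₁ a₂ a₃)) hm fun j k => by simp [hs]
    exact ⟨T, (GenFourier.isExpProduct_iff hm _ _).mpr hT⟩
  · rw [GenFourier.isExpProduct_iff hm] at hT
    have hT' : GenFourier.IsMult T fun j k => (-1) ^ j *
        Complex.I ^ (GenFourier.phaseResidue m a₀ a₁ a₂ a₃ (k + s) + k).val := by
      convert hT using 3 with j k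
      rw [hs]
    refine hT'.isPeriodicTransform hm b (fun k => ?_) fun k => ?_
    · push_cast; rw [h4, add_zero]
    · rw [← pow_mul, mul_comm, pow_mul, Complex.I_pow_four, one_pow]
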